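/- **Setting.** Let $\mathbb K$ be an algebraically closed field of characteristic $0$, and let $Q$ be a finite quiver with double $\overline Q$ (for every arrow $a$ of $Q$ an additional arrow $a^*$ in the opposite direction). Paths compose like functions: $a_1\cdots a_k$ is a path if the source of $a_i$ is the target of $a_{i+1}$. For an algebra $A$ let $A_\natural=A/[A,A]$ be the quotient by the span of the commutators. Put $\{a,a^*\}=1$, $\{a^*,a\}=-1$ for the arrows $a$ of $Q$, and $\{b,c\}=0$ for all other pairs of arrows of $\overline Q$. The space $(\mathbb K\overline Q)_\natural$ is a Lie algebra under the necklace bracket $$\{a_1\cdots a_k,\,b_1\cdots b_l\}=\sum_{i,j}\{a_i,b_j\}\,a_{i+1}\cdots a_k a_1\cdots a_{i-1}\,b_{j+1}\cdots b_l b_1\cdots b_{j-1}.$$ Let $\mathbf w=\sum_{a\in Q_1}(aa^*-a^*a)$ and let $\Pi Q=\mathbb K\overline Q/(\mathbf w)$ be the preprojective algebra. The necklace bracket descends along the projection $pr:(\mathbb K\overline Q)_\natural\to(\Pi Q)_\natural$ to a Lie bracket on $(\Pi Q)_\natural$. **The quantized necklace algebra.** $\mathbf N(Q)_\hbar$ is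 the $\mathbb K[\hbar]$-module generated by the products $X=X_1\&\cdots\&X_r$ (commutative in $\&$) of cyclic words $(a_1,h_1)\cdots(a_k,h_k)$ in $\overline Q$ with heights $h_i\in\mathbb N$ and of vertex idempotents, where all heights in $X$ are distinct and only their order matters, modulo the following relations. Let $a,b$ be two letters of $X$ with heights $h<k$, no height of $X$ lying strictly between, and let $X'$ be $X$ with the two heights exchanged. If $a,b$ lie in different components, then $X-X'=\{a,b\}X''$, where $X''$ arises by deleting $a$ and $b$ and gluing the two components into one; if they lie in the same component, then $X-X'=\hbar\{a,b\}X''$, where $X''$ arises by deleting $a$ and $b$ and splitting the component into two. The product $X*Y$ is $X\&Y$ with all heights of $Y$ raised above those of $X$. The height-lifting of a path $x=a_1\cdots a_r$ is $\widehat x=(a_1,1)\cdots(a_r,r)$ if $x$ is closed (the idempotent of the vertex if $x$ is a trivial path) and $0$ otherwise; it is extended linearly to $\mathbb K\overline Q$. **The reduction.** Let $(\mathbb K\overline Q\mathbf w)_\natural\subseteq(\mathbb K\overline Q)_\natural$ be the set of the classes of all $y\mathbf w$, $y\in\mathbb K\overline Q$. Let $S\subseteq\mathbb K\overline Q$ be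 any choice of representatives of it, that is, any set whose image in $(\mathbb K\overline Q)_\natural$ is $(\mathbb K\overline Q\mathbf w)_\natural$, and let $$\mathcal R_q=\mathcal R_q(\mathbf N(Q)_\hbar,\widehat{\mathbf w})=\mathbf N(Q)_\hbar\big/\mathbf N(Q)_\hbar\,\widehat S\,\mathbf N(Q)_\hbar,\qquad \widehat S=\{\widehat s: s\in S\},$$ be the quotient by the two-sided ideal generated by their height-liftings. **Theorem.** For every such choice of $S$ there is exactly one $\mathbb K$-linear map $$v:\ \mathcal U\big((\Pi Q)_\natural\big)\longrightarrow \mathcal R_q/\hbar\mathcal R_q$$ that is an isomorphism of $\mathbb K$-modules and satisfies $$v\big(pr(x_1)\boxtimes\cdots\boxtimes pr(x_k)\big)=\big[\,\overline{\widehat{x_1}*\cdots*\widehat{x_k}}\,\big]$$ for all $k\ge 0$ and all $x_1,\dots,x_k\in\mathbb K\overline Q$, where $pr(x_i)$ is the image of the class of $x_i$, $\boxtimes$ is the product of the universal enveloping algebra, and the right-hand side is the class in $\mathcal R_q/\hbar\mathcal R_q$. In other words, the map $v$ given by this formula is well defined and is an isomorphism of $\mathbb K$-modules. -/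

import Mathlib

/-!
# Quantized necklace algebras and their reduction

For a finite quiver `Q` (a type `V` of vertices with a `Quiver` structure) and a field `K`, this file
constructs the path algebra `K Q̄` of the double quiver, the necklace Lie algebra `(K Q̄)_♮`, the
preprojective algebra `Π Q` with the induced Lie algebra `(Π Q)_♮`, the quantized necklace algebra
`N(Q)_ħ` over `K[ħ]`, and its reduction. The helper facts that are proved here are the ones that make
these objects rings, Lie algebras and well-defined maps.
-/

namespace NecklaceQuantization

section

set_option linter.unusedSectionVars false
set_option linter.unusedSimpArgs false
set_option linter.unusedTactic false

variable {V : Type*} [Quiver V]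

/-- Arrows of the double quiver `Q̄` of the quiver `V`: `inl a` is the arrow `a`, and `inr a` is the
reversed arrow `a*`. -/
abbrev DoubleArrow (V : Type*) [Quiver V] := Quiver.Total V ⊕ Quiver.Total V

namespace DoubleArrow
/-- The source of an arrow of the double quiver. -/
def src : DoubleArrow V → V
  | .inl a => a.left
  | .inr a => a.right

/-- The target of an arrow of the double quiver. -/
def tgt : DoubleArrow V → V
  | .inl a => a.right
  | .inr a => a.left

/-- `IsWord v [a₁, …, aₖ]`: the arrows compose as `a₁ ⋯ aₖ` (composition of functions, so that the
source of `aᵢ` is the target of `aᵢ₊₁`), and the target of the composite is `v`. The empty word is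
allowed at every vertex. -/
def IsWord : V → List (DoubleArrow V) → Prop
  | _, [] => True
  | v, a :: l => a.tgt = v ∧ IsWord a.src l

/-- The source of the composite `a₁ ⋯ aₖ` with target `v`. -/
def wordSrc : V → List (DoubleArrow V) → V
  | v, [] => v
  | _, a :: l => wordSrc a.src l
end DoubleArrow

open DoubleArrow

theorem isWord_append (v : V) (l m : List (DoubleArrow V)) :
    IsWord v (l ++ m) ↔ IsWord v l ∧ IsWord (wordSrc v l) m := by
  induction l generalizing v with
  | nil => simp [IsWord, wordSrc]
  | cons a l ih => simp [IsWord, wordSrc, ih, and_assoc]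

theorem wordSrc_append (v : V) (l m : List (DoubleArrow V)) :
    wordSrc v (l ++ m) = wordSrc (wordSrc v l) m := by
  induction l generalizing v with
  | nil => simp [wordSrc]
  | cons a l ih => simp [wordSrc, ih]

theorem isWord_nil (v : V) : IsWord v [] := trivial
theorem isWord_single (a : DoubleArrow V) : IsWord a.tgt [a] := ⟨rfl, trivial⟩

/-- Paths in the double quiver; the empty path at `v` is the trivial path (idempotent) at `v`. -/
@[ext] structure DoublePath (V : Type*) [Quiver V] where
  tgt : V
  arrows : List (DoubleArrow V)
  isWord : IsWord tgt arrows

/-- The path algebra `K Q̄` of the double quiver: the vector space with basis the paths, with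
concatenation `(a₁ ⋯ aₖ) (b₁ ⋯ bₗ) = a₁ ⋯ aₖ b₁ ⋯ bₗ` when the source of the first path is the target
of the second, and `0` otherwise. -/
def PathAlgebra (K : Type*) (V : Type*) [Field K] [Quiver V] := DoublePath V →₀ K

namespace PathAlgebra
variable {K : Type*} [Field K]

noncomputable instance : AddCommGroup (PathAlgebra K V) := inferInstanceAs (AddCommGroup (DoublePath V →₀ K))
noncomputable instance : Module K (PathAlgebra K V) := inferInstanceAs (Module K (DoublePath V →₀ K))

/-- The basis element given by a path. -/
noncomputable def ofPath (p : DoublePath V) : PathAlgebra K V := Finsupp.single p (1 : K)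

/-- The linear map with prescribed values on paths. -/
noncomputable def lift {M : Type*} [AddCommGroup M] [Module K M] (f : DoublePath V → M) :
    PathAlgebra K V →ₗ[K] M :=
  Finsupp.linearCombination K f

theorem lift_ofPath {M : Type*} [AddCommGroup M] [Module K M] (f : DoublePath V → M)
    (p : DoublePath V) : lift (K := K) f (ofPath p) = f p := by
  change Finsupp.linearCombination K f (Finsupp.single p 1) = f p
  simp

open scoped Classical in
/-- The path with target `v` and arrows `l`, or `0` if these arrows do not compose. -/
noncomputable def word (v : V) (l : List (DoubleArrow V)) : PathAlgebra K V :=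
  if h : IsWord v l then ofPath ⟨v, l, h⟩ else 0

theorem word_of (v : V) (l : List (DoubleArrow V)) (h : IsWord v l) :
  (word v l : PathAlgebra K V) = ofPath ⟨v, l, h⟩ := dif_pos h

open scoped Classical in
/-- Concatenation of paths, extended bilinearly. -/
noncomputable def mulLin : PathAlgebra K V →ₗ[K] PathAlgebra K V →ₗ[K] PathAlgebra K V :=
  lift fun p => lift fun q =>
    if wordSrc p.tgt p.arrows = q.tgt then word p.tgt (p.arrows ++ q.arrows) else 0

noncomputable instance : Mul (PathAlgebra K V) := ⟨fun x y => mulLin x y⟩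

theorem mul_def (x y : PathAlgebra K V) : x * y = mulLin x y := rfl

/-- Paths span. -/
theorem span_induction {P : PathAlgebra K V → Prop} (x : PathAlgebra K V)
    (zero : P 0) (add : ∀ x y, P x → P y → P (x + y)) (smul : ∀ (c : K) x, P x → P (c • x))
    (word : ∀ v l, IsWord v l → P (word v l)) : P x := by
  refine Finsupp.induction_linear (motive := P) x zero (fun f g => add f g) ?_
  rintro ⟨v, l, h⟩ c
  have := smul c _ (word v l h)
  rw [word_of v l h] at this
  have e : c • (ofPath ⟨v, l, h⟩ : PathAlgebra K V) = Finsupp.single ⟨v, l, h⟩ c := by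
    change c • Finsupp.single _ (1 : K) = _
    simp
  rwa [e] at this

open scoped Classical in
theorem word_mul_word (v w : V) (l m : List (DoubleArrow V)) (hl : IsWord v l) (hm : IsWord w m) :
    (word v l * word w m : PathAlgebra K V) =
      if wordSrc v l = w then word v (l ++ m) else 0 := by
  rw [word_of v l hl, word_of w m hm, mul_def, mulLin, lift_ofPath, lift_ofPath]

variable [Fintype V]

noncomputable instance : One (PathAlgebra K V) := ⟨∑ v : V, word v []⟩

noncomputable instance : Ring (PathAlgebra K V) :=
  { (inferInstance : AddCommGroup (PathAlgebra K V)), (inferInstance : Mul (PathAlgebra K V)),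
    (inferInstance : One (PathAlgebra K V)) with
    left_distrib := fun x y z => by simp [mul_def]
    right_distrib := fun x y z => by simp [mul_def]
    zero_mul := fun x => by simp [mul_def]
    mul_zero := fun x => by simp [mul_def]
    mul_assoc := fun x y z => by
      classical
      induction x using span_induction with
      | zero => simp [mul_def]
      | add x x' h h' => simp only [mul_def, map_add, LinearMap.add_apply] at *; rw [h, h']
      | smul c x h => simp only [mul_def, map_smul, LinearMap.smul_apply] at *; rw [h]
      | word u k hk =>
      induction y using span_induction with
      | zero => simp [mul_def]
      | add x x' h h' => simp only [mul_def, map_add, LinearMap.add_apply] at *; rw [h, h']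
      | smul c x h => simp only [mul_def, map_smul, LinearMap.smul_apply] at *; rw [h]
      | word v l hl =>
      induction z using span_induction with
      | zero => simp [mul_def]
      | add x x' h h' => simp only [mul_def, map_add, LinearMap.add_apply] at *; rw [h, h']
      | smul c x h => simp only [mul_def, map_smul, LinearMap.smul_apply] at *; rw [h]
      | word w m hm =>
        rw [word_mul_word _ _ _ _ hk hl, word_mul_word _ _ _ _ hl hm]
        by_cases h1 : wordSrc u k = v <;> by_cases h2 : wordSrc v l = w
        · subst h1; subst h2
          have hkl := (isWord_append _ _ _).2 ⟨hk, hl⟩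
          have hlm := (isWord_append _ _ _).2 ⟨hl, hm⟩
          rw [if_pos rfl, if_pos rfl, word_mul_word _ _ _ _ hkl hm, word_mul_word _ _ _ _ hk hlm]
          simp [wordSrc_append]
        · subst h1
          have hkl := (isWord_append _ _ _).2 ⟨hk, hl⟩
          rw [if_pos rfl, if_neg h2, word_mul_word _ _ _ _ hkl hm, wordSrc_append, if_neg h2]
          simp [mul_def]
        · subst h2
          have hlm := (isWord_append _ _ _).2 ⟨hl, hm⟩
          rw [if_neg h1, if_pos rfl, word_mul_word _ _ _ _ hk hlm, if_neg h1]
          simp [mul_def]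
        · rw [if_neg h1, if_neg h2]; simp [mul_def]
    one_mul := fun x => by
      classical
      induction x using span_induction with
      | zero => simp [mul_def]
      | add x x' h h' => simp only [mul_def, map_add, LinearMap.add_apply] at *; rw [h, h']
      | smul c x h => simp only [mul_def, map_smul, LinearMap.smul_apply] at *; rw [h]
      | word v l hl =>
        change (∑ u : V, word u []) * _ = _
        rw [mul_def, map_sum, LinearMap.sum_apply]
        simp only [← mul_def]
        rw [Finset.sum_eq_single v]
        · rw [word_mul_word _ _ _ _ (by trivial) hl]; simp [wordSrc]
        · intro u _ hu
          rw [word_mul_word _ _ _ _ (by trivial) hl]; simp [wordSrc, hu]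
        · simp
    mul_one := fun x => by
      classical
      induction x using span_induction with
      | zero => simp [mul_def]
      | add x x' h h' => simp only [mul_def, map_add, LinearMap.add_apply] at *; rw [h, h']
      | smul c x h => simp only [mul_def, map_smul, LinearMap.smul_apply] at *; rw [h]
      | word v l hl =>
        change _ * (∑ u : V, word u []) = _
        rw [mul_def, map_sum]
        simp only [← mul_def]
        rw [Finset.sum_eq_single (wordSrc v l)]
        · rw [word_mul_word _ _ _ _ hl (by trivial)]; simp
        · intro u _ hu
          rw [word_mul_word _ _ _ _ hl (by trivial)]; simp [hu.symm]
        · simp }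

noncomputable instance : Algebra K (PathAlgebra K V) :=
  Algebra.ofModule (fun r x y => by simp [mul_def]) (fun r x y => by simp [mul_def])

/-- The path of length one given by an arrow. -/
noncomputable def arrow (a : DoubleArrow V) : PathAlgebra K V := word a.tgt [a]

theorem word_cons (v : V) (a : DoubleArrow V) (l : List (DoubleArrow V)) (h : IsWord v (a :: l)) :
    (word v (a :: l) : PathAlgebra K V) = arrow a * word a.src l := by
  classical
  rw [arrow, word_mul_word _ _ _ _ (isWord_single a) h.2, ← h.1]
  simp [wordSrc]

/-- Induction by multiplying with arrows from the left. -/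
theorem gen_induction {P : PathAlgebra K V → Prop} (x : PathAlgebra K V)
    (zero : P 0) (add : ∀ x y, P x → P y → P (x + y)) (smul : ∀ (c : K) x, P x → P (c • x))
    (idem : ∀ v, P (word v [])) (arr : ∀ a x, P x → P (arrow a * x)) : P x := by
  refine span_induction x zero add smul ?_
  intro v l
  induction l generalizing v with
  | nil => exact fun _ => idem v
  | cons a l ih => exact fun h => by rw [word_cons v a l h]; exact arr _ _ (ih _ h.2)


theorem ofPath_eq (p : DoublePath V) : (ofPath p : PathAlgebra K V) = word p.tgt p.arrows :=
  (word_of _ _ p.isWord).symm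

theorem gen_idem_mul_arrow (a : DoubleArrow V) :
    (word a.tgt [] * arrow a : PathAlgebra K V) = arrow a := by
  classical
  rw [arrow, word_mul_word _ _ _ _ (isWord_nil _) (isWord_single a)]
  simp [wordSrc]

theorem arrow_mul_idem (a : DoubleArrow V) :
    (arrow a * word a.src [] : PathAlgebra K V) = arrow a := by
  classical
  rw [arrow, word_mul_word _ _ _ _ (isWord_single a) (isWord_nil _)]
  simp [wordSrc]

open scoped TensorProduct
open scoped Classical in
/-- The double derivation `∂_b : a₁ ⋯ aₖ ↦ ∑_{aᵢ = b} (a₁ ⋯ aᵢ₋₁) ⊗ (aᵢ₊₁ ⋯ aₖ)`. -/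
noncomputable def doubleDer (b : DoubleArrow V) :
    PathAlgebra K V →ₗ[K] PathAlgebra K V ⊗[K] PathAlgebra K V :=
  lift fun p => ∑ i : Fin p.arrows.length,
    if p.arrows[i] = b then
      word p.tgt (p.arrows.take i) ⊗ₜ[K] word b.src (p.arrows.drop (i + 1)) else 0

theorem doubleDer_idem (b : DoubleArrow V) (v : V) : doubleDer b (word v [] : PathAlgebra K V) = 0 := by
  rw [word_of v [] trivial, doubleDer, lift_ofPath]
  exact Finset.sum_of_isEmpty (ι := Fin 0) _

open scoped Classical in
theorem doubleDer_word_cons (b : DoubleArrow V) (v : V) (a : DoubleArrow V)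
    (l : List (DoubleArrow V)) (h : IsWord v (a :: l)) :
    doubleDer b (arrow a * word a.src l : PathAlgebra K V) =
      (if a = b then word a.tgt [] ⊗ₜ[K] word a.src l else 0)
      + (arrow a ⊗ₜ[K] 1) * doubleDer b (word a.src l) := by
  rw [← word_cons v a l h, word_of _ _ h, word_of _ _ h.2, doubleDer, lift_ofPath, lift_ofPath]
  refine (Fin.sum_univ_succ (n := l.length) _).trans ?_
  congr 1
  · by_cases hab : a = b
    · subst hab
      have h1 := h.1
      simp [word_of _ _ h.2, h1]
    · simp [hab]
  · rw [Finset.mul_sum]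
    refine Finset.sum_congr rfl fun i _ => ?_
    simp only [Fin.getElem_fin, Fin.val_succ, List.getElem_cons_succ, List.take_succ_cons,
      List.drop_succ_cons]
    rw [mul_ite, mul_zero, Algebra.TensorProduct.tmul_mul_tmul, one_mul]
    congr 2
    rw [word_cons]
    have := h.2
    rw [← List.take_append_drop (i : ℕ) l, isWord_append] at this
    exact ⟨h.1, this.1⟩

theorem arrow_mul_word_ne (a : DoubleArrow V) (v : V) (l : List (DoubleArrow V))
    (h : IsWord v l) (hv : v ≠ a.src) : (arrow a * word v l : PathAlgebra K V) = 0 := by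
  classical
  rw [arrow, word_mul_word _ _ _ _ (isWord_single a) h, if_neg]
  exact fun e => hv e.symm

theorem idem_mul_idem_mul (u : V) (x : PathAlgebra K V) :
    word u [] * (word u [] * x) = word u [] * x := by
  classical
  rw [← mul_assoc, word_mul_word _ _ _ _ (isWord_nil _) (isWord_nil _)]
  simp [wordSrc]

/-- words starting at the wrong vertex are killed -/
theorem idem_mul_word (u v : V) (l : List (DoubleArrow V)) (h : IsWord v l) [Decidable (u = v)] :
    (word u [] * word v l : PathAlgebra K V) = if u = v then word v l else 0 := by
  classical
  rw [word_mul_word _ _ _ _ (isWord_nil _) h]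
  by_cases e : u = v
  · subst e; simp [wordSrc]
  · simp [wordSrc, e]

theorem doubleDer_idem_mul (b : DoubleArrow V) (u : V) (x : PathAlgebra K V) :
    doubleDer b (word u [] * x) = (word u [] ⊗ₜ[K] 1) * doubleDer b x := by
  classical
  induction x using span_induction with
  | zero => simp
  | add x y hx hy => simp only [mul_add, map_add, hx, hy]
  | smul c x h => simp only [mul_smul_comm, map_smul, h]
  | word v l hl =>
    cases l with
    | nil =>
      rw [idem_mul_word _ _ _ hl, doubleDer_idem]
      split_ifs <;> simp [doubleDer_idem]
    | cons a l =>
      rw [idem_mul_word _ _ _ hl, word_cons _ _ _ hl, apply_ite (doubleDer b), map_zero,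
        doubleDer_word_cons b v a l hl, mul_add, mul_ite, mul_zero, ← mul_assoc,
        Algebra.TensorProduct.tmul_mul_tmul, Algebra.TensorProduct.tmul_mul_tmul, one_mul, one_mul,
        idem_mul_word _ _ _ (isWord_nil _), arrow,
        idem_mul_word _ _ _ (isWord_single a), hl.1]
      by_cases e : u = v
      · simp [e]
      · simp [e]

open scoped Classical in
theorem doubleDer_arrow_mul (b a : DoubleArrow V) (x : PathAlgebra K V) :
    doubleDer b (arrow a * x) =
      (if a = b then word a.tgt [] ⊗ₜ[K] (word a.src [] * x) else 0)
      + (arrow a ⊗ₜ[K] 1) * doubleDer b x := by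
  induction x using span_induction with
  | zero => simp
  | add x y hx hy =>
    simp only [mul_add, map_add, hx, hy, TensorProduct.tmul_add]
    split_ifs
    · abel
    · abel
  | smul c x h => simp only [mul_smul_comm, map_smul, h, TensorProduct.tmul_smul, smul_add, smul_ite, smul_zero]
  | word v l hl =>
    by_cases e : v = a.src
    · subst e
      rw [doubleDer_word_cons b a.tgt a l ⟨rfl, hl⟩, idem_mul_word _ _ _ hl]
      simp
    · rw [arrow_mul_word_ne a v l hl e, idem_mul_word _ _ _ hl, if_neg (fun h : a.src = v => e h.symm)]
      have h2 : doubleDer b (word v l : PathAlgebra K V)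
          = (word v [] ⊗ₜ[K] 1) * doubleDer b (word v l) := by
        rw [← doubleDer_idem_mul, idem_mul_word _ _ _ hl, if_pos rfl]
      rw [h2, ← mul_assoc, Algebra.TensorProduct.tmul_mul_tmul, arrow_mul_word_ne a v [] trivial e]
      simp

theorem doubleDer_mul (b : DoubleArrow V) (x y : PathAlgebra K V) :
    doubleDer b (x * y) = (x ⊗ₜ[K] 1) * doubleDer b y + doubleDer b x * (1 ⊗ₜ[K] y) := by
  classical
  induction x using gen_induction with
  | zero => simp
  | add x x' h h' => simp only [add_mul, map_add, h, h', TensorProduct.add_tmul]; abel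
  | smul c x h =>
    simp only [smul_mul_assoc, map_smul, h, ← TensorProduct.smul_tmul', smul_add]
  | idem v => rw [doubleDer_idem_mul, doubleDer_idem]; simp
  | arr a x h =>
    rw [mul_assoc, doubleDer_arrow_mul, doubleDer_arrow_mul, h, mul_add, add_mul, ite_mul, zero_mul,
      ← mul_assoc, ← mul_assoc, Algebra.TensorProduct.tmul_mul_tmul,
      Algebra.TensorProduct.tmul_mul_tmul, mul_one, mul_one, mul_assoc (word a.src []),
      mul_assoc (arrow a ⊗ₜ[K] 1)]
    abel

open scoped Classical in
theorem doubleDer_arrow (b a : DoubleArrow V) :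
    doubleDer b (arrow a : PathAlgebra K V) =
      if a = b then word a.tgt [] ⊗ₜ[K] word a.src [] else 0 := by
  have := doubleDer_arrow_mul b a (word a.src [] : PathAlgebra K V)
  rw [arrow_mul_idem, doubleDer_idem, mul_zero, add_zero, idem_mul_word _ _ _ (isWord_nil _), if_pos rfl] at this
  exact this

/-- Two derivations `A → A ⊗ A` which agree on generators are equal. -/
theorem der_ext {F G : PathAlgebra K V →ₗ[K] PathAlgebra K V ⊗[K] PathAlgebra K V}
    (hF : ∀ x y, F (x * y) = (x ⊗ₜ[K] 1) * F y + F x * (1 ⊗ₜ[K] y))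
    (hG : ∀ x y, G (x * y) = (x ⊗ₜ[K] 1) * G y + G x * (1 ⊗ₜ[K] y))
    (hi : ∀ v, F (word v []) = G (word v [])) (ha : ∀ a, F (arrow a) = G (arrow a)) : F = G := by
  ext1 x
  induction x using gen_induction with
  | zero => simp
  | add x x' h h' => simp only [map_add, h, h']
  | smul c x h => simp only [map_smul, h]
  | idem v => exact hi v
  | arr a x h => rw [hF, hG, ha, h]

/-- `u ⊗ v ↦ u m v` -/
noncomputable def insertMid (m : PathAlgebra K V) :
    PathAlgebra K V ⊗[K] PathAlgebra K V →ₗ[K] PathAlgebra K V :=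
  TensorProduct.lift ((LinearMap.mul K _).comp (LinearMap.mulRight K m))

/-- `u ⊗ v ↦ v m u` -/
noncomputable def insertCyc (m : PathAlgebra K V) :
    PathAlgebra K V ⊗[K] PathAlgebra K V →ₗ[K] PathAlgebra K V :=
  TensorProduct.lift ((LinearMap.mul K _).comp (LinearMap.mulRight K m)).flip

@[simp] theorem insertMid_tmul (m u v : PathAlgebra K V) : insertMid m (u ⊗ₜ[K] v) = u * m * v := rfl
@[simp] theorem insertCyc_tmul (m u v : PathAlgebra K V) : insertCyc m (u ⊗ₜ[K] v) = v * m * u := rfl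

/-- The cyclic derivative `a₁ ⋯ aₖ ↦ ∑_{aᵢ = b} aᵢ₊₁ ⋯ aₖ a₁ ⋯ aᵢ₋₁`. -/
noncomputable def cyclicDer (b : DoubleArrow V) : PathAlgebra K V →ₗ[K] PathAlgebra K V :=
  (insertCyc 1).comp (doubleDer b)

end PathAlgebra

/-- The subspace `[A, A]` spanned by the commutators of `A`. -/
def commutatorSubmodule (K A : Type*) [CommRing K] [Ring A] [Algebra K A] : Submodule K A :=
  Submodule.span K {z | ∃ x y : A, z = x * y - y * x}

/-- The quotient `A_♮ = A / [A, A]`. For `A = K Q̄` it has the cyclic words as a basis. -/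
abbrev CyclicQuotient (K A : Type*) [CommRing K] [Ring A] [Algebra K A] := A ⧸ commutatorSubmodule K A

namespace PathAlgebra
variable {K : Type*} [Field K] [Fintype V]

open scoped TensorProduct

theorem insertMid_left (m p : PathAlgebra K V) (t) :
    insertMid m ((p ⊗ₜ[K] 1) * t) = p * insertMid m t := by
  induction t using TensorProduct.induction_on with
  | zero => simp
  | tmul u v => simp [mul_assoc]
  | add s t hs ht => simp only [mul_add, map_add, hs, ht]

theorem insertMid_right (m p : PathAlgebra K V) (t) :
    insertMid m (t * (1 ⊗ₜ[K] p)) = insertMid m t * p := by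
  induction t using TensorProduct.induction_on with
  | zero => simp
  | tmul u v => simp [mul_assoc]
  | add s t hs ht => simp only [add_mul, map_add, hs, ht]

theorem insertCyc_left (p : PathAlgebra K V) (t) :
    insertCyc 1 ((p ⊗ₜ[K] 1) * t) = insertCyc p t := by
  induction t using TensorProduct.induction_on with
  | zero => simp
  | tmul u v => simp [mul_assoc]
  | add s t hs ht => simp only [mul_add, map_add, hs, ht]

theorem insertCyc_right (p : PathAlgebra K V) (t) :
    insertCyc 1 (t * (1 ⊗ₜ[K] p)) = insertCyc p t := by
  induction t using TensorProduct.induction_on with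
  | zero => simp
  | tmul u v => simp [mul_assoc]
  | add s t hs ht => simp only [add_mul, map_add, hs, ht]

theorem cyclicDer_mul (b : DoubleArrow V) (x y : PathAlgebra K V) :
    cyclicDer b (x * y) = insertCyc x (doubleDer b y) + insertCyc y (doubleDer b x) := by
  simp only [cyclicDer, LinearMap.comp_apply, doubleDer_mul, map_add, insertCyc_left, insertCyc_right]

theorem cyclicDer_comm (b : DoubleArrow V) :
    commutatorSubmodule K (PathAlgebra K V) ≤ LinearMap.ker (cyclicDer b) := by
  rw [commutatorSubmodule, Submodule.span_le]
  rintro _ ⟨x, y, rfl⟩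
  simp only [SetLike.mem_coe, LinearMap.mem_ker, map_sub, cyclicDer_mul]
  abel


theorem swap_tmul_left (p : PathAlgebra K V) (t : PathAlgebra K V ⊗[K] PathAlgebra K V) :
    TensorProduct.comm K _ _ ((p ⊗ₜ[K] 1) * t) = (1 ⊗ₜ[K] p) * TensorProduct.comm K _ _ t := by
  induction t using TensorProduct.induction_on with
  | zero => simp
  | tmul u v => simp
  | add s t hs ht => simp only [mul_add, map_add, hs, ht]

/-- `(D_c ⊗ 1) D_b = (1 ⊗ D_b) D_c`. -/
theorem doubleDer_coassoc (b c : DoubleArrow V) (x : PathAlgebra K V) :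
    TensorProduct.assoc K _ _ _ ((doubleDer c).rTensor _ (doubleDer b x)) =
      (doubleDer b).lTensor _ (doubleDer c x) := by
  classical
  let L : DoubleArrow V → (PathAlgebra K V ⊗[K] (PathAlgebra K V ⊗[K] PathAlgebra K V) →ₗ[K]
      PathAlgebra K V ⊗[K] (PathAlgebra K V ⊗[K] PathAlgebra K V)) := fun a =>
    (LinearMap.mulLeft K (arrow a)).rTensor (PathAlgebra K V ⊗[K] PathAlgebra K V)
  have hL : ∀ a u t, L a (u ⊗ₜ[K] t) = (arrow a * u) ⊗ₜ[K] t := fun a u t => rfl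
  have key1 : ∀ (a : DoubleArrow V) (t : PathAlgebra K V ⊗[K] PathAlgebra K V),
      TensorProduct.assoc K _ _ _ ((doubleDer c).rTensor _ ((arrow a ⊗ₜ[K] 1) * t)) =
        (if a = c then word a.tgt [] ⊗ₜ[K] ((word a.src [] ⊗ₜ[K] 1) * t) else 0) +
        L a (TensorProduct.assoc K _ _ _ ((doubleDer c).rTensor _ t)) := by
    intro a t
    induction t using TensorProduct.induction_on with
    | zero => simp
    | tmul u v =>
      have key0 : ∀ s : PathAlgebra K V ⊗[K] PathAlgebra K V,
          TensorProduct.assoc K _ _ _ (((arrow a ⊗ₜ[K] 1) * s) ⊗ₜ[K] v) =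
            L a (TensorProduct.assoc K _ _ _ (s ⊗ₜ[K] v)) := by
        intro s
        induction s using TensorProduct.induction_on with
        | zero => simp
        | tmul x y =>
          simp only [Algebra.TensorProduct.tmul_mul_tmul, one_mul, TensorProduct.assoc_tmul, hL]
        | add s t hs ht => simp only [mul_add, map_add, TensorProduct.add_tmul, hs, ht]
      rw [Algebra.TensorProduct.tmul_mul_tmul, one_mul, LinearMap.rTensor_tmul,
        doubleDer_arrow_mul, TensorProduct.add_tmul, map_add, key0, LinearMap.rTensor_tmul]
      congr 1
      split_ifs <;> simp
    | add s t hs ht =>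
      simp only [mul_add, map_add, hs, ht]
      split_ifs
      · rw [TensorProduct.tmul_add]; abel
      · abel
  have key2 : ∀ (a : DoubleArrow V) (t : PathAlgebra K V ⊗[K] PathAlgebra K V),
      (doubleDer b).lTensor _ ((arrow a ⊗ₜ[K] 1) * t) =
        L a ((doubleDer b).lTensor (PathAlgebra K V) t) := by
    intro a t
    induction t using TensorProduct.induction_on with
    | zero => simp
    | tmul u v => simp [hL]
    | add s t hs ht => simp only [mul_add, map_add, hs, ht]
  induction x using gen_induction with
  | zero => simp
  | add x x' h h' => simp only [map_add, h, h']
  | smul r x h => simp only [map_smul, h]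
  | idem v => simp [doubleDer_idem]
  | arr a x h =>
    rw [doubleDer_arrow_mul, doubleDer_arrow_mul, map_add, map_add, map_add, key1, key2, h,
      ← add_assoc]
    congr 1
    rw [← doubleDer_idem_mul]
    split_ifs <;> simp [doubleDer_idem]

/-- Second cyclic derivatives are symmetric. -/
theorem doubleDer_cyclicDer (b c : DoubleArrow V) (x : PathAlgebra K V) :
    doubleDer b (cyclicDer c x) = TensorProduct.comm K _ _ (doubleDer c (cyclicDer b x)) := by
  -- `α ⊗ β ⊗ γ ↦ γ α ⊗ β`
  let P : PathAlgebra K V ⊗[K] (PathAlgebra K V ⊗[K] PathAlgebra K V) →ₗ[K] PathAlgebra K V ⊗[K] PathAlgebra K V :=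
    TensorProduct.lift (LinearMap.mk₂ K (fun α t => TensorProduct.comm K _ _ (t * (1 ⊗ₜ[K] α)))
      (by intros; simp only [TensorProduct.tmul_add, mul_add, map_add])
      (by intros; simp only [TensorProduct.tmul_smul, mul_smul_comm, map_smul])
      (by intros; simp only [add_mul, map_add])
      (by intros; simp only [smul_mul_assoc, map_smul]))
  -- `α ⊗ β ⊗ γ ↦ β ⊗ γ α`
  have hP : ∀ α β γ : PathAlgebra K V, P (α ⊗ₜ[K] (β ⊗ₜ[K] γ)) = (γ * α) ⊗ₜ[K] β := by
    intro α β γ; simp [P]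
  have h1 : ∀ t : PathAlgebra K V ⊗[K] PathAlgebra K V, doubleDer b (insertCyc 1 t) =
      P (TensorProduct.assoc K _ _ _ ((doubleDer b).rTensor _ t)) +
        TensorProduct.comm K _ _ (P ((doubleDer b).lTensor _ t)) := by
    intro t
    induction t using TensorProduct.induction_on with
    | zero => simp
    | tmul u v =>
      rw [insertCyc_tmul, mul_one, doubleDer_mul, LinearMap.rTensor_tmul, LinearMap.lTensor_tmul]
      congr 1
      · generalize doubleDer b u = s
        induction s using TensorProduct.induction_on with
        | zero => simp
        | tmul x y => rw [TensorProduct.assoc_tmul, hP]; simp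
        | add s t hs ht => simp only [mul_add, map_add, TensorProduct.add_tmul, hs, ht]
      · generalize doubleDer b v = s
        induction s using TensorProduct.induction_on with
        | zero => simp
        | tmul x y => rw [hP]; simp
        | add s t hs ht => simp only [add_mul, map_add, TensorProduct.tmul_add, hs, ht]
    | add s t hs ht => simp only [map_add, hs, ht]; abel
  have h2 : ∀ t : PathAlgebra K V ⊗[K] PathAlgebra K V, doubleDer c (insertCyc 1 t) =
      P (TensorProduct.assoc K _ _ _ ((doubleDer c).rTensor _ t)) +
        TensorProduct.comm K _ _ (P ((doubleDer c).lTensor _ t)) := by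
    intro t
    induction t using TensorProduct.induction_on with
    | zero => simp
    | tmul u v =>
      rw [insertCyc_tmul, mul_one, doubleDer_mul, LinearMap.rTensor_tmul, LinearMap.lTensor_tmul]
      congr 1
      · generalize doubleDer c u = s
        induction s using TensorProduct.induction_on with
        | zero => simp
        | tmul x y => rw [TensorProduct.assoc_tmul, hP]; simp
        | add s t hs ht => simp only [mul_add, map_add, TensorProduct.add_tmul, hs, ht]
      · generalize doubleDer c v = s
        induction s using TensorProduct.induction_on with
        | zero => simp
        | tmul x y => rw [hP]; simp
        | add s t hs ht => simp only [add_mul, map_add, TensorProduct.tmul_add, hs, ht]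
    | add s t hs ht => simp only [map_add, hs, ht]; abel
  have hcc : ∀ t : PathAlgebra K V ⊗[K] PathAlgebra K V, TensorProduct.comm K (PathAlgebra K V) (PathAlgebra K V) (TensorProduct.comm K (PathAlgebra K V) (PathAlgebra K V) t) = t := by
    intro t
    induction t using TensorProduct.induction_on with
    | zero => simp
    | tmul u v => simp
    | add s t hs ht => simp only [map_add, hs, ht]
  rw [cyclicDer, cyclicDer, LinearMap.comp_apply, LinearMap.comp_apply, h1, h2,
    doubleDer_coassoc, doubleDer_coassoc, map_add, hcc, add_comm]

section Bracket

open scoped Classical in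
/-- The symplectic pairing on the arrows of the double quiver: `{a, a*} = 1`, `{a*, a} = -1` for every
arrow `a` of the quiver, and all other values are `0`. -/
noncomputable def pairing : DoubleArrow V → DoubleArrow V → K
  | .inl a, .inr b => if a = b then 1 else 0
  | .inr a, .inl b => if a = b then -1 else 0
  | _, _ => 0

theorem pairing_antisymm (b c : DoubleArrow V) : (pairing b c : K) = - pairing c b := by
  rcases b with a | a <;> rcases c with b | b <;> by_cases h : a = b
  all_goals first
    | (subst h; simp [pairing]; done)
    | (have h' : b ≠ a := fun e => h e.symm
       simp [pairing, h, h'])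

theorem pairing_self (b : DoubleArrow V) : (pairing b b : K) = 0 := by
  rcases b with a | a <;> simp [pairing]

theorem pairing_ends (b c : DoubleArrow V) (h : (pairing b c : K) ≠ 0) :
    b.src = c.tgt ∧ b.tgt = c.src := by
  rcases b with a | a <;> rcases c with b | b <;> simp [pairing] at h <;>
    simp [h, src, tgt]

/-- The cyclic derivative, as a function on cyclic words. -/
noncomputable def cyclicDer' (b : DoubleArrow V) :
    CyclicQuotient K (PathAlgebra K V) →ₗ[K] PathAlgebra K V :=
  (commutatorSubmodule K (PathAlgebra K V)).liftQ (cyclicDer b) (cyclicDer_comm b)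

variable [Fintype (Quiver.Total V)]

/-- The necklace Lie bracket on `(K Q̄)_♮`: the sum over all pairs of an arrow of `x` and an arrow of
`y` of their pairing times the cyclic word obtained by deleting both and gluing what is left,
`{a₁ ⋯ aₖ, b₁ ⋯ bₗ} = ∑ᵢⱼ {aᵢ, bⱼ} aᵢ₊₁ ⋯ aₖ a₁ ⋯ aᵢ₋₁ bⱼ₊₁ ⋯ bₗ b₁ ⋯ bⱼ₋₁`. -/
noncomputable def necklaceBracket (x y : CyclicQuotient K (PathAlgebra K V)) :
    CyclicQuotient K (PathAlgebra K V) :=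
  Submodule.Quotient.mk (∑ b : DoubleArrow V, ∑ c : DoubleArrow V,
    (pairing b c : K) • (cyclicDer' b x * cyclicDer' c y))

/-- value of the Hamiltonian derivation of `x` on the arrow `c` -/
noncomputable def hamVal (x : CyclicQuotient K (PathAlgebra K V)) (c : DoubleArrow V) :
    PathAlgebra K V := ∑ b : DoubleArrow V, (pairing b c : K) • cyclicDer' b x

/-- Hamiltonian derivation -/
noncomputable def ham (x : CyclicQuotient K (PathAlgebra K V)) :
    PathAlgebra K V →ₗ[K] PathAlgebra K V :=
  ∑ c : DoubleArrow V, (insertMid (hamVal x c)).comp (doubleDer c)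

theorem ham_apply (x : CyclicQuotient K (PathAlgebra K V)) (q : PathAlgebra K V) :
    ham x q = ∑ c : DoubleArrow V, insertMid (hamVal x c) (doubleDer c q) := by
  simp [ham]

theorem ham_mul (x : CyclicQuotient K (PathAlgebra K V)) (p q : PathAlgebra K V) :
    ham x (p * q) = p * ham x q + ham x p * q := by
  simp only [ham_apply, doubleDer_mul, map_add, insertMid_left, insertMid_right,
    Finset.sum_add_distrib, Finset.mul_sum, Finset.sum_mul]

theorem ham_idem (x : CyclicQuotient K (PathAlgebra K V)) (v : V) : ham x (word v []) = 0 := by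
  simp [ham_apply, doubleDer_idem]

theorem cyclicDer_sandwich (b : DoubleArrow V) (x : PathAlgebra K V) :
    word b.src [] * cyclicDer b x * word b.tgt [] = cyclicDer b x := by
  classical
  have h : doubleDer b x = (1 ⊗ₜ[K] word b.src []) * doubleDer b x * (word b.tgt [] ⊗ₜ[K] 1) := by
    let F : PathAlgebra K V →ₗ[K] PathAlgebra K V ⊗[K] PathAlgebra K V :=
      (LinearMap.mulRight K (word b.tgt [] ⊗ₜ[K] 1)).comp
        ((LinearMap.mulLeft K (1 ⊗ₜ[K] word b.src [])).comp (doubleDer b))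
    have hF : ∀ x, F x = (1 ⊗ₜ[K] word b.src []) * doubleDer b x * (word b.tgt [] ⊗ₜ[K] 1) :=
      fun x => rfl
    have hl : ∀ (p : PathAlgebra K V) (t : PathAlgebra K V ⊗[K] PathAlgebra K V),
        (1 ⊗ₜ[K] word b.src []) * ((p ⊗ₜ[K] 1) * t) =
        (p ⊗ₜ[K] 1) * ((1 ⊗ₜ[K] word b.src []) * t) := by
      intro p t; simp [← mul_assoc]
    have hr : ∀ (p : PathAlgebra K V) (t : PathAlgebra K V ⊗[K] PathAlgebra K V),
        (t * (1 ⊗ₜ[K] p)) * (word b.tgt [] ⊗ₜ[K] 1) =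
        t * (word b.tgt [] ⊗ₜ[K] 1) * (1 ⊗ₜ[K] p) := by
      intro p t; simp [mul_assoc]
    have : doubleDer b = F := by
      refine der_ext (doubleDer_mul b) ?_ ?_ ?_
      · intro p q
        rw [hF, doubleDer_mul, mul_add, add_mul, hl, hF, hF, ← mul_assoc _ (doubleDer b p), hr,
          ← mul_assoc]
        simp only [mul_assoc]
      · intro v; rw [hF, doubleDer_idem]; simp
      · intro a
        rw [hF, doubleDer_arrow]
        split_ifs with e
        · subst e
          simp [idem_mul_word _ _ _ (isWord_nil _)]
        · simp
    rw [← hF, ← this]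
  rw [cyclicDer, LinearMap.comp_apply]
  conv_rhs => rw [h]
  generalize doubleDer b x = t
  induction t using TensorProduct.induction_on with
  | zero => simp
  | tmul u v => simp [mul_assoc]
  | add s t hs ht => simp only [mul_add, add_mul, map_add, hs, ht]

theorem cyclicDer'_sandwich (b : DoubleArrow V) (x : CyclicQuotient K (PathAlgebra K V)) :
    word b.src [] * cyclicDer' b x * word b.tgt [] = cyclicDer' b x := by
  induction x using Submodule.Quotient.induction_on with
  | _ x => exact cyclicDer_sandwich b x

theorem hamVal_sandwich (x : CyclicQuotient K (PathAlgebra K V)) (c : DoubleArrow V) :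
    word c.tgt [] * hamVal x c * word c.src [] = hamVal x c := by
  rw [hamVal, Finset.mul_sum, Finset.sum_mul]
  refine Finset.sum_congr rfl fun b _ => ?_
  by_cases h : (pairing b c : K) = 0
  · simp [h]
  · obtain ⟨h1, h2⟩ := pairing_ends b c h
    rw [← h1, ← h2, mul_smul_comm, smul_mul_assoc, cyclicDer'_sandwich]

theorem ham_arrow (x : CyclicQuotient K (PathAlgebra K V)) (c : DoubleArrow V) :
    ham x (arrow c) = hamVal x c := by
  classical
  rw [ham_apply, Finset.sum_eq_single c]
  · rw [doubleDer_arrow, if_pos rfl, insertMid_tmul, hamVal_sandwich]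
  · intro b _ hb
    rw [doubleDer_arrow, if_neg (fun e => hb e.symm), map_zero]
  · simp

theorem mk_insertMid (m : PathAlgebra K V) (t : PathAlgebra K V ⊗[K] PathAlgebra K V) :
    (Submodule.Quotient.mk (insertMid m t) : CyclicQuotient K (PathAlgebra K V)) =
      Submodule.Quotient.mk (m * insertCyc 1 t) := by
  induction t using TensorProduct.induction_on with
  | zero => simp
  | tmul u v =>
    rw [Submodule.Quotient.eq]
    refine Submodule.subset_span ⟨u, m * v, ?_⟩
    simp [mul_assoc]
  | add s t hs ht => simp only [map_add, mul_add, Submodule.Quotient.mk_add, hs, ht]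

theorem necklaceBracket_mk (x : CyclicQuotient K (PathAlgebra K V)) (q : PathAlgebra K V) :
    necklaceBracket x (Submodule.Quotient.mk q) = Submodule.Quotient.mk (ham x q) := by
  have hmk : ∀ (f : DoubleArrow V → PathAlgebra K V),
      (Submodule.Quotient.mk (∑ c, f c) : CyclicQuotient K (PathAlgebra K V)) =
        ∑ c, Submodule.Quotient.mk (f c) := fun f =>
    map_sum (Submodule.mkQ (commutatorSubmodule K (PathAlgebra K V))) f _
  rw [necklaceBracket, Finset.sum_comm, ham_apply, hmk, hmk]
  refine Finset.sum_congr rfl fun c _ => ?_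
  rw [mk_insertMid, hamVal, Finset.sum_mul]
  congr 1
  refine Finset.sum_congr rfl fun b _ => ?_
  rw [smul_mul_assoc]
  rfl

theorem cyclicDer_ham (b : DoubleArrow V) (x : CyclicQuotient K (PathAlgebra K V))
    (q : PathAlgebra K V) :
    cyclicDer b (ham x q) = ham x (cyclicDer b q) -
      ham (Submodule.Quotient.mk q) (cyclicDer' b x) := by
  classical
  -- the derivation of `A ⊗ A` induced by `ham x`
  let T : PathAlgebra K V ⊗[K] PathAlgebra K V →ₗ[K] PathAlgebra K V ⊗[K] PathAlgebra K V := (ham x).rTensor (PathAlgebra K V) + (ham x).lTensor (PathAlgebra K V)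
  have hT : ∀ u v : PathAlgebra K V, T (u ⊗ₜ[K] v) = ham x u ⊗ₜ[K] v + u ⊗ₜ[K] ham x v := fun u v => rfl
  have hTl : ∀ (p : PathAlgebra K V) (t : PathAlgebra K V ⊗[K] PathAlgebra K V),
      T ((p ⊗ₜ[K] 1) * t) = (ham x p ⊗ₜ[K] 1) * t + (p ⊗ₜ[K] 1) * T t := by
    intro p t
    induction t using TensorProduct.induction_on with
    | zero => simp
    | tmul u v =>
      simp only [Algebra.TensorProduct.tmul_mul_tmul, one_mul, hT, ham_mul, mul_add,
        TensorProduct.add_tmul]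
      abel
    | add s t hs ht => simp only [mul_add, map_add, hs, ht]; abel
  have hTr : ∀ (p : PathAlgebra K V) (t : PathAlgebra K V ⊗[K] PathAlgebra K V),
      T (t * (1 ⊗ₜ[K] p)) = t * (1 ⊗ₜ[K] ham x p) + T t * (1 ⊗ₜ[K] p) := by
    intro p t
    induction t using TensorProduct.induction_on with
    | zero => simp
    | tmul u v =>
      simp only [Algebra.TensorProduct.tmul_mul_tmul, mul_one, hT, ham_mul, add_mul,
        TensorProduct.tmul_add]
      abel
    | add s t hs ht => simp only [add_mul, map_add, hs, ht]; abel
  -- `u ⊗ v ↦ (u ⊗ 1) m (1 ⊗ v)`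
  let J : PathAlgebra K V ⊗[K] PathAlgebra K V → (PathAlgebra K V ⊗[K] PathAlgebra K V →ₗ[K] PathAlgebra K V ⊗[K] PathAlgebra K V) := fun m =>
    TensorProduct.lift (LinearMap.mk₂ K (fun u v => (u ⊗ₜ[K] 1) * m * (1 ⊗ₜ[K] v))
      (by intros; simp only [TensorProduct.add_tmul, add_mul])
      (by intros; simp only [← TensorProduct.smul_tmul', smul_mul_assoc])
      (by intros; simp only [TensorProduct.tmul_add, mul_add])
      (by intros; simp only [TensorProduct.tmul_smul, mul_smul_comm]))
  have hJ : ∀ m u v, J m (u ⊗ₜ[K] v) = (u ⊗ₜ[K] 1) * m * (1 ⊗ₜ[K] v) := fun m u v => rfl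
  have hJl : ∀ m p t, J m ((p ⊗ₜ[K] 1) * t) = (p ⊗ₜ[K] 1) * J m t := by
    intro m p t
    induction t using TensorProduct.induction_on with
    | zero => simp
    | tmul u v =>
      rw [Algebra.TensorProduct.tmul_mul_tmul, hJ, hJ, ← mul_assoc, ← mul_assoc,
        Algebra.TensorProduct.tmul_mul_tmul, one_mul, one_mul]
    | add s t hs ht => simp only [mul_add, map_add, hs, ht]
  have hJr : ∀ m p t, J m (t * (1 ⊗ₜ[K] p)) = J m t * (1 ⊗ₜ[K] p) := by
    intro m p t
    induction t using TensorProduct.induction_on with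
    | zero => simp
    | tmul u v =>
      rw [Algebra.TensorProduct.tmul_mul_tmul, hJ, hJ, mul_assoc, mul_assoc, mul_assoc,
        Algebra.TensorProduct.tmul_mul_tmul, mul_one, mul_one]
    | add s t hs ht => simp only [add_mul, map_add, hs, ht]
  let F : PathAlgebra K V →ₗ[K] PathAlgebra K V ⊗[K] PathAlgebra K V := (doubleDer b).comp (ham x) - T.comp (doubleDer b)
  let G : PathAlgebra K V →ₗ[K] PathAlgebra K V ⊗[K] PathAlgebra K V :=
    ∑ c : DoubleArrow V, (J (doubleDer b (hamVal x c))).comp (doubleDer c)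
  have hF : ∀ q, F q = doubleDer b (ham x q) - T (doubleDer b q) := fun q => rfl
  have hG : ∀ q, G q = ∑ c : DoubleArrow V, J (doubleDer b (hamVal x c)) (doubleDer c q) := by
    intro q; simp [G]
  have hFG : F = G := by
    refine der_ext ?_ ?_ ?_ ?_
    · intro p q
      simp only [hF, ham_mul, map_add, doubleDer_mul, hTl, hTr, mul_sub, sub_mul]
      abel
    · intro p q
      simp only [hG, doubleDer_mul, map_add, hJl, hJr, Finset.sum_add_distrib, Finset.mul_sum,
        Finset.sum_mul]
    · intro v; simp [hF, hG, ham_idem, doubleDer_idem]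
    · intro a
      rw [hF, hG, ham_arrow, doubleDer_arrow, Finset.sum_eq_single a]
      · rw [doubleDer_arrow, if_pos rfl, hJ]
        have hz : T (if a = b then word a.tgt [] ⊗ₜ[K] word a.src [] else 0) = 0 := by
          split_ifs
          · simp [hT, ham_idem]
          · simp
        rw [hz, sub_zero]
        conv_lhs => rw [← hamVal_sandwich x a, doubleDer_mul, doubleDer_idem_mul, doubleDer_idem]
        simp
      · intro c _ hc
        rw [doubleDer_arrow, if_neg (fun e => hc e.symm), map_zero]
      · simp
  have hC : ∀ t : PathAlgebra K V ⊗[K] PathAlgebra K V, insertCyc 1 (T t) = ham x (insertCyc 1 t) := by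
    intro t
    induction t using TensorProduct.induction_on with
    | zero => simp
    | tmul u v => simp [hT, ham_mul]
    | add s t hs ht => simp only [map_add, hs, ht]
  have hz : ∀ m : PathAlgebra K V ⊗[K] PathAlgebra K V, insertCyc 0 m = 0 := by
    intro m
    induction m using TensorProduct.induction_on with
    | zero => simp
    | tmul u v => simp
    | add s t hs ht => simp only [map_add, hs, ht, add_zero]
  have hCJ : ∀ (m t : PathAlgebra K V ⊗[K] PathAlgebra K V), insertCyc 1 (J m t) = insertCyc (insertCyc 1 t) m := by
    intro m t
    induction t using TensorProduct.induction_on with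
    | zero => rw [map_zero, map_zero, hz]
    | tmul u v =>
      rw [hJ]
      induction m using TensorProduct.induction_on with
      | zero => simp
      | tmul y z => simp [mul_assoc]
      | add s t hs ht => simp only [mul_add, add_mul, map_add, hs, ht]
    | add s t hs ht =>
      have : ∀ (p p' : PathAlgebra K V), insertCyc (p + p') m = insertCyc p m + insertCyc p' m := by
        clear hs ht
        intro p p'
        induction m using TensorProduct.induction_on with
        | zero => simp
        | tmul y z => simp [mul_add, add_mul]
        | add s t hs ht => simp only [map_add, hs, ht]; abel
      simp only [map_add, hs, ht, this]
  have hswap : ∀ (p : PathAlgebra K V) (t : PathAlgebra K V ⊗[K] PathAlgebra K V),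
      insertCyc p (TensorProduct.comm K (PathAlgebra K V) (PathAlgebra K V) t) = insertMid p t := by
    intro p t
    induction t using TensorProduct.induction_on with
    | zero => simp
    | tmul u v => simp
    | add s t hs ht => simp only [map_add, hs, ht]
  have hlin : ∀ (r : K) (p : PathAlgebra K V) (t : PathAlgebra K V ⊗[K] PathAlgebra K V), insertMid (r • p) t = r • insertMid p t := by
    intro r p t
    induction t using TensorProduct.induction_on with
    | zero => simp
    | tmul u v => simp
    | add s t hs ht => simp only [map_add, hs, ht, smul_add]
  have hlins : ∀ (f : DoubleArrow V → PathAlgebra K V) (t : PathAlgebra K V ⊗[K] PathAlgebra K V),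
      insertMid (∑ c, f c) t = ∑ c, insertMid (f c) t := by
    intro f t
    induction t using TensorProduct.induction_on with
    | zero => simp
    | tmul u v => simp only [insertMid_tmul, Finset.mul_sum, Finset.sum_mul]
    | add s t hs ht => simp only [map_add, hs, ht, Finset.sum_add_distrib]
  have hhess : ∀ d : DoubleArrow V, doubleDer b (cyclicDer' d x) =
      TensorProduct.comm K _ _ (doubleDer d (cyclicDer' b x)) := by
    intro d
    induction x using Submodule.Quotient.induction_on with
    | _ x => exact doubleDer_cyclicDer b d x
  have e1 : doubleDer b (ham x q) = T (doubleDer b q) + G q := by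
    rw [← hFG, hF]; abel
  rw [cyclicDer, LinearMap.comp_apply, e1, map_add, hC, LinearMap.comp_apply, sub_eq_add_neg]
  congr 1
  rw [hG, map_sum, ham_apply, ← Finset.sum_neg_distrib]
  simp only [hCJ]
  calc ∑ c, insertCyc (insertCyc 1 (doubleDer c q)) (doubleDer b (hamVal x c))
      = ∑ c, ∑ d, (pairing d c : K) •
          insertMid (cyclicDer c q) (doubleDer d (cyclicDer' b x)) := by
        refine Finset.sum_congr rfl fun c _ => ?_
        rw [hamVal, map_sum, map_sum]
        refine Finset.sum_congr rfl fun d _ => ?_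
        rw [map_smul, map_smul, hhess, hswap]
        rfl
    _ = ∑ d, ∑ c, (pairing d c : K) •
          insertMid (cyclicDer c q) (doubleDer d (cyclicDer' b x)) := Finset.sum_comm
    _ = _ := by
        refine Finset.sum_congr rfl fun d _ => ?_
        rw [hamVal, hlins, ← Finset.sum_neg_distrib]
        refine Finset.sum_congr rfl fun c _ => ?_
        rw [hlin, pairing_antisymm d c, neg_smul]
        rfl

theorem ham_bracket (x y : CyclicQuotient K (PathAlgebra K V)) (q : PathAlgebra K V) :
    ham x (ham y q) = ham (necklaceBracket x y) q + ham y (ham x q) := by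
  induction y using Submodule.Quotient.induction_on with
  | _ p =>
  induction q using gen_induction with
  | zero => simp
  | add q q' h h' => simp only [map_add, h, h']; abel
  | smul c q h => simp only [map_smul, h, smul_add]
  | idem v => simp [ham_idem]
  | arr a q h =>
    have e : ham x (ham (Submodule.Quotient.mk p) (arrow a)) =
        ham (necklaceBracket x (Submodule.Quotient.mk p)) (arrow a) +
          ham (Submodule.Quotient.mk p) (ham x (arrow a)) := by
      rw [necklaceBracket_mk, ham_arrow, ham_arrow, ham_arrow, hamVal, hamVal, hamVal, map_sum,
        map_sum, ← Finset.sum_add_distrib]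
      refine Finset.sum_congr rfl fun b _ => ?_
      have := cyclicDer_ham b x p
      change cyclicDer' b (Submodule.Quotient.mk (ham x p)) =
        ham x (cyclicDer' b (Submodule.Quotient.mk p)) - _ at this
      rw [this, map_smul, map_smul, ← smul_add]
      simp
    simp only [ham_mul, map_add, mul_add, add_mul, h, e]
    abel

theorem necklaceBracket_self (x : CyclicQuotient K (PathAlgebra K V)) :
    necklaceBracket x x = 0 := by
  classical
  rw [necklaceBracket, Submodule.Quotient.mk_eq_zero, Fintype.sum_sum_type]
  simp only [Fintype.sum_sum_type, pairing, zero_smul, Finset.sum_const_zero, zero_add, add_zero,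
    ite_smul, one_smul, neg_smul, Finset.sum_ite_eq, Finset.mem_univ, if_true]
  rw [← Finset.sum_add_distrib]
  refine Submodule.sum_mem _ fun a _ => Submodule.subset_span
    ⟨cyclicDer' (.inl a) x, cyclicDer' (.inr a) x, ?_⟩
  rw [← sub_eq_add_neg]

/-- The necklace Lie algebra. -/
noncomputable instance : LieRing (CyclicQuotient K (PathAlgebra K V)) where
  bracket := necklaceBracket
  add_lie x y z := by
    change necklaceBracket _ _ = necklaceBracket _ _ + necklaceBracket _ _
    simp only [necklaceBracket, map_add, add_mul, smul_add, Finset.sum_add_distrib,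
      Submodule.Quotient.mk_add]
  lie_add x y z := by
    change necklaceBracket _ _ = necklaceBracket _ _ + necklaceBracket _ _
    simp only [necklaceBracket, map_add, mul_add, smul_add, Finset.sum_add_distrib,
      Submodule.Quotient.mk_add]
  lie_self x := necklaceBracket_self x
  leibniz_lie x y z := by
    change necklaceBracket _ (necklaceBracket _ _) =
      necklaceBracket (necklaceBracket _ _) _ + necklaceBracket _ (necklaceBracket _ _)
    induction z using Submodule.Quotient.induction_on with
    | _ q =>
    rw [necklaceBracket_mk, necklaceBracket_mk, necklaceBracket_mk, necklaceBracket_mk,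
      necklaceBracket_mk, ← Submodule.Quotient.mk_add, ham_bracket]

noncomputable instance : LieAlgebra K (CyclicQuotient K (PathAlgebra K V)) where
  lie_smul r x y := by
    change necklaceBracket _ _ = r • necklaceBracket _ _
    induction y using Submodule.Quotient.induction_on with
    | _ q =>
    rw [← Submodule.Quotient.mk_smul, necklaceBracket_mk, necklaceBracket_mk, map_smul,
      Submodule.Quotient.mk_smul]

theorem lie_mk (x : CyclicQuotient K (PathAlgebra K V)) (q : PathAlgebra K V) :
    ⁅x, (Submodule.Quotient.mk q : CyclicQuotient K (PathAlgebra K V))⁆ =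
      Submodule.Quotient.mk (ham x q) := necklaceBracket_mk x q

end Bracket


section Preprojective
variable [Fintype (Quiver.Total V)]

/-- The element `w = ∑_a (a a* - a* a)` of `K Q̄`. -/
noncomputable def momentMap (K V : Type*) [Field K] [Quiver V] [Fintype V]
    [Fintype (Quiver.Total V)] : PathAlgebra K V :=
  ∑ a : Quiver.Total V, (arrow (.inl a) * arrow (.inr a) - arrow (.inr a) * arrow (.inl a))

/-- The commutators of arrows with cyclic derivatives sum to zero. -/
theorem euler (x : PathAlgebra K V) :
    ∑ b : DoubleArrow V, cyclicDer b x * arrow b = ∑ b : DoubleArrow V, arrow b * cyclicDer b x := by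
  classical
  let F : PathAlgebra K V →ₗ[K] PathAlgebra K V ⊗[K] PathAlgebra K V :=
    ∑ b : DoubleArrow V, ((LinearMap.mulRight K (arrow b)).rTensor _ -
      (LinearMap.mulLeft K (arrow b)).lTensor _).comp (doubleDer b)
  have hF : ∀ x, F x = ∑ b : DoubleArrow V, ((LinearMap.mulRight K (arrow b)).rTensor _ (doubleDer b x)
      - (LinearMap.mulLeft K (arrow b)).lTensor _ (doubleDer b x)) := by
    intro x; simp only [F, LinearMap.sum_apply, LinearMap.comp_apply, LinearMap.sub_apply]
  let G : PathAlgebra K V →ₗ[K] PathAlgebra K V ⊗[K] PathAlgebra K V :=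
    ∑ v : V, ((TensorProduct.mk K _ _).flip (word v []) ∘ₗ LinearMap.mulRight K (word v []) -
      TensorProduct.mk K _ _ (word v []) ∘ₗ LinearMap.mulLeft K (word v []))
  have hG : ∀ x, G x = ∑ v : V, ((x * word v []) ⊗ₜ[K] word v [] - word v [] ⊗ₜ[K] (word v [] * x)) := by
    intro x; simp [G]
  have hl1 : ∀ (m p : PathAlgebra K V) (t : PathAlgebra K V ⊗[K] PathAlgebra K V),
      (LinearMap.mulRight K m).rTensor _ ((p ⊗ₜ[K] 1) * t) =
        (p ⊗ₜ[K] 1) * (LinearMap.mulRight K m).rTensor (PathAlgebra K V) t := by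
    intro m p t
    induction t using TensorProduct.induction_on with
    | zero => simp
    | tmul u v => simp [mul_assoc]
    | add s t hs ht => simp only [mul_add, map_add, hs, ht]
  have hl2 : ∀ (m p : PathAlgebra K V) (t : PathAlgebra K V ⊗[K] PathAlgebra K V),
      (LinearMap.mulLeft K m).lTensor _ ((p ⊗ₜ[K] 1) * t) =
        (p ⊗ₜ[K] 1) * (LinearMap.mulLeft K m).lTensor (PathAlgebra K V) t := by
    intro m p t
    induction t using TensorProduct.induction_on with
    | zero => simp
    | tmul u v => simp
    | add s t hs ht => simp only [mul_add, map_add, hs, ht]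
  have hr1 : ∀ (m p : PathAlgebra K V) (t : PathAlgebra K V ⊗[K] PathAlgebra K V),
      (LinearMap.mulRight K m).rTensor _ (t * (1 ⊗ₜ[K] p)) =
        (LinearMap.mulRight K m).rTensor (PathAlgebra K V) t * (1 ⊗ₜ[K] p) := by
    intro m p t
    induction t using TensorProduct.induction_on with
    | zero => simp
    | tmul u v => simp
    | add s t hs ht => simp only [add_mul, map_add, hs, ht]
  have hr2 : ∀ (m p : PathAlgebra K V) (t : PathAlgebra K V ⊗[K] PathAlgebra K V),
      (LinearMap.mulLeft K m).lTensor _ (t * (1 ⊗ₜ[K] p)) =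
        (LinearMap.mulLeft K m).lTensor (PathAlgebra K V) t * (1 ⊗ₜ[K] p) := by
    intro m p t
    induction t using TensorProduct.induction_on with
    | zero => simp
    | tmul u v => simp [mul_assoc]
    | add s t hs ht => simp only [add_mul, map_add, hs, ht]
  have hFG : F = G := by
    refine der_ext ?_ ?_ ?_ ?_
    · intro p q
      simp only [hF, doubleDer_mul, map_add, hl1, hl2, hr1, hr2, Finset.mul_sum, Finset.sum_mul,
        ← Finset.sum_add_distrib]
      refine Finset.sum_congr rfl fun b _ => ?_
      rw [mul_sub, sub_mul]
      abel
    · intro p q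
      simp only [hG, Finset.mul_sum, Finset.sum_mul, ← Finset.sum_add_distrib]
      refine Finset.sum_congr rfl fun v _ => ?_
      rw [mul_sub, sub_mul]
      simp only [Algebra.TensorProduct.tmul_mul_tmul, one_mul, mul_one, mul_assoc]
      abel
    · intro v
      rw [hF, hG, Finset.sum_eq_zero, Finset.sum_eq_single v]
      · rw [idem_mul_word _ _ _ (isWord_nil _)]; simp
      · intro u _ hu
        rw [idem_mul_word _ _ _ (isWord_nil _), idem_mul_word _ _ _ (isWord_nil _), if_neg hu,
          if_neg (fun e : v = u => hu e.symm)]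
        simp
      · simp
      · intro b _; rw [doubleDer_idem]; simp
    · intro a
      rw [hF, hG, Finset.sum_eq_single a, doubleDer_arrow, if_pos rfl, LinearMap.rTensor_tmul,
        LinearMap.lTensor_tmul, LinearMap.mulRight_apply, LinearMap.mulLeft_apply,
        gen_idem_mul_arrow, arrow_mul_idem, Finset.sum_sub_distrib]
      · congr 1
        · rw [Finset.sum_eq_single a.src]
          · rw [arrow_mul_idem]
          · intro u _ hu
            rw [arrow_mul_word_ne a u [] (isWord_nil _) hu, TensorProduct.zero_tmul]
          · simp
        · rw [Finset.sum_eq_single a.tgt]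
          · rw [gen_idem_mul_arrow]
          · intro u _ hu
            rw [arrow, idem_mul_word _ _ _ (isWord_single a), if_neg hu, TensorProduct.tmul_zero]
          · simp
      · intro b _ hb
        rw [doubleDer_arrow, if_neg (fun e => hb e.symm)]; simp
      · simp
  have h1 : ∀ (m : PathAlgebra K V) (t : PathAlgebra K V ⊗[K] PathAlgebra K V),
      insertCyc 1 ((LinearMap.mulRight K m).rTensor _ t) = insertCyc 1 t * m := by
    intro m t
    induction t using TensorProduct.induction_on with
    | zero => simp
    | tmul u v => simp [mul_assoc]
    | add s t hs ht => simp only [add_mul, map_add, hs, ht]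
  have h2 : ∀ (m : PathAlgebra K V) (t : PathAlgebra K V ⊗[K] PathAlgebra K V),
      insertCyc 1 ((LinearMap.mulLeft K m).lTensor _ t) = m * insertCyc 1 t := by
    intro m t
    induction t using TensorProduct.induction_on with
    | zero => simp
    | tmul u v => simp [mul_assoc]
    | add s t hs ht => simp only [mul_add, map_add, hs, ht]
  have h3 := congrArg (insertCyc 1) (hF x)
  rw [hFG, hG, map_sum, map_sum] at h3
  simp only [map_sub, h1, h2, insertCyc_tmul, mul_one, mul_assoc, sub_self,
    Finset.sum_const_zero, Finset.sum_sub_distrib] at h3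
  exact sub_eq_zero.1 h3.symm

theorem euler' (x : CyclicQuotient K (PathAlgebra K V)) :
    ∑ b : DoubleArrow V, cyclicDer' b x * arrow b =
      ∑ b : DoubleArrow V, arrow b * cyclicDer' b x := by
  induction x using Submodule.Quotient.induction_on with
  | _ x => exact euler x

theorem ham_momentMap (x : CyclicQuotient K (PathAlgebra K V)) : ham x (momentMap K V) = 0 := by
  classical
  have hl : ∀ a, hamVal x (.inl a) = - cyclicDer' (.inr a) x := by
    intro a; simp [hamVal, pairing]
  have hr : ∀ a, hamVal x (.inr a) = cyclicDer' (.inl a) x := by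
    intro a; simp [hamVal, pairing]
  have h := euler' x
  rw [Fintype.sum_sum_type, Fintype.sum_sum_type] at h
  simp only [momentMap, map_sum, map_sub, ham_mul, ham_arrow, hl, hr, Finset.sum_sub_distrib,
    Finset.sum_add_distrib, mul_neg, neg_mul, Finset.sum_neg_distrib]
  rw [← sub_eq_zero] at h
  rw [← neg_eq_zero, ← h]
  abel

/-- The preprojective algebra `Π Q = K Q̄ / (w)`. -/
abbrev Preprojective (K V : Type*) [Field K] [Quiver V] [Fintype V]
    [Fintype (Quiver.Total V)] : Type _ :=
  PathAlgebra K V ⧸ (TwoSidedIdeal.span {momentMap K V}).asIdeal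

/-- The projection `K Q̄ → Π Q`. -/
noncomputable def toPreprojective : PathAlgebra K V →ₐ[K] Preprojective K V :=
  Ideal.Quotient.mkₐ K _

end Preprojective
end PathAlgebra

theorem map_commutatorSubmodule_le {K A B : Type*} [CommRing K] [Ring A] [Algebra K A] [Ring B]
    [Algebra K B] (f : A →ₐ[K] B) :
    commutatorSubmodule K A ≤ (commutatorSubmodule K B).comap f.toLinearMap := by
  rw [commutatorSubmodule, Submodule.span_le]
  rintro _ ⟨x, y, rfl⟩
  exact Submodule.subset_span ⟨f x, f y, by simp⟩

/-- The map `A_♮ → B_♮` induced by an algebra homomorphism. -/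
def CyclicQuotient.map {K A B : Type*} [CommRing K] [Ring A] [Algebra K A] [Ring B]
    [Algebra K B] (f : A →ₐ[K] B) : CyclicQuotient K A →ₗ[K] CyclicQuotient K B :=
  Submodule.mapQ _ _ f.toLinearMap (map_commutatorSubmodule_le f)

namespace PathAlgebra
section Preprojective
variable {K : Type*} [Field K] [Fintype V] [Fintype (Quiver.Total V)]

/-- The projection `(K Q̄)_♮ → (Π Q)_♮`. -/
noncomputable def pr : CyclicQuotient K (PathAlgebra K V) →ₗ[K] CyclicQuotient K (Preprojective K V) :=
  CyclicQuotient.map toPreprojective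

theorem toPreprojective_surjective :
    Function.Surjective (toPreprojective : PathAlgebra K V →ₐ[K] Preprojective K V) :=
  Ideal.Quotient.mk_surjective

theorem pr_surjective : Function.Surjective (pr (K := K) (V := V)) := by
  intro y
  obtain ⟨y, rfl⟩ := Submodule.Quotient.mk_surjective _ y
  obtain ⟨x, rfl⟩ := toPreprojective_surjective y
  exact ⟨Submodule.Quotient.mk x, rfl⟩

theorem ham_mem (x : CyclicQuotient K (PathAlgebra K V)) (q : PathAlgebra K V)
    (hq : q ∈ TwoSidedIdeal.span {momentMap K V}) :
    ham x q ∈ TwoSidedIdeal.span {momentMap K V} := by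
  induction hq using TwoSidedIdeal.span_induction with
  | mem z hz =>
    rw [Set.mem_singleton_iff.1 hz, ham_momentMap]; exact zero_mem _
  | zero => rw [map_zero]; exact zero_mem _
  | add a b _ _ ha hb => rw [map_add]; exact add_mem ha hb
  | neg a _ ha => rw [map_neg]; exact neg_mem ha
  | left_absorb a z hz h =>
    rw [ham_mul]
    exact add_mem (TwoSidedIdeal.mul_mem_left _ _ _ h) (TwoSidedIdeal.mul_mem_left _ _ _ hz)
  | right_absorb a z hz h =>
    rw [ham_mul]
    exact add_mem (TwoSidedIdeal.mul_mem_right _ _ _ hz) (TwoSidedIdeal.mul_mem_right _ _ _ h)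

/-- The kernel of `pr` is stable under the necklace bracket. -/
theorem pr_lie_eq_zero (x y : CyclicQuotient K (PathAlgebra K V)) (hy : pr y = 0) :
    pr ⁅x, y⁆ = 0 := by
  obtain ⟨q, rfl⟩ := Submodule.Quotient.mk_surjective _ y
  have h1 : toPreprojective q ∈ commutatorSubmodule K (Preprojective K V) :=
    (Submodule.Quotient.mk_eq_zero _).1 hy
  have h2 : commutatorSubmodule K (Preprojective K V) ≤
      (commutatorSubmodule K (PathAlgebra K V)).map
        (toPreprojective (K := K) (V := V)).toLinearMap := by
    rw [commutatorSubmodule, Submodule.span_le]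
    rintro _ ⟨x, y, rfl⟩
    obtain ⟨x, rfl⟩ := toPreprojective_surjective x
    obtain ⟨y, rfl⟩ := toPreprojective_surjective y
    exact ⟨x * y - y * x, Submodule.subset_span ⟨x, y, rfl⟩, by simp⟩
  obtain ⟨c, hc, hcq⟩ := h2 h1
  have h3 : q - c ∈ TwoSidedIdeal.span {momentMap K V} := by
    refine TwoSidedIdeal.mem_asIdeal.1 ((Ideal.Quotient.eq).1 ?_)
    exact hcq.symm
  have h4 : (Submodule.Quotient.mk q : CyclicQuotient K (PathAlgebra K V)) =
      Submodule.Quotient.mk (q - c) := by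
    rw [Submodule.Quotient.eq]; simpa using hc
  rw [h4, lie_mk]
  have h5 : toPreprojective (ham x (q - c)) = (0 : Preprojective K V) :=
    Ideal.Quotient.eq_zero_iff_mem.2 (TwoSidedIdeal.mem_asIdeal.2 (ham_mem x _ h3))
  change Submodule.Quotient.mk (toPreprojective (ham x (q - c))) = _
  rw [h5]; rfl

/-- The bracket on `(Π Q)_♮` induced by the necklace bracket: the projection of the bracket of
preimages. It does not depend on the preimages, see `preprojectiveBracket_pr`. -/
noncomputable def preprojectiveBracket (x y : CyclicQuotient K (Preprojective K V)) :
    CyclicQuotient K (Preprojective K V) :=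
  pr ⁅Function.surjInv pr_surjective x, Function.surjInv pr_surjective y⁆

theorem preprojectiveBracket_pr (x y : CyclicQuotient K (PathAlgebra K V)) :
    preprojectiveBracket (pr x) (pr y) = pr ⁅x, y⁆ := by
  have hr : ∀ a b b' : CyclicQuotient K (PathAlgebra K V), pr b = pr b' →
      pr ⁅a, b⁆ = pr ⁅a, b'⁆ := by
    intro a b b' h
    rw [← sub_eq_zero, ← map_sub, ← lie_sub]
    exact pr_lie_eq_zero _ _ (by rw [map_sub, h, sub_self])
  have hl : ∀ a b b' : CyclicQuotient K (PathAlgebra K V), pr b = pr b' →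
      pr ⁅b, a⁆ = pr ⁅b', a⁆ := by
    intro a b b' h
    rw [← lie_skew b a, ← lie_skew b' a, map_neg, map_neg, hr a b b' h]
  rw [preprojectiveBracket, hr _ _ _ (Function.surjInv_eq pr_surjective (pr y)),
    hl _ _ _ (Function.surjInv_eq pr_surjective (pr x))]

/-- The Lie algebra `(Π Q)_♮`, a quotient of the necklace Lie algebra along `pr`. -/
noncomputable instance : LieRing (CyclicQuotient K (Preprojective K V)) where
  bracket := preprojectiveBracket
  add_lie x y z := by
    change preprojectiveBracket _ _ = preprojectiveBracket _ _ + preprojectiveBracket _ _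
    obtain ⟨x, rfl⟩ := pr_surjective x
    obtain ⟨y, rfl⟩ := pr_surjective y
    obtain ⟨z, rfl⟩ := pr_surjective z
    simp only [← map_add, preprojectiveBracket_pr, add_lie]
  lie_add x y z := by
    change preprojectiveBracket _ _ = preprojectiveBracket _ _ + preprojectiveBracket _ _
    obtain ⟨x, rfl⟩ := pr_surjective x
    obtain ⟨y, rfl⟩ := pr_surjective y
    obtain ⟨z, rfl⟩ := pr_surjective z
    simp only [← map_add, preprojectiveBracket_pr, lie_add]
  lie_self x := by
    change preprojectiveBracket _ _ = 0
    obtain ⟨x, rfl⟩ := pr_surjective x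
    rw [preprojectiveBracket_pr, lie_self, map_zero]
  leibniz_lie x y z := by
    change preprojectiveBracket _ (preprojectiveBracket _ _) =
      preprojectiveBracket (preprojectiveBracket _ _) _ +
        preprojectiveBracket _ (preprojectiveBracket _ _)
    obtain ⟨x, rfl⟩ := pr_surjective x
    obtain ⟨y, rfl⟩ := pr_surjective y
    obtain ⟨z, rfl⟩ := pr_surjective z
    simp only [← map_add, preprojectiveBracket_pr]
    rw [leibniz_lie]

noncomputable instance : LieAlgebra K (CyclicQuotient K (Preprojective K V)) where
  lie_smul r x y := by
    change preprojectiveBracket _ _ = r • preprojectiveBracket _ _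
    obtain ⟨x, rfl⟩ := pr_surjective x
    obtain ⟨y, rfl⟩ := pr_surjective y
    simp only [← map_smul, preprojectiveBracket_pr, lie_smul]

theorem lie_pr (x y : CyclicQuotient K (PathAlgebra K V)) :
    ⁅pr x, pr y⁆ = pr ⁅x, y⁆ := preprojectiveBracket_pr x y

end Preprojective
end PathAlgebra

open Polynomial PathAlgebra

/-- A cyclic word with heights: a base vertex, the target of the first arrow, and the list of the
arrows with their heights. The pair `(v, [])` is the idempotent at the vertex `v`. -/
abbrev HComp (V : Type*) [Quiver V] := V × List (DoubleArrow V × ℕ)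

/-- A product `(a₁₁, h₁₁) ⋯ (a₁ₖ, h₁ₖ) & ⋯ & (aᵣ₁, hᵣ₁) ⋯ (aᵣₗ, hᵣₗ)` of cyclic words with heights, and
idempotents. -/
abbrev HMonomial (V : Type*) [Quiver V] := List (HComp V)

namespace HMonomial

/-- All heights that occur in a monomial. -/
def heights (X : HMonomial V) : List ℕ := X.flatMap fun c => c.2.map Prod.snd

/-- Every component is a closed path, and the heights are distinct. -/
def Admissible (X : HMonomial V) : Prop :=
  (∀ c ∈ X, IsWord c.1 (c.2.map Prod.fst) ∧ wordSrc c.1 (c.2.map Prod.fst) = c.1) ∧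
    X.heights.Nodup

/-- Replace every height `h` by `f h`. -/
def mapHeights (f : ℕ → ℕ) (X : HMonomial V) : HMonomial V :=
  X.map fun c => (c.1, c.2.map fun a => (a.1, f a.2))

/-- A number above all heights. -/
def bound (X : HMonomial V) : ℕ := X.heights.foldr max 0 + 1

/-- `Y` is placed above `X`: raise all heights of `Y` above those of `X`, and then take `X & Y`. -/
def above (X Y : HMonomial V) : HMonomial V := X ++ Y.mapHeights (X.bound + ·)

end HMonomial
open HMonomial

/-- The free `K[ħ]`-module on the admissible monomials. Here `ħ` is the variable `X` of `K[X]`. -/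
def Free (K V : Type*) [Field K] [Quiver V] := {X : HMonomial V // X.Admissible} →₀ K[X]

namespace Free
variable {K : Type*} [Field K]
noncomputable instance : AddCommGroup (Free K V) :=
  inferInstanceAs (AddCommGroup ({X : HMonomial V // X.Admissible} →₀ K[X]))
noncomputable instance : Module K[X] (Free K V) :=
  inferInstanceAs (Module K[X] ({X : HMonomial V // X.Admissible} →₀ K[X]))

/-- The basis element given by an admissible monomial. -/
noncomputable def ofMonomial (X : {X : HMonomial V // X.Admissible}) : Free K V :=
  Finsupp.single X (1 : K[X])

/-- The linear map with prescribed values on admissible monomials. -/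
noncomputable def lift {M : Type*} [AddCommGroup M] [Module K[X] M]
    (φ : {X : HMonomial V // X.Admissible} → M) : Free K V →ₗ[K[X]] M :=
  Finsupp.linearCombination K[X] φ

theorem lift_ofMonomial {M : Type*} [AddCommGroup M] [Module K[X] M]
    (φ : {X : HMonomial V // X.Admissible} → M) (X : {X : HMonomial V // X.Admissible}) :
    lift φ (ofMonomial X : Free K V) = φ X :=
  (Finsupp.linearCombination_single K[X] 1 X).trans (one_smul _ _)

theorem induction {P : Free K V → Prop} (x : Free K V) (zero : P 0)
    (add : ∀ x y, P x → P y → P (x + y))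
    (smul : ∀ (c : K[X]) (X : {X : HMonomial V // X.Admissible}), P (c • ofMonomial X)) : P x := by
  refine Finsupp.induction_linear (motive := P) x zero add ?_
  intro X c
  have e : (c • (Finsupp.single X 1 : {X : HMonomial V // X.Admissible} →₀ K[X])) =
    Finsupp.single X c := by simp
  exact e ▸ smul c X

open scoped Classical in
/-- The class of a monomial, or `0` if it is not admissible. -/
noncomputable def mono (X : HMonomial V) : Free K V :=
  if h : X.Admissible then ofMonomial ⟨X, h⟩ else 0

theorem mono_of {X : HMonomial V} (h : X.Admissible) : (mono X : Free K V) = ofMonomial ⟨X, h⟩ :=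
  dif_pos h

theorem mono_of_not {X : HMonomial V} (h : ¬ X.Admissible) : (mono X : Free K V) = 0 :=
  dif_neg h

end Free

/-- The relations that define the quantized necklace algebra.

* `perm`, `rotate`: the components commute under `&`, and each component is a cyclic word.
* `reheight`: only the order of the heights matters.
* `skein`: if the heights `h < k` of `a` and `b` are adjacent, and `a` and `b` lie in different
  components, then exchanging the two heights changes the monomial by `{a, b}` times the monomial in
  which `a` and `b` are deleted and the two components are glued into one.
* `skeinSelf`: if they lie in the same component, then exchanging the two heights changes the
  monomial by `ħ {a, b}` times the monomial in which `a` and `b` are deleted and the component is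
  split into two.

By `perm` and `rotate` it is enough to write the last two with the letters in the leading places.
If `{a, b}` is not `0`, then `a` and `b` are opposite to one another, and the glued or split monomial
is again admissible. -/
inductive SkeinRel (K : Type*) [Field K] : Free K V → Prop
  | perm (X Y : HMonomial V) (hX : X.Admissible) (h : X.Perm Y) :
      SkeinRel K (Free.mono X - Free.mono Y)
  | rotate (v : V) (a : DoubleArrow V × ℕ) (l : List (DoubleArrow V × ℕ)) (Z : HMonomial V)
      (hX : Admissible ((v, a :: l) :: Z)) :
      SkeinRel K (Free.mono ((v, a :: l) :: Z) - Free.mono ((a.1.src, l ++ [a]) :: Z))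
  | reheight (X : HMonomial V) (f : ℕ → ℕ) (hX : X.Admissible)
      (hf : StrictMonoOn f {h | h ∈ X.heights}) :
      SkeinRel K (Free.mono X - Free.mono (X.mapHeights f))
  | skein (v w : V) (a b : DoubleArrow V) (h k : ℕ) (l m : List (DoubleArrow V × ℕ))
      (Z : HMonomial V) (hX : Admissible ((v, (a, h) :: l) :: (w, (b, k) :: m) :: Z))
      (hk : h < k) (hadj : ∀ j ∈ heights ((v, (a, h) :: l) :: (w, (b, k) :: m) :: Z), ¬(h < j ∧ j < k)) :
      SkeinRel K (Free.mono ((v, (a, h) :: l) :: (w, (b, k) :: m) :: Z)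
        - Free.mono ((v, (a, k) :: l) :: (w, (b, h) :: m) :: Z)
        - C (pairing a b : K) • Free.mono ((a.src, l ++ m) :: Z))
  | skeinSelf (v : V) (a b : DoubleArrow V) (h k : ℕ) (l m : List (DoubleArrow V × ℕ))
      (Z : HMonomial V) (hX : Admissible ((v, (a, h) :: l ++ (b, k) :: m) :: Z))
      (hk : h < k) (hadj : ∀ j ∈ heights ((v, (a, h) :: l ++ (b, k) :: m) :: Z), ¬(h < j ∧ j < k)) :
      SkeinRel K (Free.mono ((v, (a, h) :: l ++ (b, k) :: m) :: Z)
        - Free.mono ((v, (a, k) :: l ++ (b, h) :: m) :: Z)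
        - (C (pairing a b : K) * X) • Free.mono ((b.src, m) :: (a.src, l) :: Z))

/-- The submodule of relations. -/
noncomputable def relSubmodule (K V : Type*) [Field K] [Quiver V] : Submodule K[X] (Free K V) :=
  Submodule.span K[X] {z | SkeinRel K z}

/-- The quantized necklace algebra `N(Q)_ħ` over `K[ħ]`. -/
def QN (K V : Type*) [Field K] [Quiver V] : Type _ := Free K V ⧸ relSubmodule K V

namespace QN
variable {K : Type*} [Field K]
noncomputable instance : AddCommGroup (QN K V) :=
  inferInstanceAs (AddCommGroup (Free K V ⧸ relSubmodule K V))
noncomputable instance : Module K[X] (QN K V) :=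
  inferInstanceAs (Module K[X] (Free K V ⧸ relSubmodule K V))

/-- The quotient map. -/
noncomputable def proj : Free K V →ₗ[K[X]] QN K V := (relSubmodule K V).mkQ

/-- The class of a monomial. -/
noncomputable def mono (X : HMonomial V) : QN K V := proj (Free.mono X)


theorem mono_of_not {X : HMonomial V} (h : ¬ X.Admissible) : (mono X : QN K V) = 0 := by
  rw [mono, Free.mono_of_not h, map_zero]

theorem induction {P : QN K V → Prop} (x : QN K V) (zero : P 0)
    (add : ∀ x y, P x → P y → P (x + y)) (smul : ∀ (c : K[X]) x, P x → P (c • x))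
    (mono : ∀ X : HMonomial V, X.Admissible → P (mono X)) : P x := by
  obtain ⟨x, rfl⟩ := Submodule.Quotient.mk_surjective _ x
  refine Free.induction (P := fun f => P (proj f)) x ?_ ?_ ?_
  · rw [map_zero]; exact zero
  · intro f g hf hg
    rw [map_add]; exact add _ _ hf hg
  · rintro c ⟨X, hX⟩
    rw [map_smul, ← Free.mono_of hX]
    exact smul c _ (mono X hX)

theorem proj_eq_zero {z : Free K V} (h : SkeinRel K z) : (proj z : QN K V) = 0 :=
  (Submodule.Quotient.mk_eq_zero _).2 (Submodule.subset_span h)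

end QN

namespace HMonomial

theorem heights_append (X Y : HMonomial V) : (X ++ Y : HMonomial V).heights = X.heights ++ Y.heights := by
  simp [heights]

theorem heights_cons (c : HComp V) (Y : HMonomial V) :
    heights (c :: Y) = c.2.map Prod.snd ++ Y.heights := by
  simp [heights]

theorem heights_map (f : ℕ → ℕ) (X : HMonomial V) : (X.mapHeights f).heights = X.heights.map f := by
  simp [heights, mapHeights, List.flatMap_map, List.map_flatMap, Function.comp_def]

theorem mapHeights_append (f : ℕ → ℕ) (X Y : HMonomial V) :
    mapHeights f (X ++ Y) = X.mapHeights f ++ Y.mapHeights f := by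
  simp [mapHeights]

theorem mapHeights_cons (f : ℕ → ℕ) (c : HComp V) (Y : HMonomial V) :
    mapHeights f (c :: Y) = (c.1, c.2.map fun a => (a.1, f a.2)) :: Y.mapHeights f := by
  simp [mapHeights]

theorem mapHeights_map (f g : ℕ → ℕ) (X : HMonomial V) :
    (X.mapHeights f).mapHeights g = X.mapHeights (g ∘ f) := by
  simp [mapHeights, Function.comp_def]

theorem mapHeights_congr {f g : ℕ → ℕ} {X : HMonomial V} (h : ∀ j ∈ X.heights, f j = g j) :
    X.mapHeights f = X.mapHeights g := by
  refine List.map_congr_left fun c hc => ?_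
  refine congrArg (Prod.mk c.1) (List.map_congr_left fun a ha => ?_)
  rw [h a.2 (List.mem_flatMap.2 ⟨c, hc, List.mem_map.2 ⟨a, ha, rfl⟩⟩)]

theorem mapHeights_id {f : ℕ → ℕ} {X : HMonomial V} (h : ∀ j ∈ X.heights, f j = j) :
    X.mapHeights f = X := by
  rw [mapHeights_congr (g := id) h]
  simp [mapHeights]

theorem heights_perm {X Y : HMonomial V} (h : X.Perm Y) : X.heights.Perm Y.heights :=
  h.flatMap_right _

theorem lt_bound (X : HMonomial V) : ∀ j ∈ X.heights, j < X.bound := by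
  have : ∀ l : List ℕ, ∀ j ∈ l, j < l.foldr max 0 + 1 := by
    intro l
    induction l with
    | nil => simp
    | cons a l ih =>
      intro j hj
      rcases List.mem_cons.1 hj with rfl | hj
      · simp only [List.foldr_cons]; omega
      · have := ih j hj
        simp only [List.foldr_cons]; omega
  exact this _

theorem admissible_perm {X Y : HMonomial V} (h : X.Perm Y) : X.Admissible ↔ Y.Admissible := by
  simp only [Admissible, (heights_perm h).nodup_iff, h.mem_iff]

theorem admissible_append (X Y : HMonomial V) : Admissible (X ++ Y) ↔
    X.Admissible ∧ Y.Admissible ∧ X.heights.Disjoint Y.heights := by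
  simp only [Admissible, heights_append, List.nodup_append', List.mem_append]
  constructor
  · rintro ⟨h1, h2, h3, h4⟩
    exact ⟨⟨fun c hc => h1 c (Or.inl hc), h2⟩, ⟨fun c hc => h1 c (Or.inr hc), h3⟩, h4⟩
  · rintro ⟨⟨h1, h2⟩, ⟨h1', h3⟩, h4⟩
    exact ⟨fun c hc => hc.elim (h1 c) (h1' c), h2, h3, h4⟩

theorem admissible_map {f : ℕ → ℕ} {X : HMonomial V} (hf : Set.InjOn f {h | h ∈ X.heights}) :
    (X.mapHeights f).Admissible ↔ X.Admissible := by
  have h1 : (X.heights.map f).Nodup ↔ X.heights.Nodup :=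
    ⟨fun h => List.Nodup.of_map f h, fun h => h.map_on fun a ha b hb e => hf ha hb e⟩
  rw [Admissible, Admissible, heights_map, h1]
  simp only [mapHeights, List.forall_mem_map, List.map_map, Function.comp_def]

theorem admissible_append_map {N : ℕ} {X : HMonomial V} (hN : ∀ j ∈ X.heights, j < N)
    (Y : HMonomial V) : Admissible (X ++ Y.mapHeights (N + ·)) ↔ X.Admissible ∧ Y.Admissible := by
  rw [admissible_append, admissible_map (fun a _ b _ e => by simpa using e), heights_map]
  refine ⟨fun h => ⟨h.1, h.2.1⟩, fun h => ⟨h.1, h.2, fun j hj hj' => ?_⟩⟩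
  obtain ⟨k, -, hk⟩ := List.mem_map.1 hj'
  have := hN j hj
  omega

end HMonomial

namespace QN
variable {K : Type*} [Field K]

theorem mono_perm {X Y : HMonomial V} (h : X.Perm Y) : (mono X : QN K V) = mono Y := by
  by_cases hX : X.Admissible
  · have := proj_eq_zero (K := K) (.perm X Y hX h)
    rwa [map_sub, sub_eq_zero] at this
  · rw [mono_of_not hX, mono_of_not (fun e => hX ((admissible_perm h).2 e))]

theorem mono_map {X : HMonomial V} {f : ℕ → ℕ} (hf : StrictMonoOn f {h | h ∈ X.heights}) :
    (mono (X.mapHeights f) : QN K V) = mono X := by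
  by_cases hX : X.Admissible
  · have := proj_eq_zero (K := K) (.reheight X f hX hf)
    rw [map_sub, sub_eq_zero] at this
    exact this.symm
  · rw [mono_of_not hX, mono_of_not (fun e => hX ((admissible_map hf.injOn).1 e))]

theorem mono_append_map {X Y : HMonomial V} {f g : ℕ → ℕ}
    (hXY : ∀ i ∈ X.heights, ∀ j ∈ Y.heights, i < j)
    (hf : StrictMonoOn f {h | h ∈ X.heights}) (hg : StrictMonoOn g {h | h ∈ Y.heights})
    (hfg : ∀ i ∈ X.heights, ∀ j ∈ Y.heights, f i < g j) :
    (mono (X.mapHeights f ++ Y.mapHeights g) : QN K V) = mono (X ++ Y) := by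
  classical
  let F : ℕ → ℕ := fun h => if h ∈ X.heights then f h else g h
  have hY : ∀ j ∈ Y.heights, j ∉ X.heights := fun j hj hj' => (hXY j hj' j hj).false
  have e : X.mapHeights f ++ Y.mapHeights g = mapHeights F (X ++ Y) := by
    rw [mapHeights_append, mapHeights_congr (X := X) (g := F) (fun j hj => by simp [F, hj]),
      mapHeights_congr (X := Y) (g := F) (fun j hj => by simp [F, hY j hj])]
  rw [e, mono_map]
  intro i hi j hj hij
  simp only [Set.mem_ofPred_eq, heights_append, List.mem_append] at hi hj
  rcases hi with hi | hi <;> rcases hj with hj | hj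
  · simpa [F, hi, hj] using hf hi hj hij
  · simpa [F, hi, hY j hj] using hfg i hi j hj
  · exact absurd (hXY j hj i hi) (by omega)
  · simpa [F, hY i hi, hY j hj] using hg hi hj hij

theorem mono_above {X : HMonomial V} (Y : HMonomial V) {N : ℕ} (hN : ∀ j ∈ X.heights, j < N) :
    (mono (X ++ Y.mapHeights (N + ·)) : QN K V) = mono (X.above Y) := by
  have h := mono_append_map (K := K) (X := X) (Y := Y.mapHeights (X.bound + ·)) (f := id)
    (g := fun h => N + (h - X.bound)) ?_ ?_ ?_ ?_
  · rw [above, ← h, mapHeights_map, mapHeights_id (f := id) (fun _ _ => rfl)]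
    congr 2
    simp [Function.comp_def]
  · intro i hi j hj
    rw [heights_map] at hj
    obtain ⟨k, -, rfl⟩ := List.mem_map.1 hj
    have := X.lt_bound i hi
    omega
  · intro i _ j _ h; exact h
  · intro i hi j hj h
    rw [Set.mem_ofPred_eq, heights_map] at hi hj
    obtain ⟨k, -, rfl⟩ := List.mem_map.1 hi
    obtain ⟨k', -, rfl⟩ := List.mem_map.1 hj
    simp only at *
    omega
  · intro i hi j hj
    have := hN i hi
    simp only [id]
    omega

/-- `Y ↦` the class of `Y` placed above `X`. -/
noncomputable def mulRightFree (X : HMonomial V) : Free K V →ₗ[K[X]] QN K V :=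
  Free.lift fun Y => mono (X.above Y.1)

theorem mulRightFree_mono (X Y : HMonomial V) :
    mulRightFree X (Free.mono Y : Free K V) = mono (X.above Y) := by
  by_cases hY : Y.Admissible
  · rw [Free.mono_of hY, mulRightFree, Free.lift_ofMonomial]
  · rw [Free.mono_of_not hY, map_zero, mono_of_not]
    rw [above, admissible_append_map X.lt_bound]
    exact fun h => hY h.2

theorem mulRightFree_rel (X : HMonomial V) (hX : X.Admissible) :
    relSubmodule K V ≤ LinearMap.ker (mulRightFree X : Free K V →ₗ[K[X]] QN K V) := by
  rw [relSubmodule, Submodule.span_le]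
  intro z hz
  have comm : ∀ P Q : HMonomial V, (mono (P ++ Q) : QN K V) = mono (Q ++ P) := fun P Q =>
    mono_perm List.perm_append_comm
  have hadm : ∀ Y : HMonomial V, Y.Admissible → Admissible (Y.mapHeights (X.bound + ·) ++ X) := by
    intro Y hY
    rw [admissible_perm List.perm_append_comm, admissible_append_map X.lt_bound]
    exact ⟨hX, hY⟩
  have hj' : ∀ (Y : HMonomial V) (h k : ℕ), (∀ j ∈ Y.heights, ¬(h < j ∧ j < k)) →
      ∀ j ∈ heights (Y.mapHeights (X.bound + ·) ++ X), ¬(X.bound + h < j ∧ j < X.bound + k) := by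
    intro Y h k H j hj
    rw [heights_append, heights_map, List.mem_append] at hj
    rcases hj with hj | hj
    · obtain ⟨i, hi, rfl⟩ := List.mem_map.1 hj
      have := H i hi
      omega
    · have := X.lt_bound j hj
      omega
  rw [SetLike.mem_coe, LinearMap.mem_ker]
  cases hz with
  | perm Y Y' hY h =>
    rw [map_sub, mulRightFree_mono, mulRightFree_mono, sub_eq_zero]
    exact mono_perm ((h.map _).append_left X)
  | rotate v a l Z hY =>
    rw [map_sub, mulRightFree_mono, mulRightFree_mono, above, above, comm X, comm X, sub_eq_zero]
    have h1 := hadm _ hY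
    simp only [mapHeights_cons, List.map_cons, List.map_append, List.map_nil, List.cons_append] at h1 ⊢
    have := proj_eq_zero (K := K) (.rotate _ _ _ _ h1)
    rwa [map_sub, sub_eq_zero] at this
  | reheight Y f hY hf =>
    rw [map_sub, mulRightFree_mono, mulRightFree_mono, sub_eq_zero]
    have h := mono_append_map (K := K) (X := X) (Y := Y.mapHeights (X.bound + ·)) (f := id)
      (g := fun h => X.bound + f (h - X.bound)) ?_ ?_ ?_ ?_
    · rw [above, above, ← h, mapHeights_map, mapHeights_map, mapHeights_id (f := id) (fun _ _ => rfl)]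
      congr 2
      simp [Function.comp_def]
    · intro i hi j hj
      rw [heights_map] at hj
      obtain ⟨k, -, rfl⟩ := List.mem_map.1 hj
      have := X.lt_bound i hi
      omega
    · intro i _ j _ h; exact h
    · intro i hi j hj h
      rw [Set.mem_ofPred_eq, heights_map] at hi hj
      obtain ⟨k, hk, rfl⟩ := List.mem_map.1 hi
      obtain ⟨k', hk', rfl⟩ := List.mem_map.1 hj
      simp only [Nat.add_sub_cancel_left] at *
      have := hf hk hk' (by omega)
      omega
    · intro i hi j hj
      have := X.lt_bound i hi
      simp only [id]
      omega
  | skein v w a b h k l m Z hY hk hadj =>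
    rw [map_sub, map_sub, map_smul, mulRightFree_mono, mulRightFree_mono, mulRightFree_mono, above,
      above, above, comm X, comm X, comm X]
    have h1 := hadm _ hY
    have h2 := hj' _ _ _ hadj
    simp only [mapHeights_cons, List.map_cons, List.map_append, List.cons_append] at h1 h2 ⊢
    have := proj_eq_zero (K := K) (.skein _ _ _ _ _ _ _ _ _ h1 (by omega) h2)
    rwa [map_sub, map_sub, map_smul] at this
  | skeinSelf v a b h k l m Z hY hk hadj =>
    rw [map_sub, map_sub, map_smul, mulRightFree_mono, mulRightFree_mono, mulRightFree_mono, above,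
      above, above, comm X, comm X, comm X]
    have h1 := hadm _ hY
    have h2 := hj' _ _ _ hadj
    simp only [mapHeights_cons, List.map_cons, List.map_append, List.cons_append] at h1 h2 ⊢
    have := proj_eq_zero (K := K) (.skeinSelf _ _ _ _ _ _ _ _ h1 (by omega) h2)
    rwa [map_sub, map_sub, map_smul] at this

/-- `Y ↦ X * Y`, on classes `Y`. -/
noncomputable def mulRight (X : {X : HMonomial V // X.Admissible}) : QN K V →ₗ[K[X]] QN K V :=
  (relSubmodule K V).liftQ (mulRightFree X.1) (mulRightFree_rel X.1 X.2)

/-- `(X, Y) ↦ X * Y`, on classes `Y`. -/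
noncomputable def mulFree : Free K V →ₗ[K[X]] QN K V →ₗ[K[X]] QN K V :=
  Free.lift mulRight

theorem mulFree_mono (X Y : HMonomial V) :
    mulFree (Free.mono X) (mono Y : QN K V) = mono (X.above Y) := by
  by_cases hX : X.Admissible
  · have e : mulFree (Free.mono X : Free K V) = mulRight ⟨X, hX⟩ := by
      rw [Free.mono_of hX, mulFree, Free.lift_ofMonomial]
    rw [e]
    exact mulRightFree_mono X Y
  · rw [Free.mono_of_not hX, map_zero, mono_of_not (X := above X Y), LinearMap.zero_apply]
    rw [above, admissible_append_map X.lt_bound]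
    exact fun h => hX h.1

theorem mulFree_rel : relSubmodule K V ≤ LinearMap.ker (mulFree (K := K) (V := V)) := by
  rw [relSubmodule, Submodule.span_le]
  intro z hz
  rw [SetLike.mem_coe, LinearMap.mem_ker]
  ext1 y
  rw [LinearMap.zero_apply]
  induction y using QN.induction with
  | zero => simp
  | add x y hx hy => rw [map_add, hx, hy, add_zero]
  | smul c x hx => rw [map_smul, hx, smul_zero]
  | mono Y hYa =>
  have hadm : ∀ (X : HMonomial V) (N : ℕ), X.Admissible → (∀ j ∈ X.heights, j < N) →
      Admissible (X ++ Y.mapHeights (N + ·)) := fun X N hX hN =>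
    (admissible_append_map hN Y).2 ⟨hX, hYa⟩
  have hj' : ∀ (X : HMonomial V) (N h k : ℕ), (∀ j ∈ X.heights, ¬(h < j ∧ j < k)) → k < N →
      ∀ j ∈ heights (X ++ Y.mapHeights (N + ·)), ¬(h < j ∧ j < k) := by
    intro X N h k H hk j hj
    rw [heights_append, heights_map, List.mem_append] at hj
    rcases hj with hj | hj
    · exact H j hj
    · obtain ⟨i, hi, rfl⟩ := List.mem_map.1 hj
      omega
  cases hz with
  | perm X X' hX h =>
    have hb := X.lt_bound
    have hb' : ∀ j ∈ X'.heights, j < X.bound := fun j hj => hb j ((heights_perm h).mem_iff.2 hj)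
    rw [map_sub, LinearMap.sub_apply, mulFree_mono, mulFree_mono, ← mono_above Y hb,
      ← mono_above Y hb', sub_eq_zero]
    exact mono_perm (h.append_right _)
  | rotate v a l Z hX =>
    have hb := lt_bound ((v, a :: l) :: Z)
    have hb' : ∀ j ∈ heights ((a.1.src, l ++ [a]) :: Z), j < bound ((v, a :: l) :: Z) := by
      intro j hj
      refine hb j ?_
      simp only [heights_cons, List.mem_append, List.map_append, List.map_cons, List.map_nil,
        List.mem_cons, List.not_mem_nil, or_false] at hj ⊢
      tauto
    rw [map_sub, LinearMap.sub_apply, mulFree_mono, mulFree_mono, ← mono_above Y hb,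
      ← mono_above Y hb']
    exact proj_eq_zero (.rotate v a l _ (hadm _ _ hX hb))
  | reheight X f hX hf =>
    rw [map_sub, LinearMap.sub_apply, mulFree_mono, mulFree_mono, sub_eq_zero]
    have h := mono_append_map (K := K) (X := X) (Y := Y.mapHeights (X.bound + ·)) (f := f)
      (g := fun h => (X.mapHeights f).bound + (h - X.bound)) ?_ hf ?_ ?_
    · rw [above, above, ← h, mapHeights_map]
      congr 2
      simp [Function.comp_def]
    · intro i hi j hj
      rw [heights_map] at hj
      obtain ⟨k, -, rfl⟩ := List.mem_map.1 hj
      have := X.lt_bound i hi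
      omega
    · intro i hi j hj h
      rw [Set.mem_ofPred_eq, heights_map] at hi hj
      obtain ⟨k, -, rfl⟩ := List.mem_map.1 hi
      obtain ⟨k', -, rfl⟩ := List.mem_map.1 hj
      simp only at *
      omega
    · intro i hi j hj
      have := (X.mapHeights f).lt_bound (f i) (by rw [heights_map]; exact List.mem_map.2 ⟨i, hi, rfl⟩)
      omega
  | skein v w a b h k l m Z hX hk hadj =>
    have hb := lt_bound ((v, (a, h) :: l) :: (w, (b, k) :: m) :: Z)
    have hb1 : ∀ j ∈ heights ((v, (a, k) :: l) :: (w, (b, h) :: m) :: Z),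
        j < bound ((v, (a, h) :: l) :: (w, (b, k) :: m) :: Z) := by
      intro j hj
      refine hb j ?_
      simp only [heights_cons, List.mem_append, List.map_cons, List.mem_cons] at hj ⊢
      tauto
    have hb2 : ∀ j ∈ heights ((a.src, l ++ m) :: Z),
        j < bound ((v, (a, h) :: l) :: (w, (b, k) :: m) :: Z) := by
      intro j hj
      refine hb j ?_
      simp only [heights_cons, List.mem_append, List.map_append, List.map_cons, List.mem_cons] at hj ⊢
      tauto
    have hk' := hb k (by simp [heights_cons])
    rw [map_sub, map_sub, map_smul, LinearMap.sub_apply, LinearMap.sub_apply, LinearMap.smul_apply,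
      mulFree_mono, mulFree_mono, mulFree_mono, ← mono_above Y hb, ← mono_above Y hb1,
      ← mono_above Y hb2]
    have := proj_eq_zero (K := K) (.skein v w a b h k l m _ (hadm _ _ hX hb) hk (hj' _ _ _ _ hadj hk'))
    rwa [map_sub, map_sub, map_smul] at this
  | skeinSelf v a b h k l m Z hX hk hadj =>
    have hb := lt_bound ((v, (a, h) :: l ++ (b, k) :: m) :: Z)
    have hb1 : ∀ j ∈ heights ((v, (a, k) :: l ++ (b, h) :: m) :: Z),
        j < bound ((v, (a, h) :: l ++ (b, k) :: m) :: Z) := by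
      intro j hj
      refine hb j ?_
      simp only [heights_cons, List.mem_append, List.map_append, List.map_cons, List.mem_cons,
        List.cons_append] at hj ⊢
      tauto
    have hb2 : ∀ j ∈ heights ((b.src, m) :: (a.src, l) :: Z),
        j < bound ((v, (a, h) :: l ++ (b, k) :: m) :: Z) := by
      intro j hj
      refine hb j ?_
      simp only [heights_cons, List.mem_append, List.map_append, List.map_cons, List.mem_cons,
        List.cons_append] at hj ⊢
      tauto
    have hk' := hb k (by simp [heights_cons])
    rw [map_sub, map_sub, map_smul, LinearMap.sub_apply, LinearMap.sub_apply, LinearMap.smul_apply,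
      mulFree_mono, mulFree_mono, mulFree_mono, ← mono_above Y hb, ← mono_above Y hb1,
      ← mono_above Y hb2]
    have := proj_eq_zero (K := K) (.skeinSelf v a b h k l m _ (hadm _ _ hX hb) hk (hj' _ _ _ _ hadj hk'))
    rwa [map_sub, map_sub, map_smul] at this

/-- The product: place `Y` above `X`. -/
noncomputable def mulLin : QN K V →ₗ[K[X]] QN K V →ₗ[K[X]] QN K V :=
  (relSubmodule K V).liftQ mulFree mulFree_rel

noncomputable instance : Mul (QN K V) := ⟨fun x y => mulLin x y⟩
noncomputable instance : One (QN K V) := ⟨mono []⟩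

theorem mul_def (x y : QN K V) : x * y = mulLin x y := rfl

theorem mono_mul_mono (X Y : HMonomial V) : (mono X * mono Y : QN K V) = mono (X.above Y) :=
  mulFree_mono X Y

noncomputable instance : Ring (QN K V) :=
  { (inferInstance : AddCommGroup (QN K V)), (inferInstance : Mul (QN K V)),
    (inferInstance : One (QN K V)) with
    left_distrib := fun x y z => by simp [mul_def]
    right_distrib := fun x y z => by simp [mul_def]
    zero_mul := fun x => by simp [mul_def]
    mul_zero := fun x => by simp [mul_def]
    mul_assoc := fun x y z => by
      induction x using QN.induction with
      | zero => simp [mul_def]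
      | add x x' h h' => simp only [mul_def, map_add, LinearMap.add_apply] at *; rw [h, h']
      | smul c x h => simp only [mul_def, map_smul, LinearMap.smul_apply] at *; rw [h]
      | mono X hX =>
      induction y using QN.induction with
      | zero => simp [mul_def]
      | add x x' h h' => simp only [mul_def, map_add, LinearMap.add_apply] at *; rw [h, h']
      | smul c x h => simp only [mul_def, map_smul, LinearMap.smul_apply] at *; rw [h]
      | mono Y hY =>
      induction z using QN.induction with
      | zero => simp [mul_def]
      | add x x' h h' => simp only [mul_def, map_add] at *; rw [h, h']
      | smul c x h => simp only [mul_def, map_smul] at *; rw [h]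
      | mono Z hZ =>
        have hN : ∀ j ∈ (X.above Y).heights, j < X.bound + Y.bound := by
          intro j hj
          rw [above, heights_append, heights_map, List.mem_append] at hj
          rcases hj with hj | hj
          · have := X.lt_bound j hj; omega
          · obtain ⟨i, hi, rfl⟩ := List.mem_map.1 hj
            have := Y.lt_bound i hi
            omega
        rw [mono_mul_mono, mono_mul_mono, mono_mul_mono, mono_mul_mono, ← mono_above Z hN]
        simp only [above, mapHeights_append, mapHeights_map, List.append_assoc, Function.comp_def,
          Nat.add_assoc]
    one_mul := fun x => by
      induction x using QN.induction with
      | zero => simp [mul_def]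
      | add x x' h h' => simp only [mul_def, map_add] at *; rw [h, h']
      | smul c x h => simp only [mul_def, map_smul] at *; rw [h]
      | mono X hX =>
        change mono [] * _ = _
        rw [mono_mul_mono]
        exact mono_map (f := (bound [] + ·)) (fun i _ j _ h => by simpa using h)
    mul_one := fun x => by
      induction x using QN.induction with
      | zero => simp [mul_def]
      | add x x' h h' => simp only [mul_def, map_add, LinearMap.add_apply] at *; rw [h, h']
      | smul c x h => simp only [mul_def, map_smul, LinearMap.smul_apply] at *; rw [h]
      | mono X hX =>
        change _ * mono [] = _
        rw [mono_mul_mono]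
        simp [above, mapHeights] }

noncomputable instance : Algebra K[X] (QN K V) :=
  Algebra.ofModule (fun r x y => by simp [mul_def]) (fun r x y => by simp [mul_def])

/-- The action of the scalars of `K`. -/
noncomputable instance : Module K (QN K V) :=
  Module.compHom (QN K V) (C : K →+* K[X])

theorem smul_def (r : K) (x : QN K V) : r • x = (C r : K[X]) • x := rfl

/-- The height-lifting of `a₁ ⋯ aᵣ` is `(a₁, 1) ⋯ (aᵣ, r)`, with the heights increasing from left to
right, extended linearly. The lifting of the trivial path at a vertex is the idempotent at this
vertex, and the lifting of a path that is not closed, whose class in `(K Q̄)_♮` is zero, is zero. -/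
noncomputable def heightLift : PathAlgebra K V →ₗ[K] QN K V :=
  PathAlgebra.lift fun p => mono [(p.tgt, p.arrows.zipIdx 1)]

end QN

section Reduction

open scoped Pointwise

variable {K : Type*} [Field K] [Fintype V]

/-- The class of an element of `A` in `A_♮`. -/
def toCyclic {K A : Type*} [CommRing K] [Ring A] [Algebra K A] : A →ₗ[K] CyclicQuotient K A :=
  (commutatorSubmodule K A).mkQ

/-- `S` is a set of representatives in `K Q̄` of `(K Q̄ w)_♮`, the subspace of all classes of
elements `y w`: the classes of the elements of `S` lie in it, and each of its elements is the class
of at least one element of `S`. A representative fixes at which arrow each cyclic word is cut open,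
and thus its height-lifting. -/
def RepresentsMoment [Fintype (Quiver.Total V)] (S : Set (PathAlgebra K V)) : Prop :=
  toCyclic (K := K) '' S = toCyclic (K := K) '' Set.range fun y => y * momentMap K V

/-- The reduction of `N(Q)_ħ`: the quotient by the two-sided ideal generated by the height-liftings
of the elements of `S`, where `S` is a set of representatives of `(K Q̄ w)_♮`. -/
abbrev QuantumReduction (K V : Type*) [Field K] [Quiver V] (S : Set (PathAlgebra K V)) : Type _ :=
  QN K V ⧸ (TwoSidedIdeal.span (QN.heightLift '' S)).asIdeal

/-- The quotient `R / ħ R` of a `K[ħ]`-module `R`, where `ħ` is the variable of `K[X]`. -/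
def ModH (K R : Type*) [Field K] [AddCommGroup R] [Module K[X] R] : Type _ :=
  R ⧸ ((Polynomial.X : K[X]) • (⊤ : Submodule K[X] R))

namespace ModH
variable {R : Type*} [AddCommGroup R] [Module K[X] R]

noncomputable instance : AddCommGroup (ModH K R) :=
  inferInstanceAs (AddCommGroup (R ⧸ ((Polynomial.X : K[X]) • (⊤ : Submodule K[X] R))))

noncomputable instance : Module K[X] (ModH K R) :=
  inferInstanceAs (Module K[X] (R ⧸ ((Polynomial.X : K[X]) • (⊤ : Submodule K[X] R))))

/-- The action of the scalars of `K`. -/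
noncomputable instance : Module K (ModH K R) :=
  Module.compHom (ModH K R) (C : K →+* K[X])

/-- The class of an element of `R`. -/
noncomputable def mk : R →ₗ[K[X]] ModH K R :=
  ((Polynomial.X : K[X]) • (⊤ : Submodule K[X] R)).mkQ

end ModH

/-- The class of an element of `N(Q)_ħ` in `R / ħ R`, where `R` is the reduction of `N(Q)_ħ`. -/
noncomputable def reductionClass (S : Set (PathAlgebra K V)) (z : QN K V) :
    ModH K (QuantumReduction K V S) :=
  ModH.mk (Ideal.Quotient.mk (TwoSidedIdeal.span (QN.heightLift '' S)).asIdeal z)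

end Reduction

end

end NecklaceQuantization

/-! At `ħ = 0` the quantized necklace algebra is the universal enveloping algebra of the necklace
Lie algebra `L = (K Q̄)_♮`, and the theorem is the quotient of this isomorphism by the moment
relations.

Modulo `ħ`, an exchange of adjacent heights inside one component changes nothing, so the class of a
height-lifting depends only on the cyclic word. An exchange between different components adds a
glued word. Moving one word past another collects one gluing for each pair of letters, hence the
commutator of two words is their necklace bracket (`cycWord_commutator`, `cycLift_lie`). This gives
an algebra map from `U(L)` to the specialization (`envelopingLift`). It is surjective because the
heights of any monomial can be sorted at the price of monomials with fewer components
(`map_mem_of_cycWord_mem`).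

Injectivity is the hard part: one has to know that the skein relations do not collapse the module.
For this a symbol map `Φ` from the quantized necklace algebra to a polynomial ring is built, by a
formula of Moyal type. Forget the heights, take the product of the components as a polynomial in
cyclic words, and apply the exponential of the second order operator that glues two components at a
pair of letters, with weight one half of the sign of the height difference times the pairing.
Exchanging two adjacent heights changes the weight of exactly one pair, by one. Contractions with
different weights commute (`contract_glueForm_comm`), so the exponential factors, and the extra
factor reproduces the glued term of the skein relation (`symbol_add`, `symbol_skein`). Within one
component nothing is contracted, which is consistent with `ħ = 0`.

Each contraction lowers the degree, so the leading term of the symbol of a product of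
height-liftings is the product of the words. Sorted products in a basis of `L` span `U(L)`, the easy
half of the Poincaré–Birkhoff–Witt theorem, and the leading terms of their symbols are distinct
monomials; therefore `envelopingLift` is injective (`envelopingLift_injective`).

Finally, the kernel of `pr` consists exactly of the classes of the elements `y w`
(`pr_eq_zero_iff`). Modulo `ħ` the height-lifting factors through classes, so the choice of
representatives in `S` is irrelevant. The map to `U((Π Q)_♮)` and the map to the reduction at `ħ =
0` are two surjections with the same kernel (`toEnveloping_eq_zero_iff`), which yields `v`;
uniqueness holds because products of Lie algebra elements span. -/

namespace NecklaceQuantization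

/-! ### Second order operators on polynomial rings attached to bilinear forms. -/

section SecondOrder

open MvPolynomial

variable {σ τ K : Type*} [Field K]

/-- The linear polynomial given by a linear combination of variables. -/
noncomputable def linPoly : (σ →₀ K) →ₗ[K] MvPolynomial σ K := Finsupp.linearCombination K X

theorem linPoly_single (i : σ) (c : K) : linPoly (Finsupp.single i c) = c • (X i : MvPolynomial σ K) := by
  simp [linPoly]

/-- Linear maps on polynomials which agree at `1`, and whose agreement is inherited by products with
variables, are equal. -/
theorem linearMap_ext_X_mul {M : Type*} [AddCommMonoid M] [Module K M]
    {f g : MvPolynomial σ K →ₗ[K] M} (h1 : f 1 = g 1)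
    (hX : ∀ i p, f p = g p → f (X i * p) = g (X i * p)) : f = g := by
  refine (basisMonomials σ K).ext fun s => ?_
  simp only [coe_basisMonomials]
  induction s using Finsupp.induction_linear with
  | zero => exact h1
  | add s t hs ht =>
    have key : ∀ (t : σ →₀ ℕ) (p : MvPolynomial σ K), f p = g p →
        f (monomial t 1 * p) = g (monomial t 1 * p) := by
      intro t
      induction t using Finsupp.induction_linear with
      | zero => intro p hp; simpa using hp
      | add s t hs ht =>
        intro p hp
        have e : (monomial (s + t) 1 : MvPolynomial σ K) = monomial s 1 * monomial t 1 := by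
          simp [monomial_mul]
        rw [e, mul_assoc]
        exact hs _ (ht _ hp)
      | single i n =>
        rw [← X_pow_eq_monomial]
        induction n with
        | zero => intro p hp; simpa using hp
        | succ n ih => intro p hp; rw [pow_succ', mul_assoc]; exact hX _ _ (ih p hp)
    have e : (monomial (s + t) 1 : MvPolynomial σ K) = monomial s 1 * monomial t 1 := by
      simp [monomial_mul]
    rw [e]
    exact key s _ ht
  | single i n =>
    rw [← X_pow_eq_monomial]
    induction n with
    | zero => simpa using h1
    | succ n ih => rw [pow_succ']; exact hX _ _ ih

variable (B : (σ →₀ K) →ₗ[K] (σ →₀ K) →ₗ[K] (σ →₀ K))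

/-- The derivation of the polynomial ring which extends `y ↦ B x y`. -/
noncomputable def bilinDer (x : σ →₀ K) : Derivation K (MvPolynomial σ K) (MvPolynomial σ K) :=
  mkDerivation K fun i => linPoly (B x (Finsupp.single i 1))

theorem bilinDer_X (x : σ →₀ K) (i : σ) :
    bilinDer B x (X i) = linPoly (B x (Finsupp.single i 1)) := mkDerivation_X _ _ _

theorem bilinDer_linPoly (x y : σ →₀ K) : bilinDer B x (linPoly y) = linPoly (B x y) := by
  induction y using Finsupp.induction_linear with
  | zero => simp
  | add y z hy hz => simp only [map_add, hy, hz]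
  | single i c =>
    rw [linPoly_single, Derivation.map_smul, bilinDer_X, ← map_smul, ← map_smul]
    simp

theorem bilinDer_add (x y : σ →₀ K) : bilinDer B (x + y) = bilinDer B x + bilinDer B y := by
  refine derivation_ext fun i => ?_
  rw [Derivation.add_apply, bilinDer_X, bilinDer_X, bilinDer_X, map_add, LinearMap.add_apply, map_add]

theorem bilinDer_smul (c : K) (x : σ →₀ K) : bilinDer B (c • x) = c • bilinDer B x := by
  refine derivation_ext fun i => ?_
  rw [Derivation.smul_apply, bilinDer_X, bilinDer_X, map_smul, LinearMap.smul_apply, map_smul]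

theorem bilinDer_zero : bilinDer B 0 = 0 := by
  simpa using bilinDer_smul B (0 : K) 0

/-- The second order differential operator `½ ∑ᵢⱼ B(xᵢ, xⱼ) ∂ᵢ ∂ⱼ`, which replaces each unordered pair
of factors `x, y` of a monomial by `B(x, y)`. -/
noncomputable def contract : MvPolynomial σ K →ₗ[K] MvPolynomial σ K :=
  (basisMonomials σ K).constr K fun s =>
    (2⁻¹ : K) • ∑ i ∈ s.support, bilinDer B (Finsupp.single i 1) (pderiv i (monomial s 1))

/-- The freedom in `T` lets a monomial and its product with a variable be summed over one index set;
the added summands vanish because the partial derivatives do. -/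
theorem contract_monomial (s : σ →₀ ℕ) (T : Finset σ) (hT : s.support ⊆ T) :
    contract B (monomial s 1) =
      (2⁻¹ : K) • ∑ i ∈ T, bilinDer B (Finsupp.single i 1) (pderiv i (monomial s 1)) := by
  have h : contract B (monomial s 1) = contract B (basisMonomials σ K s) := by simp
  rw [h, contract, Module.Basis.constr_basis]
  congr 1
  refine Finset.sum_subset hT fun i _ hi => ?_
  rw [pderiv_monomial]
  simp [Finsupp.notMem_support_iff.1 hi]

theorem contract_one : contract B 1 = 0 := by
  have := contract_monomial B 0 ∅ (by simp)
  simpa using this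

variable {B} (hB : ∀ x y, B x y = B y x)
include hB

/-- The chain rule for the derivation that extends `B xₖ`; the symmetry of `B` turns its values `B
xₖ xᵢ` into `B xᵢ xₖ`. -/
theorem sum_bilin_pderiv (k : σ) (s : σ →₀ ℕ) (T : Finset σ) (hT : s.support ⊆ T) :
    ∑ i ∈ T, pderiv i (monomial s 1) * linPoly (B (Finsupp.single i 1) (Finsupp.single k 1)) =
      bilinDer B (Finsupp.single k 1) (monomial s 1) := by
  rw [bilinDer, mkDerivation_monomial, one_smul, Finsupp.sum]
  rw [← Finset.sum_subset hT]
  · refine Finset.sum_congr rfl fun i _ => ?_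
    rw [pderiv_monomial, one_mul, hB, smul_eq_mul]
  · intro i _ hi
    rw [pderiv_monomial]
    simp [Finsupp.notMem_support_iff.1 hi]

/-- The commutator of a second order operator with a multiplication is first order. Together with
the value at `1` this rule determines the operator, so it is the form in which contraction is used
in the inductions over products. -/
theorem contract_X_mul [CharZero K] (k : σ) (f : MvPolynomial σ K) :
    contract B (X k * f) = X k * contract B f + bilinDer B (Finsupp.single k 1) f := by
  classical
  have key : (contract B) ∘ₗ LinearMap.mulLeft K (X k) =
      LinearMap.mulLeft K (X k) ∘ₗ contract B + (bilinDer B (Finsupp.single k 1)).toLinearMap := by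
    refine (basisMonomials σ K).ext fun s => ?_
    simp only [coe_basisMonomials, LinearMap.comp_apply, LinearMap.mulLeft_apply, LinearMap.add_apply,
      Derivation.coeFn_coe]
    have hT : s.support ⊆ insert k s.support := Finset.subset_insert _ _
    have e : (X k * monomial s 1 : MvPolynomial σ K) = monomial (Finsupp.single k 1 + s) 1 := by
      rw [X, monomial_mul, one_mul]
    rw [e, contract_monomial B _ (insert k s.support), contract_monomial B s _ hT, ← e]
    · have h1 : ∀ i, bilinDer B (Finsupp.single i 1) (pderiv i (X k * monomial s 1)) =
          X k * bilinDer B (Finsupp.single i 1) (pderiv i (monomial s 1)) +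
          pderiv i (monomial s 1) * linPoly (B (Finsupp.single i 1) (Finsupp.single k 1)) +
          (if i = k then bilinDer B (Finsupp.single k 1) (monomial s 1) else 0) := by
        intro i
        rw [Derivation.leibniz, smul_eq_mul, smul_eq_mul, map_add, Derivation.leibniz, smul_eq_mul,
          smul_eq_mul, bilinDer_X]
        congr 1
        by_cases h : i = k
        · subst h; simp
        · simp [pderiv_X_of_ne (Ne.symm h), h]
      simp only [h1, Finset.sum_add_distrib, Finset.sum_ite_eq', Finset.mem_insert_self, if_true,
        sum_bilin_pderiv hB k s _ hT, ← Finset.mul_sum, smul_add, mul_smul_comm]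
      rw [add_assoc, ← add_smul]
      norm_num
    · refine Finsupp.support_add.trans (Finset.union_subset ?_ hT)
      refine Finsupp.support_single_subset.trans ?_
      simp
  exact LinearMap.congr_fun key f

theorem contract_linPoly_mul [CharZero K] (x : σ →₀ K) (f : MvPolynomial σ K) :
    contract B (linPoly x * f) = linPoly x * contract B f + bilinDer B x f := by
  induction x using Finsupp.induction_linear with
  | zero => simp [bilinDer_zero]
  | add x y hx hy =>
    rw [bilinDer_add, Derivation.add_apply, map_add, add_mul, add_mul, map_add, hx, hy]; abel
  | single i c =>
    have : Finsupp.single i c = c • Finsupp.single i (1 : K) := by simp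
    rw [this, bilinDer_smul, Derivation.smul_apply, map_smul, linPoly_single, one_smul,
      smul_mul_assoc, smul_mul_assoc, map_smul, contract_X_mul hB, smul_add]

omit hB in
/-- Contraction with the sum of two forms. -/
theorem contract_add (B B' : (σ →₀ K) →ₗ[K] (σ →₀ K) →ₗ[K] (σ →₀ K)) :
    contract (B + B') = contract B + contract B' := by
  have hD : ∀ x, bilinDer (B + B') x = bilinDer B x + bilinDer B' x := fun x => by
    refine derivation_ext fun i => ?_
    rw [Derivation.add_apply, bilinDer_X, bilinDer_X, bilinDer_X, LinearMap.add_apply,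
      LinearMap.add_apply, map_add]
  refine (basisMonomials σ K).ext fun s => ?_
  rw [coe_basisMonomials, LinearMap.add_apply, contract_monomial _ s _ subset_rfl,
    contract_monomial _ s _ subset_rfl, contract_monomial _ s _ subset_rfl, ← smul_add,
    ← Finset.sum_add_distrib]
  simp only [hD, Derivation.add_apply]

/-- Contractions with two symmetric forms commute if the forms are compatible. -/
theorem contract_comm [CharZero K] {B' : (σ →₀ K) →ₗ[K] (σ →₀ K) →ₗ[K] (σ →₀ K)}
    (hB' : ∀ x y, B' x y = B' y x)
    (hBB' : ∀ i j k : σ,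
      B (B' (Finsupp.single i 1) (Finsupp.single j 1)) (Finsupp.single k 1) +
      B (B' (Finsupp.single j 1) (Finsupp.single k 1)) (Finsupp.single i 1) +
      B (B' (Finsupp.single k 1) (Finsupp.single i 1)) (Finsupp.single j 1) =
      B' (B (Finsupp.single i 1) (Finsupp.single j 1)) (Finsupp.single k 1) +
      B' (B (Finsupp.single j 1) (Finsupp.single k 1)) (Finsupp.single i 1) +
      B' (B (Finsupp.single k 1) (Finsupp.single i 1)) (Finsupp.single j 1)) :
    Commute (contract B) (contract B') := by
  -- Both sides are derivations, so it suffices to compare them on a variable `z`. There the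
  -- identity is the compatibility hypothesis, with the arguments reordered by symmetry.
  have hder : ∀ x y : σ, bilinDer B (B' (Finsupp.single x 1) (Finsupp.single y 1)) +
      ⁅bilinDer B (Finsupp.single y 1), bilinDer B' (Finsupp.single x 1)⁆ =
      bilinDer B' (B (Finsupp.single x 1) (Finsupp.single y 1)) +
      ⁅bilinDer B' (Finsupp.single y 1), bilinDer B (Finsupp.single x 1)⁆ := by
    intro x y
    refine derivation_ext fun z => ?_
    simp only [Derivation.add_apply, Derivation.commutator_apply, bilinDer_X, bilinDer_linPoly,
      ← map_add, ← map_sub]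
    congr 1
    have h := hBB' x y z
    rw [hB _ (Finsupp.single x 1), hB (B' (Finsupp.single z 1) (Finsupp.single x 1)),
      hB' (Finsupp.single z 1), hB' (B (Finsupp.single y 1) (Finsupp.single z 1)),
      hB' (B (Finsupp.single z 1) (Finsupp.single x 1)), hB (Finsupp.single z 1)] at h
    rw [← sub_eq_zero] at h ⊢
    rw [← h]
    abel
  -- The two mixed commutators of a contraction with a derivation agree. Passing a factor `y`
  -- through both sides produces exactly the two sides of `hder x y`.
  have hG : ∀ x f, contract B (bilinDer B' (Finsupp.single x 1) f) -
      bilinDer B' (Finsupp.single x 1) (contract B f) =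
      contract B' (bilinDer B (Finsupp.single x 1) f) -
      bilinDer B (Finsupp.single x 1) (contract B' f) := by
    intro x f
    have := linearMap_ext_X_mul
      (f := contract B ∘ₗ (bilinDer B' (Finsupp.single x 1)).toLinearMap -
        (bilinDer B' (Finsupp.single x 1)).toLinearMap ∘ₗ contract B)
      (g := contract B' ∘ₗ (bilinDer B (Finsupp.single x 1)).toLinearMap -
        (bilinDer B (Finsupp.single x 1)).toLinearMap ∘ₗ contract B') ?_ ?_
    · exact LinearMap.congr_fun this f
    · simp [contract_one]
    · intro y f ih
      simp only [LinearMap.sub_apply, LinearMap.comp_apply, Derivation.coeFn_coe] at ih ⊢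
      have hd := DFunLike.congr_fun (hder x y) f
      simp only [Derivation.add_apply, Derivation.commutator_apply] at hd
      simp only [Derivation.leibniz, smul_eq_mul, map_add, contract_X_mul hB, contract_X_mul hB',
        bilinDer_X]
      rw [mul_comm f, mul_comm f, contract_linPoly_mul hB, contract_linPoly_mul hB',
        mul_comm (contract B f), mul_comm (contract B' f)]
      linear_combination (X y) * ih + hd
  refine linearMap_ext_X_mul ?_ fun x f ih => ?_
  · simp [contract_one]
  -- By `hG` the commutator of the two contractions commutes with multiplication by `x`; as it kills
  -- `1`, it vanishes.
  · have h := hG x f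
    simp only [Module.End.mul_apply] at ih ⊢
    rw [contract_X_mul hB', contract_X_mul hB, map_add, map_add, contract_X_mul hB',
      contract_X_mul hB, ih]
    linear_combination h

omit hB in
theorem linPoly_mapDomain (φ : σ → τ) (x : σ →₀ K) :
    linPoly (Finsupp.mapDomain φ x) = rename φ (linPoly x) := by
  induction x using Finsupp.induction_linear with
  | zero => simp
  | add x y hx hy => simp only [Finsupp.mapDomain_add, map_add, hx, hy]
  | single i c => simp [linPoly_single]

/-- Contraction is natural. -/
theorem contract_rename [CharZero K] (φ : σ → τ) {B' : (τ →₀ K) →ₗ[K] (τ →₀ K) →ₗ[K] (τ →₀ K)}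
    (hB' : ∀ x y, B' x y = B' y x)
    (hφ : ∀ i j, B' (Finsupp.single (φ i) 1) (Finsupp.single (φ j) 1) =
      Finsupp.mapDomain φ (B (Finsupp.single i 1) (Finsupp.single j 1))) (f : MvPolynomial σ K) :
    contract B' (rename φ f) = rename φ (contract B f) := by
  have hD : ∀ i f, bilinDer B' (Finsupp.single (φ i) 1) (rename φ f) =
      rename φ (bilinDer B (Finsupp.single i 1) f) := by
    intro i f
    have := linearMap_ext_X_mul
      (f := (bilinDer B' (Finsupp.single (φ i) 1)).toLinearMap ∘ₗ (rename φ).toLinearMap)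
      (g := (rename φ).toLinearMap ∘ₗ (bilinDer B (Finsupp.single i 1)).toLinearMap) ?_ ?_
    · exact LinearMap.congr_fun this f
    · simp
    · intro j f ih
      simp only [LinearMap.comp_apply, Derivation.coeFn_coe, AlgHom.toLinearMap_apply] at ih ⊢
      simp only [map_mul, rename_X, Derivation.leibniz, smul_eq_mul, bilinDer_X, map_add, ih, hφ,
        linPoly_mapDomain]
  have := linearMap_ext_X_mul
      (f := contract B' ∘ₗ (rename φ).toLinearMap)
      (g := (rename φ).toLinearMap ∘ₗ contract B) ?_ ?_
  · exact LinearMap.congr_fun this f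
  · simp [contract_one]
  · intro j f ih
    simp only [LinearMap.comp_apply, AlgHom.toLinearMap_apply] at ih ⊢
    rw [map_mul, rename_X, contract_X_mul hB', contract_X_mul hB, map_add, map_mul, rename_X, ih, hD]

omit hB in
theorem bilinDer_prod_eq_zero (x : σ →₀ K) (l : List (σ →₀ K)) (h : ∀ y ∈ l, B x y = 0) :
    bilinDer B x (l.map linPoly).prod = 0 := by
  induction l with
  | nil => simp
  | cons j l ih =>
    simp only [List.mem_cons, forall_eq_or_imp] at h
    rw [List.map_cons, List.prod_cons, Derivation.leibniz, ih h.2, bilinDer_linPoly, h.1]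
    simp

/-- Contraction vanishes on a product of pairwise orthogonal linear polynomials. -/
theorem contract_prod_eq_zero [CharZero K] (l : List (σ →₀ K)) (h : l.Pairwise fun x y => B x y = 0) :
    contract B (l.map linPoly).prod = 0 := by
  induction l with
  | nil => simp [contract_one]
  | cons i l ih =>
    rw [List.pairwise_cons] at h
    rw [List.map_cons, List.prod_cons, contract_linPoly_mul hB, ih h.2, mul_zero, zero_add,
      bilinDer_prod_eq_zero _ _ h.1]

omit hB

theorem linPoly_isHomogeneous (x : σ →₀ K) : (linPoly x).IsHomogeneous 1 := by
  induction x using Finsupp.induction_linear with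
  | zero => rw [map_zero]; exact isHomogeneous_zero _ _ _
  | add x y hx hy => rw [map_add]; exact hx.add hy
  | single i c =>
    rw [linPoly_single, smul_eq_C_mul]
    simpa using (isHomogeneous_C σ c).mul (isHomogeneous_X K i)

theorem bilinDer_isHomogeneous (x : σ →₀ K) {f : MvPolynomial σ K} {n : ℕ} (hf : f.IsHomogeneous n) :
    (bilinDer B x f).IsHomogeneous n := by
  rw [f.as_sum, map_sum]
  refine IsHomogeneous.sum _ _ _ fun s hs => ?_
  rw [bilinDer, mkDerivation_monomial, Finsupp.sum, ← mem_homogeneousSubmodule]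
  refine Submodule.smul_mem _ _ (Submodule.sum_mem _ fun i hi => ?_)
  rw [mem_homogeneousSubmodule]
  have hd : s.degree = n := by
    by_contra h
    exact mem_support_iff.1 hs (hf.coeff_eq_zero h)
  have h1 : (s - Finsupp.single i 1).degree + 1 = n := by
    have : s - Finsupp.single i 1 + Finsupp.single i 1 = s :=
      tsub_add_cancel_of_le (Finsupp.single_le_iff.2 (Nat.one_le_iff_ne_zero.2 (Finsupp.mem_support_iff.1 hi)))
    rw [← hd]
    conv_rhs => rw [← this]
    simp
  rw [← h1]
  exact (isHomogeneous_monomial _ rfl).mul (linPoly_isHomogeneous _)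

/-- The partial derivative lowers the degree by one, and the derivation that follows sends variables
to linear forms, so it keeps the degree. This makes the uncontracted product the leading term of the
symbol. -/
theorem contract_isHomogeneous {f : MvPolynomial σ K} {n : ℕ} (hf : f.IsHomogeneous n) :
    (contract B f).IsHomogeneous (n - 1) := by
  rw [f.as_sum, map_sum]
  refine IsHomogeneous.sum _ _ _ fun s hs => ?_
  have hd : s.degree = n := by
    by_contra h
    exact mem_support_iff.1 hs (hf.coeff_eq_zero h)
  have e : monomial s (coeff s f) = coeff s f • monomial s 1 := by simp [smul_monomial]
  rw [e, map_smul, contract_monomial B s _ subset_rfl, ← mem_homogeneousSubmodule]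
  refine Submodule.smul_mem _ _ (Submodule.smul_mem _ _ (Submodule.sum_mem _ fun i hi => ?_))
  rw [mem_homogeneousSubmodule]
  exact bilinDer_isHomogeneous _ (IsHomogeneous.pderiv (isHomogeneous_monomial _ hd))

end SecondOrder

end NecklaceQuantization

namespace NecklaceQuantization

/-! ### Sums over the letters of words and of cyclic words. -/

section SplitSum

variable {α β M N : Type*} [AddCommMonoid M] [AddCommMonoid N]

/-- The sum of `f l₁ a l₂` over all decompositions `l = l₁ ++ a :: l₂`. -/
def splitSum (f : List α → α → List α → M) (l : List α) : M :=
  ∑ i : Fin l.length, f (l.take i) l[i] (l.drop (i + 1))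

theorem splitSum_nil (f : List α → α → List α → M) : splitSum f [] = 0 :=
  Finset.sum_of_isEmpty (ι := Fin 0) _

theorem splitSum_cons (f : List α → α → List α → M) (a : α) (l : List α) :
    splitSum f (a :: l) = f [] a l + splitSum (fun l₁ b l₂ => f (a :: l₁) b l₂) l :=
  Fin.sum_univ_succ (n := l.length) _

theorem splitSum_append (f : List α → α → List α → M) (l m : List α) :
    splitSum f (l ++ m) = splitSum (fun l₁ b l₂ => f l₁ b (l₂ ++ m)) l +
      splitSum (fun m₁ b m₂ => f (l ++ m₁) b m₂) m := by
  induction l generalizing f with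
  | nil => simp [splitSum_nil]
  | cons a l ih =>
    rw [List.cons_append, splitSum_cons, splitSum_cons, ih, add_assoc]
    rfl

theorem splitSum_congr {f g : List α → α → List α → M} {l : List α}
    (h : ∀ l₁ a l₂, l = l₁ ++ a :: l₂ → f l₁ a l₂ = g l₁ a l₂) : splitSum f l = splitSum g l := by
  refine Finset.sum_congr rfl fun i _ => h _ _ _ ?_
  simp

theorem splitSum_eq_zero {f : List α → α → List α → M} {l : List α}
    (h : ∀ l₁ a l₂, l = l₁ ++ a :: l₂ → f l₁ a l₂ = 0) : splitSum f l = 0 := by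
  refine Finset.sum_eq_zero fun i _ => h _ _ _ ?_
  simp

theorem map_splitSum {F : Type*} [FunLike F M N] [AddMonoidHomClass F M N] (φ : F)
    (f : List α → α → List α → M) (l : List α) :
    φ (splitSum f l) = splitSum (fun l₁ a l₂ => φ (f l₁ a l₂)) l := map_sum φ _ _

theorem splitSum_add (f g : List α → α → List α → M) (l : List α) :
    splitSum (fun l₁ a l₂ => f l₁ a l₂ + g l₁ a l₂) l = splitSum f l + splitSum g l :=
  Finset.sum_add_distrib

theorem splitSum_sub {M : Type*} [AddCommGroup M] (f g : List α → α → List α → M) (l : List α) :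
    splitSum (fun l₁ a l₂ => f l₁ a l₂ - g l₁ a l₂) l = splitSum f l - splitSum g l :=
  Finset.sum_sub_distrib _ _

theorem smul_splitSum {R : Type*} [Semiring R] [Module R M] (r : R) (f : List α → α → List α → M)
    (l : List α) : r • splitSum f l = splitSum (fun l₁ a l₂ => r • f l₁ a l₂) l :=
  Finset.smul_sum

theorem splitSum_comm (f : List α → α → List α → List β → β → List β → M) (l : List α) (m : List β) :
    splitSum (fun l₁ a l₂ => splitSum (f l₁ a l₂) m) l =
      splitSum (fun m₁ b m₂ => splitSum (fun l₁ a l₂ => f l₁ a l₂ m₁ b m₂) l) m :=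
  Finset.sum_comm

theorem splitSum_map (φ : α → β) (f : List β → β → List β → M) (l : List α) :
    splitSum f (l.map φ) = splitSum (fun l₁ a l₂ => f (l₁.map φ) (φ a) (l₂.map φ)) l := by
  induction l generalizing f with
  | nil => rfl
  | cons a l ih => rw [List.map_cons, splitSum_cons, splitSum_cons, ih]; rfl

theorem splitSum_single {f : List α → α → List α → M} {l₁ l₂ : List α} {a : α}
    (h₁ : ∀ m₁ b m₂, b ∈ l₁ → f m₁ b m₂ = 0) (h₂ : ∀ m₁ b m₂, b ∈ l₂ → f m₁ b m₂ = 0) :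
    splitSum f (l₁ ++ a :: l₂) = f l₁ a l₂ := by
  rw [splitSum_append, splitSum_cons, splitSum_eq_zero, splitSum_eq_zero, zero_add, add_zero,
    List.append_nil]
  · rintro m₁ b m₂ rfl; exact h₂ _ _ _ (by simp)
  · rintro m₁ b m₂ rfl; exact h₁ _ _ _ (by simp)

/-- Two letters at different positions can be chosen by fixing the left one first or the right one
first. -/
theorem splitSum_splitSum (f : List α → α → List α → α → List α → M) (l : List α) :
    splitSum (fun l₁ a l₂ => splitSum (fun m₁ b m₂ => f l₁ a m₁ b m₂) l₂) l =
      splitSum (fun l₁ b l₂ => splitSum (fun m₁ a m₂ => f m₁ a m₂ b l₂) l₁) l := by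
  induction l generalizing f with
  | nil => rfl
  | cons a l ih =>
    rw [splitSum_cons, splitSum_cons, ih, splitSum_nil, zero_add, ← splitSum_add]
    refine splitSum_congr fun l₁ b l₂ _ => ?_
    rw [splitSum_cons]

/-- The sum of `g a m` over all rotations `a :: m` of a list. -/
def rotSum (g : α → List α → M) (l : List α) : M := splitSum (fun l₁ a l₂ => g a (l₂ ++ l₁)) l

/-- Hence a sum over rotations depends only on the cyclic word. -/
theorem rotSum_append_comm (g : α → List α → M) (l m : List α) :
    rotSum g (l ++ m) = rotSum g (m ++ l) := by
  simp only [rotSum, splitSum_append, List.append_assoc]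
  rw [add_comm]

theorem rotSum_append (g : α → List α → M) (l m : List α) :
    rotSum g (l ++ m) = splitSum (fun l₁ a l₂ => g a (l₂ ++ (m ++ l₁))) l +
      splitSum (fun m₁ a m₂ => g a (m₂ ++ (l ++ m₁))) m := by
  simp only [rotSum, splitSum_append, List.append_assoc]

theorem rotSum_rotate (g : α → List α → M) (a : α) (l : List α) :
    rotSum g (a :: l) = rotSum g (l ++ [a]) := rotSum_append_comm g [a] l

theorem rotSum_comm (f : α → List α → β → List β → M) (l : List α) (m : List β) :
    rotSum (fun a l' => rotSum (f a l') m) l =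
      rotSum (fun b m' => rotSum (fun a l' => f a l' b m') l) m :=
  splitSum_comm (fun l₁ a l₂ m₁ b m₂ => f a (l₂ ++ l₁) b (m₂ ++ m₁)) l m

theorem rotSum_splitSum_comm (f : List α → α → List α → β → List β → M) (l : List α) (m : List β) :
    splitSum (fun l₁ a l₂ => rotSum (f l₁ a l₂) m) l =
      rotSum (fun b m' => splitSum (fun l₁ a l₂ => f l₁ a l₂ b m') l) m :=
  splitSum_comm (fun l₁ a l₂ m₁ b m₂ => f l₁ a l₂ b (m₂ ++ m₁)) l m

theorem rotSum_add (f g : α → List α → M) (l : List α) :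
    rotSum (fun a m => f a m + g a m) l = rotSum f l + rotSum g l := splitSum_add _ _ l

theorem map_rotSum {F : Type*} [FunLike F M N] [AddMonoidHomClass F M N] (φ : F)
    (f : α → List α → M) (l : List α) : φ (rotSum f l) = rotSum (fun a m => φ (f a m)) l :=
  map_splitSum φ _ l

theorem smul_rotSum {R : Type*} [Semiring R] [Module R M] (r : R) (f : α → List α → M)
    (l : List α) : r • rotSum f l = rotSum (fun a m => r • f a m) l := smul_splitSum r _ l

theorem rotSum_map (φ : α → β) (f : β → List β → M) (l : List α) :
    rotSum f (l.map φ) = rotSum (fun a m => f (φ a) (m.map φ)) l := by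
  simp only [rotSum, splitSum_map, List.map_append]

theorem rotSum_eq_zero {f : α → List α → M} {l : List α} (h : ∀ a ∈ l, ∀ m, f a m = 0) :
    rotSum f l = 0 := by
  refine splitSum_eq_zero fun l₁ a l₂ e => h a ?_ _
  simp [e]

/-- Choosing two letters of a cyclic word can be done in either order. -/
theorem rotSum_splitSum (f : α → List α → α → List α → M) (l : List α) :
    rotSum (fun a m => splitSum (fun m₁ b m₂ => f a m₁ b m₂) m) l =
      rotSum (fun a m => splitSum (fun m₁ b m₂ => f b m₂ a m₁) m) l := by
  simp only [rotSum, splitSum_append, splitSum_add]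
  -- The second letter stands either to the right or to the left of the first in the original list;
  -- interchanging the roles of the letters interchanges these two cases.
  rw [add_comm]
  congr 1
  · exact (splitSum_splitSum (fun l₁ a m₁ b m₂ => f b (m₂ ++ l₁) a m₁) l).symm
  · exact splitSum_splitSum (fun l₁ a m₁ b m₂ => f a m₁ b (m₂ ++ l₁)) l

end SplitSum

end NecklaceQuantization

namespace NecklaceQuantization

open DoubleArrow PathAlgebra HMonomial

/-! ### Gluing cyclic words with heights, with weights on pairs of heights. -/

section Gluing

set_option linter.unusedSectionVars false

variable {V : Type*} [Quiver V]

/-- The arrows `l` compose to a path with target `u` and source `v`. -/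
def IsPath (u : V) (l : List (DoubleArrow V)) (v : V) : Prop := IsWord u l ∧ wordSrc u l = v

theorem isPath_nil {u v : V} : IsPath u [] v ↔ u = v := by simp [IsPath, IsWord, wordSrc]

theorem isPath_cons {u v : V} {a : DoubleArrow V} {l : List (DoubleArrow V)} :
    IsPath u (a :: l) v ↔ a.tgt = u ∧ IsPath a.src l v := by
  simp [IsPath, IsWord, wordSrc, and_assoc]

theorem isPath_append {u v : V} {l m : List (DoubleArrow V)} :
    IsPath u (l ++ m) v ↔ ∃ w, IsPath u l w ∧ IsPath w m v := by
  constructor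
  · rintro ⟨h1, h2⟩
    rw [isWord_append] at h1
    rw [wordSrc_append] at h2
    exact ⟨_, ⟨h1.1, rfl⟩, h1.2, h2⟩
  · rintro ⟨w, ⟨h1, rfl⟩, h3, h4⟩
    exact ⟨(isWord_append _ _ _).2 ⟨h1, h3⟩, by rw [wordSrc_append, h4]⟩

theorem IsPath.append {u v w : V} {l m : List (DoubleArrow V)} (hl : IsPath u l w)
    (hm : IsPath w m v) : IsPath u (l ++ m) v := isPath_append.2 ⟨w, hl, hm⟩

/-- The rest of a closed path after an arrow. -/
theorem IsPath.rotate {v : V} {l m : List (DoubleArrow V)} {a : DoubleArrow V}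
    (h : IsPath v (l ++ a :: m) v) : IsPath a.src (m ++ l) a.tgt := by
  obtain ⟨w, h1, h2⟩ := isPath_append.1 h
  obtain ⟨rfl, h3⟩ := isPath_cons.1 h2
  exact h3.append h1

/-- A component that is a closed path. -/
def ClosedComp (c : HComp V) : Prop := IsPath c.1 (c.2.map Prod.fst) c.1

/-- Closed paths with heights, up to rotation. -/
def HCyc (V : Type*) [Quiver V] : Type _ :=
  Quot fun c d : {c : HComp V // ClosedComp c} =>
    ∃ v a l, c.1 = (v, a :: l) ∧ d.1 = (a.1.src, l ++ [a])

variable {K : Type*} [Field K]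

/-- The class of a closed path with heights. -/
def HCyc.mk (c : HComp V) (h : ClosedComp c) : HCyc V := Quot.mk _ ⟨c, h⟩

theorem HCyc.ind {P : HCyc V → Prop} (h : ∀ c hc, P (HCyc.mk c hc)) (x : HCyc V) : P x := by
  obtain ⟨⟨c, hc⟩⟩ := x
  exact h c hc

variable (K) in
open scoped Classical in
/-- The basis element given by a component, or `0` if the component is not closed. -/
noncomputable def cycClass (c : HComp V) : HCyc V →₀ K :=
  if h : ClosedComp c then Finsupp.single (HCyc.mk c h) 1 else 0

theorem cycClass_of {c : HComp V} (h : ClosedComp c) :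
    cycClass K c = Finsupp.single (HCyc.mk c h) 1 := dif_pos h

theorem ClosedComp.rotate {v u : V} {l m : List (DoubleArrow V × ℕ)}
    (h : ClosedComp (v, l ++ m)) (hl : IsPath v (l.map Prod.fst) u) : ClosedComp (u, m ++ l) := by
  rw [ClosedComp, List.map_append] at h ⊢
  obtain ⟨w, h1, h2⟩ := isPath_append.1 h
  obtain rfl : w = u := h1.2.symm.trans hl.2
  exact h2.append h1

/-- The relation defining `HCyc` moves one letter at a time; a block is moved by induction on its
length. -/
theorem cycClass_append_comm {v u : V} {l m : List (DoubleArrow V × ℕ)}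
    (h : ClosedComp (v, l ++ m)) (hl : IsPath v (l.map Prod.fst) u) :
    cycClass K (v, l ++ m) = cycClass K (u, m ++ l) := by
  induction l generalizing v m with
  | nil =>
    obtain rfl := isPath_nil.1 hl
    simp
  | cons a l ih =>
    have h' : ClosedComp (a.1.src, (l ++ m) ++ [a]) :=
      ClosedComp.rotate (l := [a]) h (isPath_cons.2 ⟨(isPath_cons.1 hl).1, isPath_nil.2 rfl⟩)
    have e : cycClass K (v, (a :: l) ++ m) = cycClass K (a.1.src, (l ++ m) ++ [a]) := by
      rw [cycClass_of h, cycClass_of h']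
      congr 1
      exact Quot.sound ⟨v, a, l ++ m, rfl, rfl⟩
    rw [List.append_assoc] at e h'
    rw [e, ih h' (isPath_cons.1 hl).2, List.append_assoc]
    rfl

/-- Allows summands to be compared only on the words that really occur: what remains of a closed
path after deleting a letter is a path with known ends. -/
theorem rotSum_congr {M : Type*} [AddCommMonoid M] {x : HComp V} (hx : ClosedComp x)
    {g g' : DoubleArrow V × ℕ → List (DoubleArrow V × ℕ) → M}
    (h : ∀ p l, IsPath p.1.src (l.map Prod.fst) p.1.tgt → g p l = g' p l) :
    rotSum g x.2 = rotSum g' x.2 := by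
  refine splitSum_congr fun l₁ p l₂ e => h _ _ ?_
  rw [ClosedComp, e, List.map_append, List.map_cons] at hx
  rw [List.map_append]
  exact hx.rotate

variable [Fintype V] (u w : ℕ → ℕ → K)

/-- The pairing of two letters with heights `i`, `j`, weighted by `u i j`. -/
noncomputable def letterForm (p q : DoubleArrow V × ℕ) : K := u p.2 q.2 * pairing p.1 q.1

variable {u w} in
-- The sign of the antisymmetric weight cancels the sign of the antisymmetric pairing. An
-- antisymmetric weight thus yields a symmetric gluing form, as contraction requires.
theorem letterForm_symm (hu : ∀ i j, u i j = - u j i) (p q : DoubleArrow V × ℕ) :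
    letterForm u p q = letterForm u q p := by
  rw [letterForm, letterForm, hu, pairing_antisymm]; ring

/-- The gluing of two components, as a sum over all pairs of letters. -/
noncomputable def glueComp (x y : HComp V) : HCyc V →₀ K :=
  rotSum (fun p l => rotSum (fun q m => letterForm u p q • cycClass K (p.1.src, l ++ m)) y.2) x.2

/-- The gluing of two cyclic words with heights. -/
noncomputable def glueCyc : HCyc V → HCyc V → (HCyc V →₀ K) :=
  Quot.lift₂ (fun x y => glueComp u x.1 y.1)
    (by
      rintro x y z ⟨v, a, l, h, h'⟩
      simp only [glueComp, h, h', rotSum_rotate])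
    (by
      rintro x y z ⟨v, a, l, h, h'⟩
      simp only [glueComp, h, h', rotSum_rotate])

/-- The gluing of two cyclic words with heights, extended bilinearly. -/
noncomputable def glueForm : (HCyc V →₀ K) →ₗ[K] (HCyc V →₀ K) →ₗ[K] (HCyc V →₀ K) :=
  Finsupp.linearCombination K fun x => Finsupp.linearCombination K (glueCyc u x)

theorem glueForm_single (x y : HCyc V) :
    glueForm u (Finsupp.single x 1) (Finsupp.single y 1) = glueCyc u x y := by
  simp [glueForm]

theorem glueForm_mk {x y : HComp V} (hx : ClosedComp x) (hy : ClosedComp y) :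
    glueForm u (Finsupp.single (HCyc.mk x hx) 1) (Finsupp.single (HCyc.mk y hy) 1) =
      glueComp u x y := glueForm_single u _ _

variable {u w}

/-- The two glued words are rotations of one another. The rotation is legitimate because a nonzero
pairing forces the two letters to be opposite, so that the glued word is closed. -/
theorem glueComp_symm (hu : ∀ i j, u i j = - u j i) {x y : HComp V} (hx : ClosedComp x)
    (hy : ClosedComp y) : glueComp u x y = glueComp u y x := by
  have h : glueComp u y x =
      rotSum (fun p l => rotSum (fun q m => letterForm u q p • cycClass K (q.1.src, m ++ l)) y.2) x.2 :=
    rotSum_comm _ _ _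
  rw [h]
  refine rotSum_congr hx fun p l hl => rotSum_congr hy fun q m hm => ?_
  rw [letterForm_symm hu]
  by_cases hpq : (pairing p.1 q.1 : K) = 0
  · rw [letterForm_symm hu, letterForm, hpq, mul_zero, zero_smul, zero_smul]
  · obtain ⟨h1, h2⟩ := pairing_ends _ _ hpq
    rw [h2] at hl
    have hc : ClosedComp (p.1.src, l ++ m) := by
      rw [ClosedComp, List.map_append]
      rw [← h1] at hm
      exact hl.append hm
    rw [cycClass_append_comm hc hl]

theorem glueForm_symm (hu : ∀ i j, u i j = - u j i) (x y : HCyc V →₀ K) :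
    glueForm u x y = glueForm u y x := by
  induction x using Finsupp.induction_linear with
  | zero => simp
  | add x x' hx hx' => rw [map_add, map_add, LinearMap.add_apply, hx, hx']
  | single x c =>
  induction y using Finsupp.induction_linear with
  | zero => simp
  | add x x' hx hx' => rw [map_add, map_add, LinearMap.add_apply, hx, hx']
  | single y d =>
    have e : ∀ (x : HCyc V) (c : K), Finsupp.single x c = c • Finsupp.single x 1 := by simp
    rw [e x c, e y d]
    simp only [map_smul, LinearMap.smul_apply]
    rw [smul_comm]
    congr 2
    induction x using HCyc.ind with
    | _ x hx =>
    induction y using HCyc.ind with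
    | _ y hy => rw [glueForm_mk, glueForm_mk, glueComp_symm hu hx hy]

theorem glueForm_add : glueForm (V := V) (u + w) = glueForm u + glueForm w := by
  refine Finsupp.lhom_ext' fun x => LinearMap.ext_ring ?_
  refine Finsupp.lhom_ext' fun y => LinearMap.ext_ring ?_
  simp only [LinearMap.comp_apply, Finsupp.lsingle_apply, LinearMap.add_apply]
  induction x using HCyc.ind with
  | _ x hx =>
  induction y using HCyc.ind with
  | _ y hy =>
    have h : ∀ p q : DoubleArrow V × ℕ, letterForm (u + w) p q = letterForm u p q + letterForm w p q :=
      fun p q => by rw [letterForm, letterForm, letterForm, Pi.add_apply, Pi.add_apply, add_mul]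
    simp only [glueForm_mk, glueComp, h, add_smul, rotSum_add]

variable (u w) in
/-- The gluing of `y` to a letter of `x` with the weight `w`, and of `z` to another letter of `x` with
the weight `u`. -/
noncomputable def glueTwo (x y z : HComp V) : HCyc V →₀ K :=
  rotSum (fun p l => splitSum (fun l₁ r l₂ => rotSum (fun q m => rotSum (fun s n =>
    (letterForm w p q * letterForm u r s) • cycClass K (r.1.src, l₂ ++ (m ++ l₁) ++ n)) z.2) y.2) l) x.2

/-- Both sides perform the same surgery on `x`: two letters are removed, and `y` and `z` are
inserted in their places. Only the starting point of the resulting cyclic word and the order of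
choosing the two letters differ. -/
theorem glueTwo_symm {x y z : HComp V} (hx : ClosedComp x) (hy : ClosedComp y) (hz : ClosedComp z) :
    glueTwo u w x y z = glueTwo w u x z y := by
  conv_rhs => rw [glueTwo, rotSum_splitSum]
  rw [glueTwo]
  refine rotSum_congr hx fun p l hl => splitSum_congr fun l₁ r l₂ e => ?_
  rw [rotSum_comm (l := z.2)]
  refine rotSum_congr hy fun q m hm => rotSum_congr hz fun s n hn => ?_
  rw [mul_comm]
  by_cases hrs : (pairing r.1 s.1 : K) = 0
  · rw [letterForm, hrs]; simp
  by_cases hpq : (pairing p.1 q.1 : K) = 0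
  · rw [letterForm, letterForm, hpq]; simp
  congr 1
  obtain ⟨h1, h2⟩ := pairing_ends _ _ hrs
  obtain ⟨h3, h4⟩ := pairing_ends _ _ hpq
  rw [e, List.map_append, List.map_cons] at hl
  obtain ⟨t, hl1, hl2⟩ := isPath_append.1 hl
  obtain ⟨rfl, hl3⟩ := isPath_cons.1 hl2
  rw [h4] at hl3
  rw [← h3] at hm
  rw [← h1, ← h2] at hn
  have hlm : IsPath r.1.src ((l₂ ++ m).map Prod.fst) p.1.src := by
    rw [List.map_append]; exact hl3.append hm
  have hc : ClosedComp (r.1.src, (l₂ ++ m) ++ (l₁ ++ n)) := by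
    rw [ClosedComp, List.map_append (l₁ := l₂ ++ m), List.map_append (l₁ := l₁)]
    exact hlm.append (hl1.append hn)
  have := cycClass_append_comm (K := K) hc hlm
  simp only [List.append_assoc] at this ⊢
  exact this

/-- Once `x` and `y` have been glued, the letter at which `z` is attached comes from what is left of
`x` or from what is left of `y`. -/
theorem glueForm_glueComp (hw : ∀ i j, w i j = - w j i) {x y z : HComp V} (hx : ClosedComp x)
    (hy : ClosedComp y) (hz : ClosedComp z) :
    glueForm u (glueComp w x y) (Finsupp.single (HCyc.mk z hz) 1) =
      glueTwo u w x y z + glueTwo u w y x z := by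
  let φ : (HCyc V →₀ K) →ₗ[K] (HCyc V →₀ K) := (glueForm u).flip (Finsupp.single (HCyc.mk z hz) 1)
  change φ (glueComp w x y) = _
  have hφ : ∀ c (_ : ClosedComp c), φ (cycClass K c) = glueComp u c z := fun c hc => by
    rw [cycClass_of hc]; exact glueForm_mk u hc hz
  let A : DoubleArrow V × ℕ → List (DoubleArrow V × ℕ) → DoubleArrow V × ℕ →
    List (DoubleArrow V × ℕ) → (HCyc V →₀ K) := fun p l q m => splitSum (fun l₁ r l₂ =>
      rotSum (fun s n => (letterForm w p q * letterForm u r s) •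
        cycClass K (r.1.src, l₂ ++ (m ++ l₁) ++ n)) z.2) l
  have key : φ (glueComp w x y) = rotSum (fun p l => rotSum (fun q m => A p l q m + A q m p l) y.2) x.2 := by
    rw [glueComp, map_rotSum]
    refine rotSum_congr hx fun p l hl => ?_
    rw [map_rotSum]
    refine rotSum_congr hy fun q m hm => ?_
    rw [map_smul]
    -- If the pairing vanishes, the glued word need not be closed and `hφ` does not apply, but then
    -- both sides are zero.
    by_cases hpq : (pairing p.1 q.1 : K) = 0
    · have h1 : letterForm w p q = 0 := by rw [letterForm, hpq, mul_zero]
      have h2 : letterForm w q p = 0 := by rw [letterForm_symm hw, h1]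
      have h0 : A p l q m = 0 := by
        refine splitSum_eq_zero fun _ _ _ _ => rotSum_eq_zero fun _ _ _ => ?_
        rw [h1, zero_mul, zero_smul]
      have h0' : A q m p l = 0 := by
        refine splitSum_eq_zero fun _ _ _ _ => rotSum_eq_zero fun _ _ _ => ?_
        rw [h2, zero_mul, zero_smul]
      rw [h1, zero_smul, h0, h0', add_zero]
    · obtain ⟨h1, h2⟩ := pairing_ends _ _ hpq
      rw [h2] at hl
      rw [← h1] at hm
      rw [hφ _ (by rw [ClosedComp, List.map_append]; exact hl.append hm), glueComp, rotSum_append,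
        smul_add, smul_splitSum, smul_splitSum]
      simp only [smul_rotSum, smul_smul]
      rw [letterForm_symm hw p q]
      simp only [A, letterForm_symm hw p q]
  have hA : ∀ (x y : HComp V), glueTwo u w x y z = rotSum (fun p l => rotSum (A p l) y.2) x.2 := by
    intro x y
    simp only [glueTwo, A]
    congr 1
    funext p l
    rw [rotSum_splitSum_comm]
  rw [key, hA, hA]
  simp only [rotSum_add]
  congr 1
  exact rotSum_comm (fun p l q m => A q m p l) x.2 y.2

/-- Contractions with different weights commute. -/
theorem contract_glueForm_comm [CharZero K] (hu : ∀ i j, u i j = - u j i)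
    (hw : ∀ i j, w i j = - w j i) :
    Commute (contract (glueForm (V := V) u)) (contract (glueForm w)) := by
  refine contract_comm (glueForm_symm hu) (glueForm_symm hw) fun x y z => ?_
  induction x using HCyc.ind with
  | _ x hx =>
  induction y using HCyc.ind with
  | _ y hy =>
  induction z using HCyc.ind with
  | _ z hz =>
    -- Each side of the compatibility condition consists of six double gluings: every component
    -- serves as the middle one in two ways. The identity `glueTwo_symm` matches them, and `e`
    -- records the matching permutation.
    have e : ∀ a b c d e f a' b' c' d' e' f' : HCyc V →₀ K, a = a' → b = b' → c = c' → d = d' →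
        e = e' → f = f' → a + b + (c + d) + (e + f) = f' + c' + (b' + e') + (d' + a') := by
      rintro a b c d e f _ _ _ _ _ _ rfl rfl rfl rfl rfl rfl
      abel
    rw [glueForm_mk, glueForm_mk, glueForm_mk, glueForm_mk, glueForm_mk, glueForm_mk,
      glueForm_glueComp hw hx hy hz, glueForm_glueComp hw hy hz hx, glueForm_glueComp hw hz hx hy,
      glueForm_glueComp hu hx hy hz, glueForm_glueComp hu hy hz hx, glueForm_glueComp hu hz hx hy]
    exact e _ _ _ _ _ _ _ _ _ _ _ _ (glueTwo_symm hx hy hz) (glueTwo_symm hy hx hz)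
      (glueTwo_symm hy hz hx) (glueTwo_symm hz hy hx) (glueTwo_symm hz hx hy) (glueTwo_symm hx hz hy)

/-- Replace the heights of a component. -/
def mapComp (f : ℕ → ℕ) (c : HComp V) : HComp V := (c.1, c.2.map fun a => (a.1, f a.2))

theorem ClosedComp.map (f : ℕ → ℕ) {c : HComp V} (h : ClosedComp c) : ClosedComp (mapComp f c) := by
  simpa [ClosedComp, mapComp, Function.comp_def] using h

/-- Replace the heights of a cyclic word. -/
def HCyc.map (f : ℕ → ℕ) : HCyc V → HCyc V :=
  Quot.map (fun c => ⟨mapComp f c.1, c.2.map f⟩) (by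
    rintro c d ⟨v, a, l, h, h'⟩
    exact ⟨v, (a.1, f a.2), l.map fun a => (a.1, f a.2), by simp [mapComp, h], by simp [mapComp, h']⟩)

theorem HCyc.map_mk (f : ℕ → ℕ) (c : HComp V) (h : ClosedComp c) :
    HCyc.map f (HCyc.mk c h) = HCyc.mk (mapComp f c) (h.map f) := rfl

theorem cycClass_map (f : ℕ → ℕ) (c : HComp V) :
    cycClass K (mapComp f c) = Finsupp.mapDomain (HCyc.map f) (cycClass K c) := by
  by_cases h : ClosedComp c
  · rw [cycClass_of h, cycClass_of (h.map f), Finsupp.mapDomain_single]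
    rfl
  · have h' : ¬ ClosedComp (mapComp f c) := fun h' => h (by
      simpa [ClosedComp, mapComp, Function.comp_def] using h')
    rw [cycClass, cycClass, dif_neg h, dif_neg h', Finsupp.mapDomain_zero]

theorem glueForm_map (f : ℕ → ℕ) (x y : HCyc V) :
    glueForm u (Finsupp.single (HCyc.map f x) 1) (Finsupp.single (HCyc.map f y) 1) =
      Finsupp.mapDomain (HCyc.map f) (glueForm (fun i j => u (f i) (f j))
        (Finsupp.single x 1) (Finsupp.single y 1)) := by
  induction x using HCyc.ind with
  | _ x hx =>
  induction y using HCyc.ind with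
  | _ y hy =>
    have hm : ∀ (g : DoubleArrow V × ℕ → List (DoubleArrow V × ℕ) → (HCyc V →₀ K)) l,
        Finsupp.mapDomain (HCyc.map f) (rotSum g l) =
          rotSum (fun a m => Finsupp.mapDomain (HCyc.map f) (g a m)) l := fun g l =>
      map_rotSum (Finsupp.mapDomain.addMonoidHom (HCyc.map f)) g l
    rw [HCyc.map_mk, HCyc.map_mk, glueForm_mk, glueForm_mk, glueComp, glueComp]
    simp only [mapComp, rotSum_map, hm, Finsupp.mapDomain_smul, ← cycClass_map, List.map_append]
    rfl

theorem glueComp_eq_zero {x y : HComp V} (h : ∀ p ∈ x.2, ∀ q ∈ y.2, u p.2 q.2 = 0) :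
    glueComp u x y = 0 := by
  refine rotSum_eq_zero fun p hp l => rotSum_eq_zero fun q hq m => ?_
  rw [letterForm, h p hp q hq, zero_mul, zero_smul]

/-- Applied to a weight supported on one pair of heights, where only the two leading letters
contribute. -/
theorem glueComp_single {v v' : V} {p q : DoubleArrow V × ℕ} {l m : List (DoubleArrow V × ℕ)}
    (h1 : ∀ p' ∈ l, ∀ q' ∈ q :: m, u p'.2 q'.2 = 0) (h2 : ∀ q' ∈ m, u p.2 q'.2 = 0) :
    glueComp u (v, p :: l) (v', q :: m) = letterForm u p q • cycClass K (p.1.src, l ++ m) := by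
  rw [glueComp, rotSum, splitSum_cons, splitSum_eq_zero, add_zero, rotSum, splitSum_cons,
    splitSum_eq_zero, add_zero]
  · simp
  · intro m₁ q' m₂ e
    rw [letterForm, h2 q' (by simp [e]), zero_mul, zero_smul]
  · intro l₁ p' l₂ e
    refine rotSum_eq_zero fun q' hq m => ?_
    rw [letterForm, h1 p' (by simp [e]) q' hq, zero_mul, zero_smul]

end Gluing

end NecklaceQuantization

namespace NecklaceQuantization

open DoubleArrow PathAlgebra HMonomial

/-! ### The symbol of a monomial as an exponential of contractions. -/

section Symbol

set_option linter.unusedSectionVars false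

variable {V : Type*} [Quiver V] [Fintype V] {K : Type*} [Field K] [CharZero K]

variable (K) in
/-- The product of the components of a monomial, forgetting how the heights are interlaced. -/
noncomputable def monoPoly (X : HMonomial V) : MvPolynomial (HCyc V) K :=
  ((X.map (cycClass K)).map linPoly).prod

theorem monoPoly_mapHeights (f : ℕ → ℕ) (X : HMonomial V) :
    monoPoly K (X.mapHeights f) = MvPolynomial.rename (HCyc.map f) (monoPoly K X) := by
  rw [monoPoly, monoPoly, map_list_prod, mapHeights]
  simp only [List.map_map]
  congr 1
  refine List.map_congr_left fun c _ => ?_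
  simp only [Function.comp_apply]
  rw [← linPoly_mapDomain, ← cycClass_map]
  rfl

variable {R : Type*} [CommRing R] [Algebra K R] (φ : HCyc V → R)

/-- The sum over all partial matchings of the letters of a monomial, of the product of the weights of
the pairs times the monomial in which the matched letters are deleted and their components glued. -/
noncomputable def symbol (u : ℕ → ℕ → K) (X : HMonomial V) : R :=
  ∑ k ∈ Finset.range (X.length + 1),
    (k.factorial : K)⁻¹ • MvPolynomial.aeval φ ((contract (glueForm u) ^ k) (monoPoly K X))

theorem symbol_perm (u : ℕ → ℕ → K) {X Y : HMonomial V} (h : X.Perm Y) :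
    symbol φ u X = symbol φ u Y := by
  have : monoPoly K X = monoPoly K Y := ((h.map _).map _).prod_eq
  rw [symbol, symbol, this, h.length_eq]

theorem symbol_cons_congr (u : ℕ → ℕ → K) {c d : HComp V} (h : cycClass K c = cycClass K d)
    (Z : HMonomial V) : symbol φ u (c :: Z) = symbol φ u (d :: Z) := by
  rw [symbol, symbol, monoPoly, monoPoly, List.map_cons, List.map_cons, h]
  simp

variable {φ}

/-- As `φ` ignores heights, a change of heights can be traded for a change of weights, so that
different height assignments are compared on one fixed monomial. -/
theorem symbol_mapHeights (hφ : ∀ f x, φ (HCyc.map f x) = φ x) {u : ℕ → ℕ → K}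
    (hu : ∀ i j, u i j = - u j i) (f : ℕ → ℕ) (X : HMonomial V) :
    symbol φ u (X.mapHeights f) = symbol φ (fun i j => u (f i) (f j)) X := by
  have h : ∀ (k : ℕ) (p : MvPolynomial (HCyc V) K), (contract (glueForm u) ^ k)
      (MvPolynomial.rename (HCyc.map f) p) =
      MvPolynomial.rename (HCyc.map f) ((contract (glueForm fun i j => u (f i) (f j)) ^ k) p) := by
    intro k
    induction k with
    | zero => intro p; rfl
    | succ k ih =>
      intro p
      rw [pow_succ, Module.End.mul_apply,
        contract_rename (glueForm_symm fun i j => hu (f i) (f j)) _ (glueForm_symm hu)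
          (glueForm_map f), ih]
      rfl
  have hl : (X.mapHeights f).length = X.length := by simp [mapHeights]
  have hf : φ ∘ HCyc.map f = φ := funext (hφ f)
  rw [symbol, symbol, hl, monoPoly_mapHeights]
  refine Finset.sum_congr rfl fun k _ => ?_
  rw [h, MvPolynomial.aeval_rename, hf]

/-- Contraction refers to the weights of all heights, whereas only those that occur in `X` should
matter. Pulling the weights back along a retraction onto the occurring heights makes them equal
everywhere. -/
theorem symbol_congr (hφ : ∀ f x, φ (HCyc.map f x) = φ x) {u w : ℕ → ℕ → K}
    (hu : ∀ i j, u i j = - u j i) (hw : ∀ i j, w i j = - w j i) (X : HMonomial V)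
    (h : ∀ i ∈ X.heights, ∀ j ∈ X.heights, u i j = w i j) : symbol φ u X = symbol φ w X := by
  classical
  have h0 : ∀ u : ℕ → ℕ → K, (∀ i j, u i j = - u j i) → u 0 0 = 0 := fun u hu => by
    have := hu 0 0
    rwa [self_eq_neg] at this
  -- Heights that do not occur are sent to one that does. If there are none at all, the default `0`
  -- is the only value, and antisymmetry in characteristic zero makes both weights vanish there.
  let r : ℕ → ℕ := fun i => if i ∈ X.heights then i else X.heights.headD 0
  have hr : X.mapHeights r = X := mapHeights_id fun j hj => if_pos hj
  have hm : X.heights = [] ∨ ∀ i, r i ∈ X.heights := by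
    by_cases h : X.heights = []
    · exact Or.inl h
    · refine Or.inr fun i => ?_
      by_cases hi : i ∈ X.heights
      · simp [r, hi]
      · simp only [r, if_neg hi]
        cases h' : X.heights with
        | nil => exact absurd h' h
        | cons a l => simp
  rw [← hr, symbol_mapHeights hφ hu, symbol_mapHeights hφ hw]
  congr 1
  funext i j
  rcases hm with hm | hm
  · simp [r, hm, h0 u hu, h0 w hw]
  · exact h _ (hm i) _ (hm j)

/-- If contracting twice with `d` gives zero, the effect of adding `d` to the weights. -/
theorem symbol_add {u d : ℕ → ℕ → K} (hu : ∀ i j, u i j = - u j i) (hd : ∀ i j, d i j = - d j i)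
    {X Y : HMonomial V} {c : K} (hX : contract (glueForm d) (monoPoly K X) = c • monoPoly K Y)
    (hY : contract (glueForm d) (monoPoly K Y) = 0) (hl : X.length = Y.length + 1) :
    symbol φ (u + d) X = symbol φ u X + c • symbol φ u Y := by
  have hc : Commute (contract (glueForm (V := V) u)) (contract (glueForm d)) :=
    contract_glueForm_comm hu hd
  -- The binomial formula for commuting operators, cut off after the first order in `d` because the
  -- second contraction with `d` vanishes.
  have h : ∀ k : ℕ, (contract (glueForm (u + d)) ^ k) (monoPoly K X) =
      (contract (glueForm u) ^ k) (monoPoly K X) +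
        (k * c : K) • (contract (glueForm u) ^ (k - 1)) (monoPoly K Y) := by
    intro k
    induction k with
    | zero => simp
    | succ k ih =>
      have e : ∀ (j : ℕ) p, contract (glueForm (V := V) d) ((contract (glueForm u) ^ j) p) =
          (contract (glueForm u) ^ j) (contract (glueForm d) p) := fun j p =>
        (LinearMap.congr_fun (hc.pow_left j).eq p).symm
      rw [pow_succ', Module.End.mul_apply, ih, glueForm_add, contract_add, LinearMap.add_apply,
        map_add, map_add, map_smul, map_smul, e, e, hX, hY, map_zero, smul_zero, add_zero, map_smul,
        ← Module.End.mul_apply, ← Module.End.mul_apply, ← pow_succ', ← pow_succ', add_assoc]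
      congr 1
      cases k with
      | zero => simp
      | succ k =>
        simp only [Nat.add_sub_cancel]
        rw [← add_smul]
        congr 1
        push_cast
        ring
  have h' : ∀ k : ℕ, (k.factorial : K)⁻¹ • MvPolynomial.aeval φ
      ((contract (glueForm (u + d)) ^ k) (monoPoly K X)) =
      (k.factorial : K)⁻¹ • MvPolynomial.aeval φ ((contract (glueForm u) ^ k) (monoPoly K X)) +
      ((k.factorial : K)⁻¹ * (k * c)) •
        MvPolynomial.aeval φ ((contract (glueForm u) ^ (k - 1)) (monoPoly K Y)) := fun k => by
    rw [h, map_add, map_smul, smul_add, smul_smul]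
  simp only [symbol, h', Finset.sum_add_distrib]
  congr 1
  -- The summand `k + 1` for `X` meets the summand `k` for `Y`, since `(k + 1) / (k + 1)! = 1 / k!`;
  -- the ranges agree because `X` has one component more.
  rw [hl, Finset.sum_range_succ', Finset.smul_sum]
  simp only [Nat.cast_zero, zero_mul, mul_zero, zero_smul, add_zero]
  refine Finset.sum_congr rfl fun k _ => ?_
  rw [smul_smul, Nat.add_sub_cancel, Nat.factorial_succ]
  congr 1
  have h1 : (k + 1 : K) ≠ 0 := by exact_mod_cast Nat.succ_ne_zero k
  have h2 : (k.factorial : K) ≠ 0 := by exact_mod_cast Nat.factorial_ne_zero k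
  push_cast
  field_simp

theorem symbol_add_of_contract_eq_zero {u d : ℕ → ℕ → K} (hu : ∀ i j, u i j = - u j i)
    (hd : ∀ i j, d i j = - d j i) {X : HMonomial V}
    (hX : contract (glueForm d) (monoPoly K X) = 0) :
    symbol φ (u + d) X = symbol φ u X := by
  have hc : Commute (contract (glueForm (V := V) u)) (contract (glueForm d)) :=
    contract_glueForm_comm hu hd
  have h : ∀ k : ℕ, (contract (glueForm (u + d)) ^ k) (monoPoly K X) =
      (contract (glueForm u) ^ k) (monoPoly K X) := by
    intro k
    induction k with
    | zero => simp
    | succ k ih =>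
      have e : ∀ (j : ℕ) p, contract (glueForm (V := V) d) ((contract (glueForm u) ^ j) p) =
          (contract (glueForm u) ^ j) (contract (glueForm d) p) := fun j p =>
        (LinearMap.congr_fun (hc.pow_left j).eq p).symm
      rw [pow_succ', Module.End.mul_apply, ih, glueForm_add, contract_add, LinearMap.add_apply,
        e, hX, map_zero, add_zero, pow_succ', Module.End.mul_apply]
  simp only [symbol, h]

theorem glueForm_cycClass_eq_zero {u : ℕ → ℕ → K} {c d : HComp V}
    (h : ∀ p ∈ c.2, ∀ q ∈ d.2, u p.2 q.2 = 0) :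
    glueForm u (cycClass K c) (cycClass K d) = 0 := by
  by_cases hc : ClosedComp c
  · by_cases hd : ClosedComp d
    · rw [cycClass_of hc, cycClass_of hd, glueForm_mk, glueComp_eq_zero h]
    · rw [cycClass, cycClass, dif_neg hd, map_zero]
  · rw [cycClass, dif_neg hc, map_zero, LinearMap.zero_apply]

theorem contract_monoPoly_eq_zero {u : ℕ → ℕ → K} (hu : ∀ i j, u i j = - u j i) {X : HMonomial V}
    (h : X.Pairwise fun c d => ∀ p ∈ c.2, ∀ q ∈ d.2, u p.2 q.2 = 0) :
    contract (glueForm u) (monoPoly K X) = 0 := by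
  refine contract_prod_eq_zero (glueForm_symm hu) _ ?_
  rw [List.pairwise_map]
  exact h.imp fun h => glueForm_cycClass_eq_zero h

/-- When only the first two components interact, contraction replaces their product by their gluing
and leaves the rest alone. -/
theorem contract_monoPoly_cons_cons {u : ℕ → ℕ → K} (hu : ∀ i j, u i j = - u j i) {c d : HComp V}
    {Z : HMonomial V} (hc : ∀ e ∈ Z, ∀ p ∈ c.2, ∀ q ∈ e.2, u p.2 q.2 = 0)
    (hd : ∀ e ∈ Z, ∀ p ∈ d.2, ∀ q ∈ e.2, u p.2 q.2 = 0)
    (h : Z.Pairwise fun c d => ∀ p ∈ c.2, ∀ q ∈ d.2, u p.2 q.2 = 0) :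
    contract (glueForm u) (monoPoly K (c :: d :: Z)) =
      linPoly (glueForm u (cycClass K c) (cycClass K d)) * monoPoly K Z := by
  have h1 : ∀ c : HComp V, (∀ e ∈ Z, ∀ p ∈ c.2, ∀ q ∈ e.2, u p.2 q.2 = 0) →
      bilinDer (glueForm u) (cycClass K c) (monoPoly K Z) = 0 := by
    intro c hc
    refine bilinDer_prod_eq_zero _ _ fun y hy => ?_
    obtain ⟨e, he, rfl⟩ := List.mem_map.1 hy
    exact glueForm_cycClass_eq_zero (hc e he)
  have e : monoPoly K (c :: d :: Z) = linPoly (cycClass K c) * (linPoly (cycClass K d) * monoPoly K Z) := by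
    simp [monoPoly]
  rw [e, contract_linPoly_mul (glueForm_symm hu), contract_linPoly_mul (glueForm_symm hu),
    contract_monoPoly_eq_zero hu h, h1 d hd, Derivation.leibniz, h1 c hc, bilinDer_linPoly]
  simp [mul_comm]

variable (K) in
/-- The weight of a pair of letters: one half of the sign of the difference of their heights. -/
noncomputable def heightWeight (i j : ℕ) : K := if i < j then 2⁻¹ else if j < i then - 2⁻¹ else 0

theorem heightWeight_antisymm (i j : ℕ) : heightWeight K i j = - heightWeight K j i := by
  rcases lt_trichotomy i j with h | h | h
  · simp [heightWeight, h, h.not_gt]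
  · simp [heightWeight, h]
  · simp [heightWeight, h, h.not_gt]

variable (K) in
/-- The antisymmetric weight supported on the pair of heights `h`, `k`. -/
noncomputable def pairWeight (h k i j : ℕ) : K :=
  (if i = h ∧ j = k then 1 else 0) - (if i = k ∧ j = h then 1 else 0)

theorem pairWeight_antisymm (h k i j : ℕ) : pairWeight K h k i j = - pairWeight K h k j i := by
  rw [pairWeight, pairWeight, neg_sub]
  simp only [and_comm]

theorem pairWeight_eq_zero {h k i j : ℕ} (h1 : ¬ (i = h ∧ j = k)) (h2 : ¬ (i = k ∧ j = h)) :
    pairWeight K h k i j = 0 := by simp [pairWeight, h1, h2]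

/-- Exchanging two adjacent heights. -/
theorem heightWeight_swap {h k i j : ℕ} (hk : h < k) (hi : ¬ (h < i ∧ i < k))
    (hj : ¬ (h < j ∧ j < k)) :
    heightWeight K i j = heightWeight K (Equiv.swap h k i) (Equiv.swap h k j) + pairWeight K h k i j := by
  have h2 : (2⁻¹ : K) + 2⁻¹ = 1 := by norm_num
  -- With this substitution each case is either contradictory or an identity in which the jump from
  -- `-½` to `½` is the value `1` of `pairWeight`.
  have h3 : (-2⁻¹ : K) = 2⁻¹ - 1 := by rw [← h2]; ring
  have hsi : Equiv.swap h k i = if i = h then k else if i = k then h else i := Equiv.swap_apply_def _ _ _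
  have hsj : Equiv.swap h k j = if j = h then k else if j = k then h else j := Equiv.swap_apply_def _ _ _
  rw [hsi, hsj]
  by_cases e1 : i = h <;> by_cases e2 : i = k <;> by_cases e3 : j = h <;> by_cases e4 : j = k
  all_goals simp only [heightWeight, pairWeight, e1, e2, e3, e4, if_true, if_false, and_true, and_false,
    true_and, false_and, h3]
  all_goals split_ifs
  all_goals first
    | (exfalso; omega)
    | ring

end Symbol

end NecklaceQuantization

namespace NecklaceQuantization

open DoubleArrow PathAlgebra HMonomial

/-! ### The symbol respects the skein relations at `ħ = 0`. -/

section SymbolQN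

set_option linter.unusedSectionVars false

open Polynomial

variable {V : Type*} [Quiver V]

theorem HMonomial.Admissible.closedComp {X : HMonomial V} (h : X.Admissible) {c : HComp V} (hc : c ∈ X) :
    ClosedComp c := h.1 c hc

theorem mem_heights {X : HMonomial V} {j : ℕ} : j ∈ X.heights ↔ ∃ c ∈ X, ∃ p ∈ c.2, p.2 = j := by
  simp [heights, List.mem_flatMap]

theorem height_mem {X : HMonomial V} {c : HComp V} (hc : c ∈ X) {p : DoubleArrow V × ℕ}
    (hp : p ∈ c.2) : p.2 ∈ X.heights := mem_heights.2 ⟨c, hc, p, hp, rfl⟩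

/-- Gluing at a pair of arrows with nonzero pairing gives an admissible monomial. -/
theorem admissible_glue [Fintype V] {K : Type*} [Field K] {v w : V} {a b : DoubleArrow V} {h k : ℕ}
    {l m : List (DoubleArrow V × ℕ)} {Z : HMonomial V} (hab : (pairing a b : K) ≠ 0)
    (hX : Admissible ((v, (a, h) :: l) :: (w, (b, k) :: m) :: Z)) :
    Admissible ((a.src, l ++ m) :: Z) := by
  obtain ⟨h1, h2⟩ := pairing_ends _ _ hab
  refine ⟨?_, ?_⟩
  · intro c hc
    rcases List.mem_cons.1 hc with rfl | hc
    · have hl : ClosedComp (v, (a, h) :: l) := hX.1 _ (by simp)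
      have hm : ClosedComp (w, (b, k) :: m) := hX.1 _ (by simp)
      rw [ClosedComp, List.map_cons] at hl hm
      have hl := IsPath.rotate (l := []) hl
      have hm := IsPath.rotate (l := []) hm
      rw [List.append_nil] at hl hm
      rw [h2] at hl
      rw [← h1] at hm
      have := hl.append hm
      rw [← List.map_append] at this
      exact this
    · exact hX.1 _ (by simp [hc])
  · refine List.Nodup.sublist ?_ hX.2
    simp only [heights_cons, List.map_append, List.map_cons, List.append_assoc]
    refine List.Sublist.cons _ (List.Sublist.append_left ?_ _)
    exact List.sublist_cons_self _ _

theorem mapLetters_id {f : ℕ → ℕ} {l : List (DoubleArrow V × ℕ)} (h : ∀ p ∈ l, f p.2 = p.2) :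
    l.map (fun p => (p.1, f p.2)) = l := by
  conv_rhs => rw [← List.map_id l]
  refine List.map_congr_left fun p hp => ?_
  rw [h p hp]; rfl

/-- Writes the exchanged monomial of the skein relation as the image of a transposition of heights,
so that `symbol_mapHeights` applies to it. -/
theorem mapHeights_swap_skein {v w : V} {a b : DoubleArrow V} {h k : ℕ}
    {l m : List (DoubleArrow V × ℕ)} {Z : HMonomial V}
    (hX : Admissible ((v, (a, h) :: l) :: (w, (b, k) :: m) :: Z)) :
    mapHeights (Equiv.swap h k) ((v, (a, h) :: l) :: (w, (b, k) :: m) :: Z) =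
      (v, (a, k) :: l) :: (w, (b, h) :: m) :: Z := by
  have hn := hX.2
  simp only [heights_cons, List.map_cons, List.cons_append, List.nodup_cons, List.nodup_append',
    List.mem_append, List.mem_cons, List.mem_map, not_or, not_exists, not_and, Prod.forall] at hn
  have hl : ∀ p ∈ l, Equiv.swap h k p.2 = p.2 := fun p hp =>
    Equiv.swap_apply_of_ne_of_ne (fun e => hn.1.1 _ _ hp e) fun e => by
      have := hn.2.2.2
      rw [List.disjoint_left] at this
      exact this (List.mem_map.2 ⟨p, hp, e⟩) (by simp)
  have hm : ∀ p ∈ m, Equiv.swap h k p.2 = p.2 := fun p hp =>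
    Equiv.swap_apply_of_ne_of_ne (fun e => hn.1.2.2.1 _ _ hp e) fun e => hn.2.2.1.1.1 _ _ hp e
  have hZ : Z.mapHeights (Equiv.swap h k) = Z := mapHeights_id fun j hj =>
    Equiv.swap_apply_of_ne_of_ne (fun e => hn.1.2.2.2 (e ▸ hj)) fun e => hn.2.2.1.1.2 (e ▸ hj)
  rw [mapHeights_cons, mapHeights_cons, hZ, List.map_cons, List.map_cons, mapLetters_id hl,
    mapLetters_id hm]
  simp

theorem mapHeights_swap_skeinSelf {v : V} {a b : DoubleArrow V} {h k : ℕ}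
    {l m : List (DoubleArrow V × ℕ)} {Z : HMonomial V}
    (hX : Admissible ((v, (a, h) :: l ++ (b, k) :: m) :: Z)) :
    mapHeights (Equiv.swap h k) ((v, (a, h) :: l ++ (b, k) :: m) :: Z) =
      (v, (a, k) :: l ++ (b, h) :: m) :: Z := by
  have hn := hX.2
  simp only [heights_cons, List.map_cons, List.map_append, List.cons_append, List.append_assoc,
    List.nodup_cons, List.nodup_append',
    List.mem_append, List.mem_cons, List.mem_map, not_or, not_exists, not_and, Prod.forall] at hn
  have hl : ∀ p ∈ l, Equiv.swap h k p.2 = p.2 := fun p hp =>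
    Equiv.swap_apply_of_ne_of_ne (fun e => hn.1.1 _ _ hp e) fun e => by
      have := hn.2.2.2
      rw [List.disjoint_left] at this
      exact this (List.mem_map.2 ⟨p, hp, e⟩) (by simp)
  have hm : ∀ p ∈ m, Equiv.swap h k p.2 = p.2 := fun p hp =>
    Equiv.swap_apply_of_ne_of_ne (fun e => hn.1.2.2.1 _ _ hp e) fun e => hn.2.2.1.1.1 _ _ hp e
  have hZ : Z.mapHeights (Equiv.swap h k) = Z := mapHeights_id fun j hj =>
    Equiv.swap_apply_of_ne_of_ne (fun e => hn.1.2.2.2 (e ▸ hj)) fun e => hn.2.2.1.1.2 (e ▸ hj)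
  rw [mapHeights_cons, hZ, List.cons_append, List.map_cons, List.map_append, List.map_cons,
    mapLetters_id hl, mapLetters_id hm]
  simp

variable [Fintype V] {K : Type*} [Field K] [CharZero K]
variable {R : Type*} [CommRing R] [Algebra K R] {φ : HCyc V → R}

/-- No occurring height lies strictly between `h` and `k`, so on the occurring heights the two
weights coincide by `heightWeight_swap`. -/
theorem symbol_swap_eq (hφ : ∀ f x, φ (HCyc.map f x) = φ x) {X : HMonomial V} {h k : ℕ} (hk : h < k)
    (hadj : ∀ j ∈ X.heights, ¬(h < j ∧ j < k)) :
    symbol φ (heightWeight K) X = symbol φ ((fun i j =>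
      heightWeight K (Equiv.swap h k i) (Equiv.swap h k j)) + pairWeight K h k) X := by
  refine symbol_congr hφ heightWeight_antisymm ?_ X ?_
  · intro i j
    rw [Pi.add_apply, Pi.add_apply, Pi.add_apply, Pi.add_apply, heightWeight_antisymm,
      pairWeight_antisymm]
    ring
  · intro i hi j hj
    exact heightWeight_swap hk (hadj i hi) (hadj j hj)

theorem pairwise_pairWeight {Z : HMonomial V} {h k : ℕ} (hh : h ∉ Z.heights) :
    Z.Pairwise fun c d => ∀ p ∈ c.2, ∀ q ∈ d.2, pairWeight K h k p.2 q.2 = 0 := by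
  refine List.Pairwise.imp_of_mem (R := fun _ _ => True) ?_ (List.pairwise_of_forall fun _ _ => trivial)
  intro c d hc hd _ p hp q hq
  refine pairWeight_eq_zero ?_ ?_
  · rintro ⟨e, -⟩; exact hh (e ▸ height_mem hc hp)
  · rintro ⟨-, e⟩; exact hh (e ▸ height_mem hd hq)

/-- Contracting with `pairWeight` glues exactly the two chosen letters. The heights `h` and `k` are
absent from the glued monomial, so a second such contraction is zero, and the exchange of `h` and
`k` does not affect its symbol. Hence `symbol_add` applies. -/
theorem symbol_skein (hφ : ∀ f x, φ (HCyc.map f x) = φ x) {v w : V} {a b : DoubleArrow V} {h k : ℕ}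
    {l m : List (DoubleArrow V × ℕ)} {Z : HMonomial V}
    (hX : Admissible ((v, (a, h) :: l) :: (w, (b, k) :: m) :: Z)) (hk : h < k)
    (hadj : ∀ j ∈ heights ((v, (a, h) :: l) :: (w, (b, k) :: m) :: Z), ¬(h < j ∧ j < k)) :
    symbol φ (heightWeight K) ((v, (a, h) :: l) :: (w, (b, k) :: m) :: Z) =
      symbol φ (heightWeight K) ((v, (a, k) :: l) :: (w, (b, h) :: m) :: Z) +
        (pairing a b : K) • symbol φ (heightWeight K) ((a.src, l ++ m) :: Z) := by
  have hs : ∀ i j : ℕ, (fun i j => heightWeight K (Equiv.swap h k i) (Equiv.swap h k j)) i j =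
      - (fun i j => heightWeight K (Equiv.swap h k i) (Equiv.swap h k j)) j i :=
    fun i j => heightWeight_antisymm _ _
  have hn := hX.2
  simp only [heights_cons, List.map_cons, List.cons_append, List.nodup_cons, List.nodup_append',
    List.mem_append, List.mem_cons, List.mem_map, not_or, not_exists, not_and, Prod.forall] at hn
  have hlh : ∀ p ∈ l, p.2 ≠ h := fun p hp e => hn.1.1 _ _ hp e
  have hlk : ∀ p ∈ l, p.2 ≠ k := fun p hp e => by
    have := hn.2.2.2
    rw [List.disjoint_left] at this
    exact this (List.mem_map.2 ⟨p, hp, e⟩) (by simp)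
  have hmh : ∀ p ∈ m, p.2 ≠ h := fun p hp e => hn.1.2.2.1 _ _ hp e
  have hmk : ∀ p ∈ m, p.2 ≠ k := fun p hp e => hn.2.2.1.1.1 _ _ hp e
  have hZh : h ∉ Z.heights := hn.1.2.2.2
  have hZk : k ∉ Z.heights := hn.2.2.1.1.2
  have hYh : h ∉ heights ((a.src, l ++ m) :: Z) := by
    rw [heights_cons, List.mem_append, List.mem_map]
    rintro (⟨p, hp, e⟩ | e)
    · rcases List.mem_append.1 hp with hp | hp
      · exact hlh p hp e
      · exact hmh p hp e
    · exact hZh e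
  have hYk : k ∉ heights ((a.src, l ++ m) :: Z) := by
    rw [heights_cons, List.mem_append, List.mem_map]
    rintro (⟨p, hp, e⟩ | e)
    · rcases List.mem_append.1 hp with hp | hp
      · exact hlk p hp e
      · exact hmk p hp e
    · exact hZk e
  have hz : ∀ c : HComp V, ∀ e ∈ Z, ∀ p ∈ c.2, ∀ q ∈ e.2, pairWeight K h k p.2 q.2 = 0 := by
    intro c e he p _ q hq
    refine pairWeight_eq_zero ?_ ?_
    · rintro ⟨-, e'⟩; exact hZk (e' ▸ height_mem he hq)
    · rintro ⟨-, e'⟩; exact hZh (e' ▸ height_mem he hq)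
  have hc : contract (glueForm (pairWeight K h k))
      (monoPoly K ((v, (a, h) :: l) :: (w, (b, k) :: m) :: Z)) =
      (pairing a b : K) • monoPoly K ((a.src, l ++ m) :: Z) := by
    rw [contract_monoPoly_cons_cons (pairWeight_antisymm h k) (hz _) (hz _) (pairwise_pairWeight hZh),
      cycClass_of (hX.closedComp (by simp)), cycClass_of (hX.closedComp (by simp)), glueForm_mk,
      glueComp_single]
    · have : letterForm (pairWeight K h k) (a, h) (b, k) = pairing a b := by
        simp [letterForm, pairWeight, hk.ne]
      rw [this, map_smul, smul_mul_assoc]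
      simp [monoPoly]
    · intro p hp q hq
      refine pairWeight_eq_zero ?_ ?_
      · rintro ⟨e, -⟩; exact hlh p hp e
      · rintro ⟨e, -⟩; exact hlk p hp e
    · intro q hq
      refine pairWeight_eq_zero ?_ ?_
      · rintro ⟨-, e⟩; exact hmk q hq e
      · rintro ⟨-, e⟩; exact hmh q hq e
  rw [symbol_swap_eq hφ hk hadj, symbol_add hs (pairWeight_antisymm h k) hc
    (contract_monoPoly_eq_zero (pairWeight_antisymm h k) (pairwise_pairWeight hYh)) (by simp),
    ← symbol_mapHeights hφ heightWeight_antisymm (Equiv.swap h k), ← symbol_mapHeights hφ heightWeight_antisymm (Equiv.swap h k),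
    mapHeights_swap_skein hX, mapHeights_id (X := (a.src, l ++ m) :: Z)]
  intro j hj
  exact Equiv.swap_apply_of_ne_of_ne (fun e => hYh (e ▸ hj)) fun e => hYk (e ▸ hj)

/-- Contraction pairs letters of different components only. With `h` and `k` in one component, the
change of weight is invisible, just as the correction with factor `ħ` is. -/
theorem symbol_skeinSelf (hφ : ∀ f x, φ (HCyc.map f x) = φ x) {v : V} {a b : DoubleArrow V} {h k : ℕ}
    {l m : List (DoubleArrow V × ℕ)} {Z : HMonomial V}
    (hX : Admissible ((v, (a, h) :: l ++ (b, k) :: m) :: Z)) (hk : h < k)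
    (hadj : ∀ j ∈ heights ((v, (a, h) :: l ++ (b, k) :: m) :: Z), ¬(h < j ∧ j < k)) :
    symbol φ (heightWeight K) ((v, (a, h) :: l ++ (b, k) :: m) :: Z) =
      symbol φ (heightWeight K) ((v, (a, k) :: l ++ (b, h) :: m) :: Z) := by
  have hs : ∀ i j : ℕ, (fun i j => heightWeight K (Equiv.swap h k i) (Equiv.swap h k j)) i j =
      - (fun i j => heightWeight K (Equiv.swap h k i) (Equiv.swap h k j)) j i :=
    fun i j => heightWeight_antisymm _ _
  have hn := hX.2
  rw [heights_cons, List.nodup_append', List.disjoint_left] at hn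
  have hZh : h ∉ Z.heights := hn.2.2 (by simp)
  have hZk : k ∉ Z.heights := hn.2.2 (by simp)
  rw [symbol_swap_eq hφ hk hadj, symbol_add_of_contract_eq_zero hs (pairWeight_antisymm h k),
    ← symbol_mapHeights hφ heightWeight_antisymm (Equiv.swap h k), mapHeights_swap_skeinSelf hX]
  refine contract_monoPoly_eq_zero (pairWeight_antisymm h k)
    (List.pairwise_cons.2 ⟨fun e he p _ q hq => ?_, pairwise_pairWeight hZh⟩)
  refine pairWeight_eq_zero ?_ ?_
  · rintro ⟨-, e'⟩; exact hZk (e' ▸ height_mem he hq)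
  · rintro ⟨-, e'⟩; exact hZh (e' ▸ height_mem he hq)

variable (K R) in
/-- The `K[ħ]`-module structure on a `K`-module on which `ħ` acts by zero. -/
noncomputable abbrev zeroModule : Module K[X] R := Module.compHom R (Polynomial.constantCoeff (R := K))

/-- The symbol of an element of the quantized necklace algebra at `ħ = 0`. -/
theorem exists_symbolQN (hφ : ∀ f x, φ (HCyc.map f x) = φ x) :
    ∃ Φ : QN K V →+ R, (∀ (c : K[X]) z, Φ (c • z) = c.coeff 0 • Φ z) ∧
      ∀ X : HMonomial V, X.Admissible → Φ (QN.mono X) = symbol φ (heightWeight K) X := by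
  classical
  let _ : Module K[X] R := zeroModule K R
  have hsm : ∀ (c : K[X]) (r : R), c • r = c.coeff 0 • r := fun c r => rfl
  let Ψ : Free K V →ₗ[K[X]] R := Free.lift fun X => symbol φ (heightWeight K) X.1
  have hΨ : ∀ {X : HMonomial V}, X.Admissible → Ψ (Free.mono X) = symbol φ (heightWeight K) X := by
    intro X hX
    rw [Free.mono_of hX]
    exact Free.lift_ofMonomial _ _
  have hle : relSubmodule K V ≤ LinearMap.ker Ψ := by
    rw [relSubmodule, Submodule.span_le]
    intro z hz
    rw [SetLike.mem_coe, LinearMap.mem_ker]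
    cases hz with
    | perm X Y hX h =>
      rw [map_sub, hΨ hX, hΨ ((admissible_perm h).1 hX), symbol_perm φ _ h, sub_self]
    | rotate v a l Z hX =>
      have hc : ClosedComp (v, a :: l) := hX.closedComp (by simp)
      have hp : IsPath v ([a].map Prod.fst) a.1.src := by
        rw [ClosedComp, List.map_cons, isPath_cons] at hc
        exact isPath_cons.2 ⟨hc.1, isPath_nil.2 rfl⟩
      have hc' : ClosedComp (a.1.src, l ++ [a]) := ClosedComp.rotate (l := [a]) hc hp
      have hX' : Admissible ((a.1.src, l ++ [a]) :: Z) := by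
        refine ⟨fun c hc => ?_, ?_⟩
        · rcases List.mem_cons.1 hc with rfl | hc
          · exact hc'
          · exact hX.1 _ (by simp [hc])
        · refine (List.Perm.nodup_iff ?_).1 hX.2
          rw [heights_cons, heights_cons]
          refine List.Perm.append_right _ (List.Perm.map _ ?_)
          exact (List.perm_append_comm (l₁ := [a]) (l₂ := l))
      rw [map_sub, hΨ hX, hΨ hX', sub_eq_zero]
      exact symbol_cons_congr φ _ (cycClass_append_comm (l := [a]) hc hp) Z
    | reheight X f hX hf =>
      rw [map_sub, hΨ hX, hΨ ((admissible_map hf.injOn).2 hX), symbol_mapHeights hφ heightWeight_antisymm,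
        sub_eq_zero]
      refine symbol_congr hφ heightWeight_antisymm (fun i j => heightWeight_antisymm _ _) X ?_
      intro i hi j hj
      simp only [heightWeight, hf.lt_iff_lt hi hj, hf.lt_iff_lt hj hi]
    | skein v w a b h k l m Z hX hk hadj =>
      have hX' := (admissible_map (f := Equiv.swap h k) (Equiv.swap h k).injective.injOn).2 hX
      rw [mapHeights_swap_skein hX] at hX'
      rw [map_sub, map_sub, map_smul, hΨ hX, hΨ hX', hsm, Polynomial.coeff_C_zero,
        symbol_skein hφ hX hk hadj, add_sub_cancel_left, sub_eq_zero]
      -- The formula for `Ψ` needs an admissible glued monomial; a nonzero pairing provides it, and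
      -- otherwise the coefficient kills both terms.
      by_cases hab : (pairing a b : K) = 0
      · rw [hab, zero_smul, zero_smul]
      · rw [hΨ (admissible_glue hab hX)]
    | skeinSelf v a b h k l m Z hX hk hadj =>
      have hX' := (admissible_map (f := Equiv.swap h k) (Equiv.swap h k).injective.injOn).2 hX
      rw [mapHeights_swap_skeinSelf hX] at hX'
      rw [map_sub, map_sub, map_smul, hΨ hX, hΨ hX', hsm, Polynomial.mul_coeff_zero,
        Polynomial.coeff_X_zero, mul_zero, zero_smul, sub_zero, symbol_skeinSelf hφ hX hk hadj, sub_self]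
  let Φ : QN K V →ₗ[K[X]] R := (relSubmodule K V).liftQ Ψ hle
  refine ⟨Φ.toAddMonoidHom, fun c z => ?_, fun X hX => ?_⟩
  · exact (map_smul Φ c z).trans (hsm _ _)
  · exact hΨ hX

end SymbolQN

end NecklaceQuantization

namespace NecklaceQuantization

open DoubleArrow PathAlgebra HMonomial

/-! ### Reaching every order of the heights by adjacent exchanges. -/

section Sorting

/-- A function of injective height assignments on a finite set which depends only on the order of the
heights, and which is invariant under exchanging adjacent heights, is constant. -/
theorem eq_of_adjacent_swap {M : Type*} (T : Finset ℕ) (G : (ℕ → ℕ) → M)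
    (h1 : ∀ η, StrictMonoOn η T → G η = G id)
    (h2 : ∀ η, Set.InjOn η T → ∀ i ∈ T, ∀ j ∈ T, η i < η j →
      (∀ t ∈ T, ¬ (η i < η t ∧ η t < η j)) → G (Equiv.swap (η i) (η j) ∘ η) = G η) :
    ∀ η, Set.InjOn η T → G η = G id := by
  -- Induction on the number of inversions of the height assignment.
  suffices H : ∀ (n : ℕ) (η : ℕ → ℕ), Set.InjOn η T →
      ((T ×ˢ T).filter fun p => p.1 < p.2 ∧ η p.2 < η p.1).card = n → G η = G id from
    fun η hη => H _ η hη rfl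
  intro n
  induction n using Nat.strong_induction_on with
  | _ n ih =>
  intro η hη hn
  by_cases he : ((T ×ˢ T).filter fun p => p.1 < p.2 ∧ η p.2 < η p.1) = ∅
  · refine h1 η fun i hi j hj hij => ?_
    have h := Finset.eq_empty_iff_forall_notMem.1 he (i, j)
    simp only [Finset.mem_filter, Finset.mem_product, not_and] at h
    have h3 : η i ≠ η j := fun e => hij.ne (hη hi hj e)
    have h4 := h ⟨hi, hj⟩ hij
    omega
  · obtain ⟨⟨i, j⟩, hij, hmin⟩ := Finset.exists_min_image _ (fun p : ℕ × ℕ => η p.1 - η p.2)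
      (Finset.nonempty_iff_ne_empty.2 he)
    simp only [Finset.mem_filter, Finset.mem_product] at hij hmin
    obtain ⟨⟨hi, hj⟩, hlt, hηij⟩ := hij
    have hadj : ∀ t ∈ T, ¬ (η j < η t ∧ η t < η i) := by
      rintro t ht ⟨ht1, ht2⟩
      rcases lt_trichotomy t i with h | h | h
      · have := hmin (t, j) ⟨⟨ht, hj⟩, by simp only; omega, ht1⟩
        simp only at this
        omega
      · subst h; omega
      · have := hmin (i, t) ⟨⟨hi, ht⟩, h, ht2⟩
        simp only at this
        omega
    have hη' : Set.InjOn (Equiv.swap (η j) (η i) ∘ η) T :=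
      (Equiv.swap (η j) (η i)).injective.comp_injOn hη
    have hs : ∀ x, Equiv.swap (η j) (η i) x = if x = η j then η i else if x = η i then η j else x :=
      fun x => Equiv.swap_apply_def _ _ _
    rw [← h2 η hη j hj i hi hηij hadj]
    refine ih _ ?_ _ hη' rfl
    rw [← hn]
    -- Exchanging two adjacent heights creates no inversion and removes `(i, j)`.
    refine Finset.card_lt_card (Finset.ssubset_iff_subset_ne.2 ⟨?_, ?_⟩)
    · rintro ⟨p, q⟩ hpq
      simp only [Finset.mem_filter, Finset.mem_product, Function.comp_apply, hs] at hpq ⊢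
      obtain ⟨⟨hp, hq⟩, h3, h4⟩ := hpq
      refine ⟨⟨hp, hq⟩, h3, ?_⟩
      have e1 := hadj p hp
      have e2 := hadj q hq
      have e3 : η p ≠ η q := fun e => h3.ne (hη hp hq e)
      have e4 : η p = η j → p = j := fun e => hη hp hj e
      have e5 : η q = η i → q = i := fun e => hη hq hi e
      split_ifs at h4 <;> omega
    · intro h
      have h3 : (i, j) ∈ ((T ×ˢ T).filter fun p => p.1 < p.2 ∧ η p.2 < η p.1) := by
        simp [hi, hj, hlt, hηij]
      rw [← h] at h3
      simp only [Finset.mem_filter, Finset.mem_product, Function.comp_apply, hs] at h3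
      have h4 := h3.2.2
      split_ifs at h4 <;> omega

end Sorting

/-! ### Skein relations for letters in arbitrary positions. -/

section Skein

set_option linter.unusedSectionVars false

open Polynomial

variable {V : Type*} [Quiver V] {K : Type*} [Field K]

/-- Rotation of the first component preserves admissibility. -/
theorem admissible_rotate {v u : V} {l m : List (DoubleArrow V × ℕ)} {Z : HMonomial V}
    (hX : Admissible ((v, l ++ m) :: Z)) (hl : IsPath v (l.map Prod.fst) u) :
    Admissible ((u, m ++ l) :: Z) := by
  refine ⟨fun c hc => ?_, ?_⟩
  · rcases List.mem_cons.1 hc with rfl | hc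
    · exact ClosedComp.rotate (hX.closedComp (by simp)) hl
    · exact hX.1 _ (by simp [hc])
  · refine (List.Perm.nodup_iff ?_).1 hX.2
    rw [heights_cons, heights_cons]
    exact List.Perm.append_right _ (List.Perm.map _ List.perm_append_comm)

theorem QN.mono_rotate {v u : V} {l m : List (DoubleArrow V × ℕ)} {Z : HMonomial V}
    (hX : Admissible ((v, l ++ m) :: Z)) (hl : IsPath v (l.map Prod.fst) u) :
    (QN.mono ((v, l ++ m) :: Z) : QN K V) = QN.mono ((u, m ++ l) :: Z) := by
  induction l generalizing v m with
  | nil =>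
    obtain rfl := isPath_nil.1 hl
    simp
  | cons a l ih =>
    have h1 := QN.proj_eq_zero (K := K) (.rotate v a (l ++ m) Z hX)
    rw [map_sub, sub_eq_zero] at h1
    have hl' := isPath_cons.1 hl
    have hX' : Admissible ((a.1.src, (l ++ m) ++ [a]) :: Z) :=
      admissible_rotate (l := [a]) hX (isPath_cons.2 ⟨hl'.1, isPath_nil.2 rfl⟩)
    rw [List.append_assoc] at h1 hX'
    refine Eq.trans h1 ((ih hX' hl'.2).trans ?_)
    rw [List.append_assoc]
    rfl

/-- The part of a closed path before an arrow ends at the target of the arrow. -/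
theorem isPath_of_closed {v : V} {l m : List (DoubleArrow V × ℕ)} {p : DoubleArrow V × ℕ}
    (h : ClosedComp (v, l ++ p :: m)) : IsPath v (l.map Prod.fst) p.1.tgt := by
  rw [ClosedComp, List.map_append] at h
  obtain ⟨w, h1, h2⟩ := isPath_append.1 h
  obtain ⟨rfl, -⟩ := isPath_cons.1 h2
  exact h1

theorem admissible_front {v : V} {l m : List (DoubleArrow V × ℕ)} {p : DoubleArrow V × ℕ}
    {Z : HMonomial V} (hX : Admissible ((v, l ++ p :: m) :: Z)) :
    Admissible ((p.1.tgt, p :: (m ++ l)) :: Z) :=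
  admissible_rotate hX (isPath_of_closed (m := m) (hX.closedComp (by simp)))

theorem QN.mono_front {v : V} {l m : List (DoubleArrow V × ℕ)} {p : DoubleArrow V × ℕ}
    {Z : HMonomial V} (hX : Admissible ((v, l ++ p :: m) :: Z)) :
    (QN.mono ((v, l ++ p :: m) :: Z) : QN K V) = QN.mono ((p.1.tgt, p :: (m ++ l)) :: Z) :=
  QN.mono_rotate hX (isPath_of_closed (m := m) (hX.closedComp (by simp)))

theorem heights_perm_front {v w : V} {l m : List (DoubleArrow V × ℕ)} {p : DoubleArrow V × ℕ}
    {Z : HMonomial V} :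
    (heights ((v, l ++ p :: m) :: Z)).Perm (heights ((w, p :: (m ++ l)) :: Z)) := by
  rw [heights_cons, heights_cons]
  exact List.Perm.append_right _ (List.Perm.map _ (List.perm_append_comm (l₂ := p :: m)))

theorem admissible_mapHeights_equiv (s : Equiv.Perm ℕ) {X : HMonomial V} (hX : X.Admissible) :
    (X.mapHeights s).Admissible := (admissible_map s.injective.injOn).2 hX

theorem QN.mono_mapHeights_front (f : ℕ → ℕ) {v : V} {l m : List (DoubleArrow V × ℕ)}
    {p : DoubleArrow V × ℕ} {Z : HMonomial V}
    (hX : Admissible (mapHeights f ((v, l ++ p :: m) :: Z))) :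
    (QN.mono (mapHeights f ((v, l ++ p :: m) :: Z)) : QN K V) =
      QN.mono (mapHeights f ((p.1.tgt, p :: (m ++ l)) :: Z)) := by
  rw [mapHeights_cons, mapHeights_cons] at *
  simp only [List.map_append, List.map_cons] at *
  exact QN.mono_front hX

/-- Exchanging two adjacent heights in two different components. -/
theorem QN.mono_swap {v w : V} {a b : DoubleArrow V} {h k : ℕ}
    {l₁ l₂ m₁ m₂ : List (DoubleArrow V × ℕ)} {Z : HMonomial V}
    (hX : Admissible ((v, l₁ ++ (a, h) :: l₂) :: (w, m₁ ++ (b, k) :: m₂) :: Z)) (hk : h < k)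
    (hadj : ∀ j ∈ heights ((v, l₁ ++ (a, h) :: l₂) :: (w, m₁ ++ (b, k) :: m₂) :: Z),
      ¬(h < j ∧ j < k)) :
    (QN.mono ((v, l₁ ++ (a, h) :: l₂) :: (w, m₁ ++ (b, k) :: m₂) :: Z) : QN K V) =
      QN.mono (mapHeights (Equiv.swap h k) ((v, l₁ ++ (a, h) :: l₂) :: (w, m₁ ++ (b, k) :: m₂) :: Z)) +
        (C (pairing a b : K)) • QN.mono ((a.src, (l₂ ++ l₁) ++ (m₂ ++ m₁)) :: Z) := by
  -- The defining relations act on leading letters of leading components. So the first component is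
  -- rotated, the components are exchanged, the second one is rotated, and they are exchanged back;
  -- the same is done for the monomial with exchanged heights.
  have h1 := admissible_front hX
  have hp : ∀ (c d : HComp V), (c :: d :: Z).Perm (d :: c :: Z) := fun c d => List.Perm.swap _ _ _
  have h2 := (admissible_perm (hp _ _)).1 h1
  have h3 := admissible_front h2
  have h4 := (admissible_perm (hp _ _)).1 h3
  have hpm : ∀ f c d, (QN.mono (mapHeights f (c :: d :: Z)) : QN K V) =
      QN.mono (mapHeights f (d :: c :: Z)) := fun f c d => QN.mono_perm ((hp c d).map _)
  rw [QN.mono_front hX, QN.mono_perm (hp _ _), QN.mono_front h2, QN.mono_perm (hp _ _),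
    QN.mono_mapHeights_front _ (admissible_mapHeights_equiv _ hX),
    hpm,
    QN.mono_mapHeights_front _ (admissible_mapHeights_equiv _ h2),
    hpm,
    mapHeights_swap_skein h4]
  have := QN.proj_eq_zero (K := K) (.skein _ _ _ _ _ _ _ _ _ h4 hk ?_)
  · rw [map_sub, map_sub, map_smul, sub_sub, sub_eq_zero] at this
    exact this
  · intro j hj
    refine hadj j ?_
    rw [← (heights_perm_front (Z := _ :: Z) (w := a.tgt)).mem_iff] at hj
    rw [(heights_perm (hp _ _)).mem_iff] at hj ⊢
    rw [← (heights_perm_front (Z := _ :: Z) (w := b.tgt)).mem_iff] at hj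
    exact hj

/-- Exchanging two adjacent heights in one component. -/
theorem QN.mono_swapSelf {v : V} {l : List (DoubleArrow V × ℕ)} {h k : ℕ} {Z : HMonomial V}
    (hX : Admissible ((v, l) :: Z)) (hh : h ∈ l.map Prod.snd) (hk' : k ∈ l.map Prod.snd) (hk : h < k)
    (hadj : ∀ j ∈ heights ((v, l) :: Z), ¬(h < j ∧ j < k)) :
    ∃ z : QN K V, QN.mono ((v, l) :: Z) =
      QN.mono (mapHeights (Equiv.swap h k) ((v, l) :: Z)) + (X : K[X]) • z := by
  obtain ⟨⟨a, h'⟩, hp, rfl⟩ := List.mem_map.1 hh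
  obtain ⟨l₁, l₂, rfl⟩ := List.append_of_mem hp
  simp only at hk hadj ⊢
  have h1 := admissible_front hX
  have hk2 : k ∈ (l₂ ++ l₁).map Prod.snd := by
    simp only [List.map_append, List.map_cons, List.mem_append, List.mem_cons] at hk' ⊢
    rcases hk' with h | h | h
    · exact Or.inr h
    · omega
    · exact Or.inl h
  obtain ⟨⟨b, k'⟩, hq, rfl⟩ := List.mem_map.1 hk2
  obtain ⟨m₁, m₂, e⟩ := List.append_of_mem hq
  simp only at hk hadj ⊢
  rw [e] at h1
  -- After rotating the letter of height `h` to the front, the letter of height `k` cuts the rest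
  -- into `m₁` and `m₂`, and the witness is the monomial split there.
  refine ⟨C (pairing a b : K) • QN.mono ((b.src, m₂) :: (a.src, m₁) :: Z), ?_⟩
  rw [QN.mono_front hX, QN.mono_mapHeights_front _ (admissible_mapHeights_equiv _ hX), e,
    ← List.cons_append, mapHeights_swap_skeinSelf h1]
  have := QN.proj_eq_zero (K := K) (.skeinSelf _ _ _ _ _ _ _ _ h1 hk ?_)
  · rw [map_sub, map_sub, map_smul, sub_sub, sub_eq_zero] at this
    rw [smul_smul, mul_comm X]
    exact this
  · intro j hj
    refine hadj j ?_
    rw [List.cons_append, ← e, ← heights_perm_front.mem_iff] at hj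
    exact hj

/-- Since the heights in `l` are distinct, a height identifies its letter, and the new height is a
function of the old one. -/
theorem exists_relabel_list {α : Type*} {l l' : List (α × ℕ)} (h : l.map Prod.fst = l'.map Prod.fst)
    (hn : (l.map Prod.snd).Nodup) : ∃ η : ℕ → ℕ, l' = l.map fun a => (a.1, η a.2) := by
  induction l generalizing l' with
  | nil => exact ⟨id, by simpa using h.symm⟩
  | cons a l ih =>
    cases l' with
    | nil => simp at h
    | cons a' l' =>
      simp only [List.map_cons, List.cons.injEq, List.nodup_cons] at h hn
      obtain ⟨η, hη⟩ := ih h.2 hn.2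
      refine ⟨Function.update η a.2 a'.2, ?_⟩
      rw [hη, List.map_cons, Function.update_self]
      congr 1
      · exact Prod.ext h.1.symm rfl
      · refine List.map_congr_left fun b hb => ?_
        rw [Function.update_of_ne]
        intro e
        exact hn.1 (e ▸ List.mem_map.2 ⟨b, hb, rfl⟩)

/-- Two monomials which differ only in their heights are related by a map of the heights. -/
theorem exists_relabel {X Y : HMonomial V}
    (h : X.map (fun c => (c.1, c.2.map Prod.fst)) = Y.map fun c => (c.1, c.2.map Prod.fst))
    (hn : X.heights.Nodup) : ∃ η : ℕ → ℕ, Y = X.mapHeights η := by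
  classical
  induction X generalizing Y with
  | nil =>
    obtain rfl : Y = [] := by simpa using h.symm
    exact ⟨id, rfl⟩
  | cons c X ih =>
    cases Y with
    | nil => simp at h
    | cons d Y =>
      simp only [List.map_cons, List.cons.injEq, Prod.mk.injEq] at h
      rw [heights_cons, List.nodup_append', List.disjoint_left] at hn
      obtain ⟨η₁, h₁⟩ := exists_relabel_list h.1.2 hn.1
      obtain ⟨η₂, h₂⟩ := ih h.2 hn.2.1
      refine ⟨fun i => if i ∈ c.2.map Prod.snd then η₁ i else η₂ i, ?_⟩
      rw [mapHeights_cons, h₂]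
      congr 1
      · refine Prod.ext h.1.1.symm ?_
        rw [h₁]
        refine List.map_congr_left fun b hb => ?_
        rw [if_pos (List.mem_map.2 ⟨b, hb, rfl⟩)]
      · refine mapHeights_congr fun j hj => ?_
        rw [if_neg fun e => hn.2.2 e hj]

theorem injOn_of_nodup {X : HMonomial V} {η : ℕ → ℕ} (h : (X.mapHeights η).heights.Nodup) :
    Set.InjOn η {j | j ∈ X.heights} := by
  rw [heights_map] at h
  exact fun i hi j hj e => List.inj_on_of_nodup_map h hi hj e

end Skein

end NecklaceQuantization

namespace NecklaceQuantization

open DoubleArrow PathAlgebra HMonomial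

open Polynomial

noncomputable instance QN.algebraField {V : Type*} [Quiver V] {K : Type*} [Field K] :
    Algebra K (QN K V) :=
  Algebra.ofModule (fun r x y => by rw [QN.smul_def, QN.smul_def, smul_mul_assoc])
    (fun r x y => by rw [QN.smul_def, QN.smul_def, mul_smul_comm])

/-! ### Cyclic words in a quotient that kills `ħ`. -/

section Classical

set_option linter.unusedSectionVars false

variable {V : Type*} [Quiver V] {K : Type*} [Field K]
variable {A : Type*} [Ring A] [Algebra K A] (q : QN K V →ₐ[K] A)

theorem QN.mono_mapHeights_perm (f : ℕ → ℕ) {Y Z : HMonomial V} (h : Y.Perm Z) :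
    (QN.mono (Y.mapHeights f) : QN K V) = QN.mono (Z.mapHeights f) := QN.mono_perm (h.map _)

theorem map_smul_of_map_X_smul (hq : ∀ z, q ((X : K[X]) • z) = 0) (c : K[X]) (z : QN K V) :
    q (c • z) = c.coeff 0 • q z := by
  conv_lhs => rw [← Polynomial.divX_mul_X_add c]
  rw [add_smul, map_add, mul_comm, mul_smul, hq, zero_add, ← QN.smul_def, map_smul]

theorem map_C_smul (c : K) (z : QN K V) : q ((C c : K[X]) • z) = c • q z := by
  rw [← QN.smul_def, map_smul]

/-- Modulo `ħ`, the heights in a single component do not matter. -/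
theorem map_mono_mapHeights_single (hq : ∀ z, q ((X : K[X]) • z) = 0) {v : V}
    {l : List (DoubleArrow V × ℕ)} (hX : Admissible [(v, l)]) {η : ℕ → ℕ}
    (hη : Set.InjOn η {j | j ∈ heights [(v, l)]}) :
    q (QN.mono (mapHeights η [(v, l)])) = q (QN.mono [(v, l)]) := by
  have hT : ∀ j, j ∈ (heights [(v, l)]).toFinset ↔ j ∈ heights [(v, l)] := fun j => List.mem_toFinset
  have key := eq_of_adjacent_swap (heights [(v, l)]).toFinset
    (fun η => q (QN.mono (mapHeights η [(v, l)]))) ?_ ?_ η ?_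
  · rwa [mapHeights_id (f := id) fun _ _ => rfl] at key
  · intro η hη
    rw [mapHeights_id (f := id) fun _ _ => rfl, QN.mono_map]
    exact fun i hi j hj h => hη ((hT i).2 hi) ((hT j).2 hj) h
  · intro η hη i hi j hj hij hadj
    have hη' : Set.InjOn η {j | j ∈ heights [(v, l)]} := fun i hi j hj h =>
      hη ((hT i).2 hi) ((hT j).2 hj) h
    have h1 : Admissible (mapHeights η [(v, l)]) := (admissible_map hη').2 hX
    have hm : ∀ i ∈ heights [(v, l)], η i ∈ ((l.map fun a => (a.1, η a.2)).map Prod.snd) := by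
      intro i hi
      obtain ⟨c, hc, p, hp, rfl⟩ := mem_heights.1 hi
      obtain rfl := List.mem_singleton.1 hc
      exact List.mem_map.2 ⟨_, List.mem_map.2 ⟨p, hp, rfl⟩, rfl⟩
    rw [← mapHeights_map]
    have hadj' : ∀ t ∈ heights (mapHeights η [(v, l)]), ¬(η i < t ∧ t < η j) := by
      intro t ht
      rw [heights_map] at ht
      obtain ⟨s, hs, rfl⟩ := List.mem_map.1 ht
      exact hadj s ((hT s).2 hs)
    obtain ⟨z, hz⟩ := QN.mono_swapSelf (K := K) h1 (hm i ((hT i).1 hi)) (hm j ((hT j).1 hj)) hij hadj'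
    refine Eq.trans ?_ (congrArg q hz).symm
    rw [map_add, hq, add_zero]
    rfl
  · exact fun i hi j hj h => hη ((hT i).1 hi) ((hT j).1 hj) h

/-- The image of a cyclic word. -/
noncomputable def cycWord (v : V) (l : List (DoubleArrow V)) : A := q (QN.mono [(v, l.zipIdx 1)])

theorem map_fst_zipIdx {α : Type*} (l : List α) (n : ℕ) : (l.zipIdx n).map Prod.fst = l := by
  simp

theorem admissible_zipIdx {v : V} {l : List (DoubleArrow V)} :
    Admissible [(v, l.zipIdx 1)] ↔ IsPath v l v := by
  have h : (heights [(v, l.zipIdx 1)]).Nodup := by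
    simp [heights, List.nodup_range']
  simp only [Admissible, h, and_true, List.mem_singleton, forall_eq, map_fst_zipIdx, IsPath]

theorem cycWord_of_not {v : V} {l : List (DoubleArrow V)} (h : ¬ IsPath v l v) :
    cycWord q v l = 0 := by
  rw [cycWord, QN.mono_of_not (fun e => h (admissible_zipIdx.1 e)), map_zero]

theorem map_heightLift_word {v : V} {l : List (DoubleArrow V)} :
    q (QN.heightLift (word v l)) = cycWord q v l := by
  by_cases h : IsWord v l
  · rw [word_of _ _ h, QN.heightLift, lift_ofPath]
    rfl
  · rw [word, dif_neg h, map_zero, map_zero, cycWord_of_not _ fun e => h e.1]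

theorem map_mono_single (hq : ∀ z, q ((X : K[X]) • z) = 0) {v : V}
    {l : List (DoubleArrow V × ℕ)} (hX : (l.map Prod.snd).Nodup) :
    q (QN.mono [(v, l)]) = cycWord q v (l.map Prod.fst) := by
  have hn : (heights [(v, l)]).Nodup := by simpa [heights] using hX
  by_cases h : IsPath v (l.map Prod.fst) v
  · have h0 : Admissible [(v, (l.map Prod.fst).zipIdx 1)] := admissible_zipIdx.2 h
    obtain ⟨η, hη⟩ := exists_relabel (X := [(v, (l.map Prod.fst).zipIdx 1)]) (Y := [(v, l)])
      (by simp) h0.2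
    rw [cycWord, hη]
    refine map_mono_mapHeights_single q hq h0 (injOn_of_nodup ?_)
    rwa [← hη]
  · rw [cycWord_of_not _ h, QN.mono_of_not, map_zero]
    exact fun e => h (e.closedComp (c := (v, l)) (by simp))

/-- Rotating a height-lifting destroys the increasing order of its heights, but modulo `ħ` the
heights within one component are irrelevant. -/
theorem cycWord_append_comm (hq : ∀ z, q ((X : K[X]) • z) = 0) {u v : V}
    {l m : List (DoubleArrow V)} (hl : IsPath u l v) (hm : IsPath v m u) :
    cycWord q u (l ++ m) = cycWord q v (m ++ l) := by
  have h0 := admissible_zipIdx.2 (hl.append hm)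
  rw [List.zipIdx_append] at h0
  have hl' : IsPath u ((l.zipIdx 1).map Prod.fst) v := by rwa [map_fst_zipIdx]
  rw [cycWord, List.zipIdx_append, QN.mono_rotate h0 hl', map_mono_single q hq
      (by simpa [heights] using (admissible_rotate h0 hl').2),
    List.map_append, map_fst_zipIdx, map_fst_zipIdx]

variable [Fintype V]

/-- A height-lifting depends on where the cyclic word is cut open; in a quotient that kills `ħ` it
no longer does, so it descends to cyclic words. Products of paths that do not close up go to zero in
either order. -/
theorem commutator_le_ker (hq : ∀ z, q ((X : K[X]) • z) = 0) :
    commutatorSubmodule K (PathAlgebra K V) ≤ LinearMap.ker (q.toLinearMap ∘ₗ QN.heightLift) := by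
  classical
  rw [commutatorSubmodule, Submodule.span_le]
  rintro _ ⟨x, y, rfl⟩
  rw [SetLike.mem_coe, LinearMap.mem_ker, map_sub, sub_eq_zero]
  induction x using span_induction with
  | zero => simp
  | add x x' h h' => rw [add_mul, mul_add, map_add, map_add, h, h']
  | smul c x h => rw [smul_mul_assoc, mul_smul_comm, map_smul, map_smul, h]
  | word u k hk =>
  induction y using span_induction with
  | zero => simp
  | add x x' h h' => rw [add_mul, mul_add, map_add, map_add, h, h']
  | smul c x h => rw [smul_mul_assoc, mul_smul_comm, map_smul, map_smul, h]
  | word v l hl =>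
    have key : ∀ (u v : V) (k l : List (DoubleArrow V)), IsWord u k → IsWord v l →
        q (QN.heightLift (word u k * word v l)) =
          if wordSrc u k = v ∧ wordSrc v l = u then cycWord q u (k ++ l) else 0 := by
      intro u v k l hk hl
      rw [word_mul_word _ _ _ _ hk hl]
      by_cases h1 : wordSrc u k = v
      · rw [if_pos h1, map_heightLift_word]
        by_cases h2 : wordSrc v l = u
        · rw [if_pos ⟨h1, h2⟩]
        · rw [if_neg fun e => h2 e.2, cycWord_of_not]
          rintro ⟨-, h3⟩
          rw [wordSrc_append, h1] at h3
          exact h2 h3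
      · rw [if_neg h1, if_neg fun e => h1 e.1, map_zero, map_zero]
    change q (QN.heightLift (word u k * word v l)) = q (QN.heightLift (word v l * word u k))
    rw [key _ _ _ _ hk hl, key _ _ _ _ hl hk]
    by_cases h : wordSrc u k = v ∧ wordSrc v l = u
    · rw [if_pos h, if_pos h.symm, cycWord_append_comm q hq ⟨hk, h.1⟩ ⟨hl, h.2⟩]
    · rw [if_neg h, if_neg fun e => h e.symm]

/-- The map on cyclic words induced by the height-lifting. -/
noncomputable def cycLift (hq : ∀ z, q ((X : K[X]) • z) = 0) :
    CyclicQuotient K (PathAlgebra K V) →ₗ[K] A :=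
  (commutatorSubmodule K (PathAlgebra K V)).liftQ (q.toLinearMap ∘ₗ QN.heightLift)
    (commutator_le_ker q hq)

theorem cycLift_word (hq : ∀ z, q ((X : K[X]) • z) = 0) (v : V) (l : List (DoubleArrow V)) :
    cycLift q hq (toCyclic (word v l)) = cycWord q v l := map_heightLift_word q

/-- Exchanging two adjacent heights changes a monomial, modulo `ħ`, only by monomials with fewer
components. -/
theorem map_mono_swap_mem (hq : ∀ z, q ((X : K[X]) • z) = 0) (W : Submodule K A) {Y : HMonomial V}
    (hY : Y.Admissible) (hW : ∀ Z : HMonomial V, Z.Admissible → Z.length < Y.length → q (QN.mono Z) ∈ W)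
    {h k : ℕ} (hh : h ∈ Y.heights) (hk' : k ∈ Y.heights) (hk : h < k)
    (hadj : ∀ j ∈ Y.heights, ¬(h < j ∧ j < k)) :
    q (QN.mono Y) - q (QN.mono (Y.mapHeights (Equiv.swap h k))) ∈ W := by
  obtain ⟨⟨v, l⟩, hc, ⟨a, h'⟩, hp, e⟩ := mem_heights.1 hh
  obtain rfl : h' = h := e
  obtain ⟨Y₁, Y₂, rfl⟩ := List.append_of_mem hc
  have hperm : (Y₁ ++ (v, l) :: Y₂).Perm ((v, l) :: (Y₁ ++ Y₂)) := List.perm_middle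
  rw [QN.mono_perm hperm, QN.mono_mapHeights_perm _ hperm]
  have hlen : (Y₁ ++ (v, l) :: Y₂).length = (Y₁ ++ Y₂).length + 1 := by simp; omega
  rw [admissible_perm hperm] at hY
  simp only [(heights_perm hperm).mem_iff] at hk' hadj
  rw [hlen] at hW
  generalize Y₁ ++ Y₂ = Z at *
  -- In the same component the difference is a multiple of `ħ` and vanishes. In different components
  -- it is a multiple of a glued monomial, which has one component fewer.
  by_cases hkl : k ∈ l.map Prod.snd
  · obtain ⟨z, hz⟩ := QN.mono_swapSelf (K := K) hY (List.mem_map.2 ⟨_, hp, rfl⟩) hkl hk hadj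
    rw [hz, map_add, hq, add_zero, sub_self]
    exact zero_mem _
  · rw [heights_cons, List.mem_append, or_iff_right hkl] at hk'
    obtain ⟨⟨w, m⟩, hd, ⟨b, k'⟩, hr, e⟩ := mem_heights.1 hk'
    obtain rfl : k' = k := e
    obtain ⟨Z₁, Z₂, rfl⟩ := List.append_of_mem hd
    have hperm : ((v, l) :: (Z₁ ++ (w, m) :: Z₂)).Perm ((v, l) :: (w, m) :: (Z₁ ++ Z₂)) :=
      List.Perm.cons _ List.perm_middle
    rw [QN.mono_perm hperm, QN.mono_mapHeights_perm _ hperm]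
    rw [admissible_perm hperm] at hY
    simp only [(heights_perm hperm).mem_iff] at hadj
    have hlen : (Z₁ ++ (w, m) :: Z₂).length = (Z₁ ++ Z₂).length + 1 := by simp; omega
    rw [hlen] at hW
    generalize Z₁ ++ Z₂ = Z at *
    obtain ⟨l₁, l₂, rfl⟩ := List.append_of_mem hp
    obtain ⟨m₁, m₂, rfl⟩ := List.append_of_mem hr
    rw [QN.mono_swap hY hk hadj, map_add, add_sub_cancel_left, map_C_smul]
    by_cases ha : Admissible ((a.src, (l₂ ++ l₁) ++ (m₂ ++ m₁)) :: Z)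
    · exact W.smul_mem _ (hW _ ha (by simp))
    · rw [QN.mono_of_not ha, map_zero, smul_zero]
      exact zero_mem _

end Classical

end NecklaceQuantization

namespace NecklaceQuantization

open DoubleArrow PathAlgebra HMonomial

open Polynomial

/-- Transposing two adjacent values changes the relative order of that pair and of no other. -/
theorem swap_lt_swap_iff {x y c d : ℕ} (hxy : x < y) (hc : ¬(x < c ∧ c < y)) (hd : ¬(x < d ∧ d < y))
    (hcd : c ≠ d) (h1 : ¬(c = x ∧ d = y)) (h2 : ¬(c = y ∧ d = x)) :
    Equiv.swap x y d < Equiv.swap x y c ↔ d < c := by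
  simp only [Equiv.swap_apply_def]
  split_ifs <;> omega

/-! ### The commutator of two cyclic words is their necklace bracket. -/

section Bracket

set_option linter.unusedSectionVars false

variable {V : Type*} [Quiver V] {K : Type*} [Field K] [Fintype V]
variable {A : Type*} [Ring A] [Algebra K A] (q : QN K V →ₐ[K] A)

/-- The sum over all pairs of letters of two components, the first above the second, of their
gluing. -/
noncomputable def crossSum (η : ℕ → ℕ) (l m : List (DoubleArrow V × ℕ)) : A :=
  rotSum (fun p l' => rotSum (fun r m' => (if η r.2 < η p.2 then (pairing p.1 r.1 : K) else 0) •
    cycWord q p.1.src ((l' ++ m').map Prod.fst)) m) l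

theorem crossSum_congr {η θ : ℕ → ℕ} {l m : List (DoubleArrow V × ℕ)}
    (h : ∀ p ∈ l, ∀ r ∈ m, (η r.2 < η p.2 ↔ θ r.2 < θ p.2)) : crossSum q η l m = crossSum q θ l m := by
  rw [crossSum, crossSum, rotSum, rotSum]
  refine splitSum_congr fun l₁ p l₂ e => ?_
  rw [rotSum, rotSum]
  refine splitSum_congr fun m₁ r m₂ e' => ?_
  rw [if_congr (h p (by simp [e]) r (by simp [e'])) rfl rfl]

/-- Only the pair with heights `η i` and `η j` changes its relative order. Before the exchange it is
not counted; afterwards the first letter is above the second, and its gluing is added. -/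
theorem crossSum_swap {η : ℕ → ℕ} {l₁ l₂ m₁ m₂ : List (DoubleArrow V × ℕ)} {a b : DoubleArrow V}
    {i j : ℕ} (hη : Set.InjOn η {t | t ∈ (l₁ ++ (a, i) :: l₂).map Prod.snd ++
      (m₁ ++ (b, j) :: m₂).map Prod.snd})
    (hn : ((l₁ ++ (a, i) :: l₂).map Prod.snd ++ (m₁ ++ (b, j) :: m₂).map Prod.snd).Nodup)
    (hij : η i < η j) (hadj : ∀ t ∈ (l₁ ++ (a, i) :: l₂).map Prod.snd ++
      (m₁ ++ (b, j) :: m₂).map Prod.snd, ¬(η i < η t ∧ η t < η j)) :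
    crossSum q (Equiv.swap (η i) (η j) ∘ η) (l₁ ++ (a, i) :: l₂) (m₁ ++ (b, j) :: m₂) =
      crossSum q η (l₁ ++ (a, i) :: l₂) (m₁ ++ (b, j) :: m₂) +
        (pairing a b : K) • cycWord q a.src (((l₂ ++ l₁) ++ (m₂ ++ m₁)).map Prod.fst) := by
  have hi : i ∈ (l₁ ++ (a, i) :: l₂).map Prod.snd ++ (m₁ ++ (b, j) :: m₂).map Prod.snd := by simp
  have hj : j ∈ (l₁ ++ (a, i) :: l₂).map Prod.snd ++ (m₁ ++ (b, j) :: m₂).map Prod.snd := by simp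
  have key : ∀ p ∈ l₁ ++ (a, i) :: l₂, ∀ r ∈ m₁ ++ (b, j) :: m₂, ¬ (p.2 = i ∧ r.2 = j) →
      (Equiv.swap (η i) (η j) (η r.2) < Equiv.swap (η i) (η j) (η p.2) ↔ η r.2 < η p.2) := by
    intro p hp r hr h
    have hp' : p.2 ∈ (l₁ ++ (a, i) :: l₂).map Prod.snd := List.mem_map.2 ⟨p, hp, rfl⟩
    have hr' : r.2 ∈ (m₁ ++ (b, j) :: m₂).map Prod.snd := List.mem_map.2 ⟨r, hr, rfl⟩
    have hp2 := List.mem_append_left ((m₁ ++ (b, j) :: m₂).map Prod.snd) hp'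
    have hr2 := List.mem_append_right ((l₁ ++ (a, i) :: l₂).map Prod.snd) hr'
    have hd := (List.nodup_append'.1 hn).2.2
    have hi' : i ∈ (l₁ ++ (a, i) :: l₂).map Prod.snd := by simp
    refine swap_lt_swap_iff hij (hadj _ hp2) (hadj _ hr2) (fun e => ?_) (fun e => ?_) (fun e => ?_)
    · have := hη hp2 hr2 e
      exact hd hp' (this ▸ hr')
    · exact h ⟨hη hp2 hi e.1, hη hr2 hj e.2⟩
    · have := hη hr2 hi e.2
      exact hd hi' (this ▸ hr')
  have hnl : ∀ p, p ∈ l₁ ∨ p ∈ l₂ → p.2 ≠ i := by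
    rintro p hp rfl
    have := (List.nodup_append'.1 hn).1
    rw [List.map_append, List.map_cons, List.nodup_middle, List.nodup_cons, List.mem_append,
      List.mem_map, List.mem_map] at this
    rcases hp with hp | hp
    · exact this.1 (Or.inl ⟨p, hp, rfl⟩)
    · exact this.1 (Or.inr ⟨p, hp, rfl⟩)
  have hnm : ∀ r, r ∈ m₁ ∨ r ∈ m₂ → r.2 ≠ j := by
    rintro p hp rfl
    have := (List.nodup_append'.1 hn).2.1
    rw [List.map_append, List.map_cons, List.nodup_middle, List.nodup_cons, List.mem_append,
      List.mem_map, List.mem_map] at this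
    rcases hp with hp | hp
    · exact this.1 (Or.inl ⟨p, hp, rfl⟩)
    · exact this.1 (Or.inr ⟨p, hp, rfl⟩)
  have hzero : ∀ p r (c : K) (x : A), p ∈ l₁ ++ (a, i) :: l₂ → r ∈ m₁ ++ (b, j) :: m₂ →
      ¬ (p.2 = i ∧ r.2 = j) →
      (if (Equiv.swap (η i) (η j) ∘ η) r.2 < (Equiv.swap (η i) (η j) ∘ η) p.2 then c else 0) • x -
        (if η r.2 < η p.2 then c else 0) • x = 0 := by
    intro p r c x hp hr h
    rw [sub_eq_zero, Function.comp_apply, Function.comp_apply, if_congr (key p hp r hr h) rfl rfl]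
  rw [add_comm, ← sub_eq_iff_eq_add, crossSum, crossSum, rotSum, rotSum, ← splitSum_sub]
  simp only [rotSum, ← splitSum_sub]
  rw [splitSum_single, splitSum_single]
  · simp only [Function.comp_apply, Equiv.swap_apply_left, Equiv.swap_apply_right]
    rw [if_pos hij, if_neg hij.not_gt, zero_smul, sub_zero]
  · exact fun _ r _ hr => hzero _ r _ _ (by simp) (by simp [hr]) fun e => hnm r (Or.inl hr) e.2
  · exact fun _ r _ hr => hzero _ r _ _ (by simp) (by simp [hr]) fun e => hnm r (Or.inr hr) e.2
  · exact fun _ p _ hp => splitSum_eq_zero fun _ r _ e =>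
      hzero p r _ _ (by simp [hp]) (by simp [e]) fun e => hnl p (Or.inl hp) e.1
  · exact fun _ p _ hp => splitSum_eq_zero fun _ r _ e =>
      hzero p r _ _ (by simp [hp]) (by simp [e]) fun e => hnl p (Or.inr hp) e.1

variable {q}

/-- The gluing lost by the monomial in the skein relation is the one gained by `crossSum`. Their sum
is therefore an invariant, to which `eq_of_adjacent_swap` can be applied. -/
theorem map_mono_add_crossSum_swap (hq : ∀ z, q ((X : K[X]) • z) = 0) {v w : V}
    {l m : List (DoubleArrow V × ℕ)} (hX : Admissible [(v, l), (w, m)]) {η : ℕ → ℕ}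
    (hη : Set.InjOn η {t | t ∈ heights [(v, l), (w, m)]}) {i j : ℕ} (hi : i ∈ l.map Prod.snd)
    (hj : j ∈ m.map Prod.snd) (hij : η i < η j)
    (hadj : ∀ t ∈ heights [(v, l), (w, m)], ¬(η i < η t ∧ η t < η j)) :
    q (QN.mono (mapHeights (Equiv.swap (η i) (η j) ∘ η) [(v, l), (w, m)])) +
        crossSum q (Equiv.swap (η i) (η j) ∘ η) l m =
      q (QN.mono (mapHeights η [(v, l), (w, m)])) + crossSum q η l m := by
  obtain ⟨⟨a, i'⟩, hp, e⟩ := List.mem_map.1 hi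
  obtain rfl : i' = i := e
  obtain ⟨⟨b, j'⟩, hr, e⟩ := List.mem_map.1 hj
  obtain rfl : j' = j := e
  obtain ⟨l₁, l₂, rfl⟩ := List.append_of_mem hp
  obtain ⟨m₁, m₂, rfl⟩ := List.append_of_mem hr
  have hh : heights [(v, l₁ ++ (a, i') :: l₂), (w, m₁ ++ (b, j') :: m₂)] =
      (l₁ ++ (a, i') :: l₂).map Prod.snd ++ (m₁ ++ (b, j') :: m₂).map Prod.snd := by
    simp [heights]
  have hX' := (admissible_map hη).2 hX
  have hadj' : ∀ t ∈ heights (mapHeights η [(v, l₁ ++ (a, i') :: l₂), (w, m₁ ++ (b, j') :: m₂)]),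
      ¬(η i' < t ∧ t < η j') := by
    intro t ht
    rw [heights_map] at ht
    obtain ⟨s, hs, rfl⟩ := List.mem_map.1 ht
    exact hadj s hs
  have hn := hX'.2
  rw [heights_map] at hn
  have hX2 := hX.2
  rw [hh] at hη hadj hX2 hn
  rw [crossSum_swap q hη hX2 hij hadj, ← mapHeights_map]
  have e : mapHeights η [(v, l₁ ++ (a, i') :: l₂), (w, m₁ ++ (b, j') :: m₂)] =
      [(v, l₁.map (fun p => (p.1, η p.2)) ++ (a, η i') :: l₂.map fun p => (p.1, η p.2)),
        (w, m₁.map (fun p => (p.1, η p.2)) ++ (b, η j') :: m₂.map fun p => (p.1, η p.2))] := by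
    simp [mapHeights]
  rw [e] at hX' hadj' ⊢
  rw [QN.mono_swap (K := K) hX' hij hadj', map_add, map_C_smul, map_mono_single q hq]
  · simp only [List.map_append, List.map_map, Function.comp_def]
    abel
  · have h1 : (((l₁ ++ l₂) ++ (m₁ ++ m₂)).map fun p => η p.2).Nodup := by
      refine List.Nodup.sublist ?_ hn
      rw [← List.map_append, List.map_map]
      refine List.Sublist.map _ (List.Sublist.append ?_ ?_)
      · exact (List.sublist_cons_self _ _).append_left _
      · exact (List.sublist_cons_self _ _).append_left _
    have h2 : ((l₂ ++ l₁) ++ (m₂ ++ m₁)).Perm ((l₁ ++ l₂) ++ (m₁ ++ m₂)) :=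
      List.perm_append_comm.append List.perm_append_comm
    rw [← (h2.map _).nodup_iff] at h1
    simpa only [List.map_append, List.map_map, Function.comp_def] using h1

/-- How a product of two components depends on the heights, modulo `ħ`. -/
theorem map_mono_add_crossSum (hq : ∀ z, q ((X : K[X]) • z) = 0) {v w : V}
    {l m : List (DoubleArrow V × ℕ)} (hX : Admissible [(v, l), (w, m)]) {η : ℕ → ℕ}
    (hη : Set.InjOn η {t | t ∈ heights [(v, l), (w, m)]}) :
    q (QN.mono (mapHeights η [(v, l), (w, m)])) + crossSum q η l m =
      q (QN.mono [(v, l), (w, m)]) + crossSum q id l m := by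
  have hT : ∀ j, j ∈ (heights [(v, l), (w, m)]).toFinset ↔ j ∈ heights [(v, l), (w, m)] :=
    fun j => List.mem_toFinset
  have hh : ∀ t, t ∈ heights [(v, l), (w, m)] ↔ t ∈ l.map Prod.snd ∨ t ∈ m.map Prod.snd := by
    intro t
    rw [heights_cons, heights_cons, List.mem_append, List.mem_append]
    simp [heights]
  have hd : (l.map Prod.snd).Disjoint (m.map Prod.snd) := by
    have := hX.2
    rw [heights_cons, heights_cons, List.nodup_append'] at this
    exact fun a ha hb => this.2.2 ha (by simp only [List.mem_append]; exact Or.inl hb)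
  have hl : ∀ p ∈ l, p.2 ∈ l.map Prod.snd := fun p hp => List.mem_map.2 ⟨p, hp, rfl⟩
  have hm : ∀ p ∈ m, p.2 ∈ m.map Prod.snd := fun p hp => List.mem_map.2 ⟨p, hp, rfl⟩
  have key := eq_of_adjacent_swap (heights [(v, l), (w, m)]).toFinset
    (fun η => q (QN.mono (mapHeights η [(v, l), (w, m)])) + crossSum q η l m) ?_ ?_ η
    (fun i hi j hj h => hη ((hT i).1 hi) ((hT j).1 hj) h)
  · simpa only [mapHeights_id (f := id) fun _ _ => rfl] using key
  · intro η hη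
    have hη' : StrictMonoOn η {t | t ∈ heights [(v, l), (w, m)]} := fun i hi j hj h =>
      hη ((hT i).2 hi) ((hT j).2 hj) h
    rw [mapHeights_id (f := id) fun _ _ => rfl, QN.mono_map hη']
    congr 1
    exact crossSum_congr q fun p hp r hr =>
      hη'.lt_iff_lt ((hh _).2 (Or.inr (hm r hr))) ((hh _).2 (Or.inl (hl p hp)))
  · intro η hη i hi j hj hij hadj
    replace hη : Set.InjOn η {t | t ∈ heights [(v, l), (w, m)]} := fun i hi j hj h =>
      hη ((hT i).2 hi) ((hT j).2 hj) h
    replace hadj : ∀ t ∈ heights [(v, l), (w, m)], ¬(η i < η t ∧ η t < η j) := fun t ht =>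
      hadj t ((hT t).2 ht)
    replace hi := (hT i).1 hi
    replace hj := (hT j).1 hj
    have hX' := (admissible_map hη).2 hX
    have hadj' : ∀ t ∈ heights (mapHeights η [(v, l), (w, m)]), ¬(η i < t ∧ t < η j) := by
      intro t ht
      rw [heights_map] at ht
      obtain ⟨s, hs, rfl⟩ := List.mem_map.1 ht
      exact hadj s hs
    -- If both exchanged letters belong to one component, no pair counted by `crossSum` changes its
    -- order.
    have hself : (i ∈ l.map Prod.snd ↔ j ∈ l.map Prod.snd) →
        crossSum q (Equiv.swap (η i) (η j) ∘ η) l m = crossSum q η l m := by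
      intro h
      refine crossSum_congr q fun p hp r hr => ?_
      have hp' := (hh _).2 (Or.inl (hl p hp))
      have hr' := (hh _).2 (Or.inr (hm r hr))
      have hr2 : r.2 ∉ l.map Prod.snd := fun e => hd e (hm r hr)
      refine swap_lt_swap_iff hij (hadj _ hp') (hadj _ hr') (fun e => ?_) (fun e => ?_) (fun e => ?_)
      · exact hr2 (hη hp' hr' e ▸ hl p hp)
      · rw [← hη hp' hi e.1, ← hη hr' hj e.2] at h
        exact hr2 (h.1 (hl p hp))
      · rw [← hη hp' hj e.1, ← hη hr' hi e.2] at h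
        exact hr2 (h.2 (hl p hp))
    have hmem : ∀ (n : List (DoubleArrow V × ℕ)) t, t ∈ n.map Prod.snd →
        η t ∈ ((n.map fun a => (a.1, η a.2)).map Prod.snd) := by
      intro n t ht
      obtain ⟨p, hp, rfl⟩ := List.mem_map.1 ht
      exact List.mem_map.2 ⟨_, List.mem_map.2 ⟨p, hp, rfl⟩, rfl⟩
    rcases (hh i).1 hi with hi1 | hi1 <;> rcases (hh j).1 hj with hj1 | hj1
    · rw [hself (iff_of_true hi1 hj1), ← mapHeights_map]
      obtain ⟨z, hz⟩ := QN.mono_swapSelf (K := K) hX' (hmem l i hi1) (hmem l j hj1) hij hadj'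
      congr 1
      refine Eq.trans ?_ (congrArg q hz).symm
      rw [map_add, hq, add_zero]
      rfl
    · exact map_mono_add_crossSum_swap hq hX hη hi1 hj1 hij hadj
    -- Here the lower letter belongs to the second component. The swap lemma is applied to the
    -- already exchanged assignment, whose exchange gives back `η`.
    · have h2 : Equiv.swap (η i) (η j) ∘ Equiv.swap (η i) (η j) ∘ η = η := funext fun t =>
        Equiv.swap_apply_self _ _ _
      have h3 := map_mono_add_crossSum_swap (η := Equiv.swap (η i) (η j) ∘ η) hq hX
        ((Equiv.swap (η i) (η j)).injective.comp_injOn hη) hj1 hi1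
        (by simpa using hij) ?_
      · simp only [Function.comp_apply, Equiv.swap_apply_left, Equiv.swap_apply_right] at h3
        rw [h2] at h3
        exact h3.symm
      · intro t ht
        have := hadj t ht
        simp only [Function.comp_apply, Equiv.swap_apply_left, Equiv.swap_apply_right]
        rw [Equiv.swap_apply_def]
        split_ifs <;> omega
    · have hi2 : i ∉ l.map Prod.snd := fun e => hd e hi1
      have hj2 : j ∉ l.map Prod.snd := fun e => hd e hj1
      rw [hself (iff_of_false hi2 hj2), ← mapHeights_map]
      have hperm : [(v, l), (w, m)].Perm [(w, m), (v, l)] := List.Perm.swap _ _ _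
      have hperm' : (mapHeights η [(v, l), (w, m)]).Perm (mapHeights η [(w, m), (v, l)]) := hperm.map _
      have hadj2 : ∀ t ∈ heights (mapHeights η [(w, m), (v, l)]), ¬(η i < t ∧ t < η j) :=
        fun t ht => hadj' t ((heights_perm hperm').mem_iff.2 ht)
      obtain ⟨z, hz⟩ := QN.mono_swapSelf (K := K) ((admissible_perm hperm').1 hX') (hmem m i hi1)
        (hmem m j hj1) hij hadj2
      congr 1
      rw [QN.mono_mapHeights_perm _ hperm', QN.mono_perm hperm']
      refine Eq.trans ?_ (congrArg q hz).symm
      rw [map_add, hq, add_zero]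
      rfl

/-- The commutator of two cyclic words, modulo `ħ`. -/
theorem cycWord_commutator (hq : ∀ z, q ((X : K[X]) • z) = 0) {v w : V}
    {k k' : List (DoubleArrow V)} (hk : IsPath v k v) (hk' : IsPath w k' w) :
    cycWord q v k * cycWord q w k' - cycWord q w k' * cycWord q v k =
      rotSum (fun a l => rotSum (fun b m => (pairing a b : K) • cycWord q a.src (l ++ m)) k') k := by
  have hY := admissible_zipIdx.2 hk
  have hZ := admissible_zipIdx.2 hk'
  obtain ⟨Y, hYe⟩ : ∃ Y : HMonomial V, Y = [(v, k.zipIdx 1)] := ⟨_, rfl⟩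
  obtain ⟨Z, hZe⟩ : ∃ Z : HMonomial V, Z = [(w, k'.zipIdx 1)] := ⟨_, rfl⟩
  rw [cycWord, cycWord, ← hYe, ← hZe, ← map_mul, ← map_mul, QN.mono_mul_mono, QN.mono_mul_mono]
  rw [← hYe] at hY
  rw [← hZe] at hZ
  have hb := Y.lt_bound
  have hc := Z.lt_bound
  have hYh : ∀ p ∈ k.zipIdx 1, p.2 < Y.bound := fun p hp =>
    hb _ (mem_heights.2 ⟨_, by rw [hYe]; exact List.mem_singleton_self _, p, hp, rfl⟩)
  have hZh : ∀ p ∈ k'.zipIdx 1, p.2 < Z.bound := fun p hp =>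
    hc _ (mem_heights.2 ⟨_, by rw [hZe]; exact List.mem_singleton_self _, p, hp, rfl⟩)
  -- This map exchanges the two blocks of heights: those of `Y` go above those of `Z`, and those of
  -- `Z` return to their original values.
  let η : ℕ → ℕ := fun t => if t < Y.bound then Z.bound + t else t - Y.bound
  have e1 : Y.above Z = [(v, k.zipIdx 1), (w, (k'.zipIdx 1).map fun p => (p.1, Y.bound + p.2))] := by
    rw [above, hZe, hYe]; rfl
  have e2 : (mapHeights η (Y.above Z)).Perm (Z.above Y) := by
    have h1 : mapHeights η Y = mapHeights (Z.bound + ·) Y :=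
      mapHeights_congr fun j hj => if_pos (hb j hj)
    have h2 : mapHeights η (mapHeights (Y.bound + ·) Z) = Z := by
      rw [mapHeights_map]
      exact mapHeights_id fun j _ => by simp [η]
    rw [above, above, mapHeights_append, h1, h2]
    exact List.perm_append_comm
  have hadm : Admissible (Y.above Z) := (admissible_append_map hb Z).2 ⟨hY, hZ⟩
  have hadm' : Admissible (Z.above Y) := (admissible_append_map hc Y).2 ⟨hZ, hY⟩
  have hinj : Set.InjOn η {t | t ∈ heights (Y.above Z)} :=
    injOn_of_nodup ((admissible_perm e2).2 hadm').2
  have key := map_mono_add_crossSum (η := η) hq (e1 ▸ hadm) (e1 ▸ hinj)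
  rw [← e1, QN.mono_perm e2] at key
  -- In `Y.above Z` no letter of the first word is above one of the second, so nothing is counted.
  -- After the exchange of blocks every pair is counted, with the full necklace sum as the
  -- difference.
  have h0 : crossSum q id (k.zipIdx 1) ((k'.zipIdx 1).map fun p => (p.1, Y.bound + p.2)) = 0 := by
    refine rotSum_eq_zero fun p hp l => rotSum_eq_zero fun r hr m => ?_
    obtain ⟨s, hs, rfl⟩ := List.mem_map.1 hr
    have := hYh p hp
    simp only [id]
    rw [if_neg (by omega), zero_smul]
  rw [h0, add_zero] at key
  rw [← key, add_sub_cancel_left]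
  conv_rhs => rw [← map_fst_zipIdx k 1, ← map_fst_zipIdx k' 1]
  rw [rotSum_map, crossSum]
  refine splitSum_congr fun l₁ p l₂ e => ?_
  beta_reduce
  rw [rotSum_map, rotSum_map]
  refine splitSum_congr fun m₁ r m₂ e' => ?_
  have h1 := hYh p (by simp [e])
  have h2 := hZh r (by simp [e'])
  have : η (Y.bound + r.2) < η p.2 := by
    simp only [η]
    rw [if_pos h1, if_neg (by omega)]
    omega
  beta_reduce
  rw [if_pos this]
  simp [Function.comp_def]

end Bracket

end NecklaceQuantization

namespace NecklaceQuantization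

open DoubleArrow PathAlgebra HMonomial

open Polynomial

/-! ### The height-lifting as a homomorphism of Lie algebras. -/

section LieHom

set_option linter.unusedSectionVars false

variable {V : Type*} [Quiver V] {K : Type*} [Field K] [Fintype V]

theorem sum_rotSum {ι α M : Type*} [AddCommMonoid M] (s : Finset ι) (f : ι → α → List α → M)
    (l : List α) : ∑ i ∈ s, rotSum (f i) l = rotSum (fun a m => ∑ i ∈ s, f i a m) l := by
  simp only [rotSum, splitSum]
  exact Finset.sum_comm

open scoped TensorProduct Classical in
theorem doubleDer_word (b : DoubleArrow V) {v : V} {l : List (DoubleArrow V)} (h : IsWord v l) :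
    doubleDer b (word v l : PathAlgebra K V) =
      splitSum (fun l₁ a l₂ => if a = b then word v l₁ ⊗ₜ[K] word a.src l₂ else 0) l := by
  induction l generalizing v with
  | nil => rw [doubleDer_idem, splitSum_nil]
  | cons a l ih =>
    rw [word_cons v a l h, doubleDer_word_cons b v a l h, ih h.2, splitSum_cons,
      ← LinearMap.mulLeft_apply (R := K), map_splitSum, h.1]
    congr 1
    refine splitSum_congr fun l₁ c l₂ e => ?_
    rw [LinearMap.mulLeft_apply, mul_ite, mul_zero, Algebra.TensorProduct.tmul_mul_tmul, one_mul,
      ← word_cons]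
    have := h.2
    rw [e, isWord_append] at this
    exact ⟨h.1, this.1⟩

-- Expresses the cyclic derivative, defined through double derivations, as a sum over letters, so
-- that the necklace bracket can be compared with `cycWord_commutator`.
open scoped Classical in
theorem cyclicDer_word (b : DoubleArrow V) {v : V} {l : List (DoubleArrow V)} (h : IsPath v l v) :
    cyclicDer b (word v l : PathAlgebra K V) =
      rotSum (fun a m => if a = b then word a.src m else 0) l := by
  rw [cyclicDer, LinearMap.comp_apply, doubleDer_word b h.1, map_splitSum]
  refine splitSum_congr fun l₁ c l₂ e => ?_
  rw [e] at h
  obtain ⟨u, h1, h2⟩ := isPath_append.1 h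
  have h3 := (isPath_cons.1 h2).2
  rw [apply_ite (insertCyc 1), map_zero, insertCyc_tmul, mul_one, word_mul_word _ _ _ _ h3.1 h1.1,
    if_pos h3.2]

/-- A path that is not closed is its own commutator with the idempotent at its target. -/
theorem toCyclic_word_of_not {v : V} {l : List (DoubleArrow V)} (h : ¬ IsPath v l v) :
    (toCyclic (word v l) : CyclicQuotient K (PathAlgebra K V)) = 0 := by
  classical
  by_cases hl : IsWord v l
  · refine (Submodule.Quotient.mk_eq_zero _).2 (Submodule.subset_span ⟨word v [], word v l, ?_⟩)
    rw [word_mul_word _ _ _ _ (isWord_nil _) hl, word_mul_word _ _ _ _ hl (isWord_nil _),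
      if_neg fun e => h ⟨hl, e⟩]
    simp [wordSrc]
  · rw [word, dif_neg hl, map_zero]

variable {A : Type*} [Ring A] [Algebra K A] (q : QN K V →ₐ[K] A)
variable [Fintype (Quiver.Total V)]

theorem cycLift_lie_word (hq : ∀ z, q ((X : K[X]) • z) = 0) (v w : V)
    (k k' : List (DoubleArrow V)) :
    cycLift q hq ⁅toCyclic (K := K) (word v k : PathAlgebra K V), toCyclic (word w k')⁆ =
      cycLift q hq (toCyclic (word v k)) * cycLift q hq (toCyclic (word w k')) -
        cycLift q hq (toCyclic (word w k')) * cycLift q hq (toCyclic (word v k)) := by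
  classical
  by_cases hk : IsPath v k v
  swap
  · rw [toCyclic_word_of_not hk]; simp
  by_cases hk' : IsPath w k' w
  swap
  · rw [toCyclic_word_of_not hk']; simp
  rw [cycLift_word, cycLift_word, cycWord_commutator hq hk hk']
  have h1 : ⁅toCyclic (K := K) (word v k : PathAlgebra K V), toCyclic (word w k' : PathAlgebra K V)⁆ =
      toCyclic (K := K) (∑ b : DoubleArrow V, ∑ c : DoubleArrow V,
        (pairing b c : K) • (cyclicDer b (word v k) * cyclicDer c (word w k'))) := by
    change necklaceBracket _ _ = _
    rw [necklaceBracket]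
    rfl
  have h2 : (∑ b : DoubleArrow V, ∑ c : DoubleArrow V,
        (pairing b c : K) • (cyclicDer b (word v k) * cyclicDer c (word w k'))) =
      rotSum (fun a l => rotSum (fun b m => (pairing a b : K) •
        (word a.src l * word b.src m : PathAlgebra K V)) k') k := by
    have h3 : ∀ b c : DoubleArrow V, (pairing b c : K) •
        (cyclicDer b (word v k : PathAlgebra K V) * cyclicDer c (word w k')) =
        rotSum (fun a l => rotSum (fun a' m => (pairing b c : K) •
          ((if a = b then word a.src l else 0) * (if a' = c then word a'.src m else 0) :
            PathAlgebra K V)) k') k := by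
      intro b c
      rw [cyclicDer_word b hk, cyclicDer_word c hk', ← LinearMap.mulRight_apply (R := K), map_rotSum,
        smul_rotSum]
      refine splitSum_congr fun l₁ a l₂ _ => ?_
      beta_reduce
      rw [LinearMap.mulRight_apply, ← LinearMap.mulLeft_apply (R := K), map_rotSum, smul_rotSum]
      rfl
    simp only [h3, sum_rotSum]
    refine splitSum_congr fun l₁ a l₂ _ => ?_
    refine splitSum_congr fun m₁ a' m₂ _ => ?_
    simp only [mul_ite, ite_mul, zero_mul, mul_zero, smul_ite, smul_zero, Finset.sum_ite_eq,
      Finset.mem_univ, if_true]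
  rw [h1, h2, ← LinearMap.comp_apply, map_rotSum]
  refine splitSum_congr fun l₁ a l₂ e => ?_
  beta_reduce
  rw [map_rotSum]
  refine splitSum_congr fun m₁ b m₂ e' => ?_
  beta_reduce
  rw [map_smul]
  -- Only for opposite letters do the two remaining paths fit together, so that their product is the
  -- concatenated word.
  by_cases hab : (pairing a b : K) = 0
  · rw [hab, zero_smul, zero_smul]
  · rw [e] at hk
    rw [e'] at hk'
    have ha := hk.rotate
    have hb := hk'.rotate
    rw [word_mul_word _ _ _ _ ha.1 hb.1, ha.2, if_pos (pairing_ends _ _ hab).2,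
      LinearMap.comp_apply, cycLift_word]

theorem cycLift_lie (hq : ∀ z, q ((X : K[X]) • z) = 0)
    (x y : CyclicQuotient K (PathAlgebra K V)) :
    cycLift q hq ⁅x, y⁆ = cycLift q hq x * cycLift q hq y - cycLift q hq y * cycLift q hq x := by
  obtain ⟨x, rfl⟩ := Submodule.Quotient.mk_surjective _ x
  obtain ⟨y, rfl⟩ := Submodule.Quotient.mk_surjective _ y
  change cycLift q hq ⁅toCyclic x, toCyclic y⁆ = cycLift q hq (toCyclic x) * cycLift q hq (toCyclic y) -
    cycLift q hq (toCyclic y) * cycLift q hq (toCyclic x)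
  induction x using span_induction with
  | zero => simp
  | add x x' h h' => simp only [map_add, add_lie, add_mul, mul_add, h, h']; abel
  | smul c x h => simp only [map_smul, smul_lie, smul_mul_assoc, mul_smul_comm, h, smul_sub]
  | word v k hk =>
  induction y using span_induction with
  | zero => simp
  | add x x' h h' => simp only [map_add, lie_add, add_mul, mul_add, h, h']; abel
  | smul c x h => simp only [map_smul, lie_smul, smul_mul_assoc, mul_smul_comm, h, smul_sub]
  | word w k' hk' => exact cycLift_lie_word q hq v w k k'

end LieHom

/-! ### Height-liftings generate modulo `ħ`. -/

section Spanning

set_option linter.unusedSectionVars false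

variable {V : Type*} [Quiver V] {K : Type*} [Field K] [Fintype V]
variable {A : Type*} [Ring A] [Algebra K A] (q : QN K V →ₐ[K] A)

/-- The monomial with the same components in which the heights increase from left to right. -/
def sorted (X : HMonomial V) : HMonomial V :=
  X.foldr (fun c Y => above [(c.1, (c.2.map Prod.fst).zipIdx 1)] Y) []

theorem map_mono_sorted_mem (B : Subalgebra K A) (hB : ∀ v l, cycWord q v l ∈ B) (X : HMonomial V) :
    q (QN.mono (sorted X)) ∈ B := by
  induction X with
  | nil =>
    change q 1 ∈ B
    rw [map_one]
    exact one_mem B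
  | cons c X ih =>
    change q (QN.mono (above _ (sorted X))) ∈ B
    rw [← QN.mono_mul_mono, map_mul]
    exact mul_mem (hB _ _) ih

theorem map_arrows_sorted (X : HMonomial V) :
    (sorted X).map (fun c => (c.1, c.2.map Prod.fst)) = X.map fun c => (c.1, c.2.map Prod.fst) := by
  induction X with
  | nil => rfl
  | cons c X ih =>
    change (above _ (sorted X)).map (fun c => (c.1, c.2.map Prod.fst)) = _
    rw [above, mapHeights, List.map_append, List.map_map, List.map_cons (l := X), ← ih]
    simp [Function.comp_def]

theorem admissible_sorted {X : HMonomial V} (hX : ∀ c ∈ X, ClosedComp c) : (sorted X).Admissible := by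
  induction X with
  | nil => exact ⟨by simp [sorted], by simp [sorted, heights]⟩
  | cons c X ih =>
    refine (admissible_append_map (lt_bound _) _).2 ⟨admissible_zipIdx.2 (hX c (by simp)), ih ?_⟩
    exact fun d hd => hX d (by simp [hd])

/-- Modulo `ħ`, the height-liftings generate the quantized necklace algebra. -/
theorem map_mem_of_cycWord_mem (hq : ∀ z, q ((X : K[X]) • z) = 0) (B : Subalgebra K A)
    (hB : ∀ v l, cycWord q v l ∈ B) (z : QN K V) : q z ∈ B := by
  induction z using QN.induction with
  | zero => rw [map_zero]; exact zero_mem B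
  | add x y hx hy => rw [map_add]; exact add_mem hx hy
  | smul c x hx => rw [map_smul_of_map_X_smul q hq]; exact B.smul_mem hx _
  | mono X hX =>
  -- Strong induction on the number of components: each exchange on the way to the sorted monomial
  -- costs only monomials with fewer components.
  obtain ⟨n, hn⟩ : ∃ n, X.length = n := ⟨_, rfl⟩
  induction n using Nat.strong_induction_on generalizing X with
  | _ n ih =>
  have hlen : (sorted X).length = n := by
    have := congrArg List.length (map_arrows_sorted X)
    rw [List.length_map, List.length_map] at this
    rw [this, hn]
  have hS : (sorted X).Admissible := admissible_sorted hX.1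
  obtain ⟨η, hη⟩ := exists_relabel (map_arrows_sorted X) hS.2
  have hT : ∀ j, j ∈ (heights (sorted X)).toFinset ↔ j ∈ heights (sorted X) :=
    fun j => List.mem_toFinset
  -- Modulo `B` the class is invariant under adjacent exchanges by the induction hypothesis, and the
  -- sorted monomial, a product of cyclic words, lies in `B`.
  let W : Submodule K A := Subalgebra.toSubmodule B
  have key := eq_of_adjacent_swap (heights (sorted X)).toFinset
    (fun η => W.mkQ (q (QN.mono (mapHeights η (sorted X))))) ?_ ?_ η ?_
  · rw [← hη, mapHeights_id (f := id) fun _ _ => rfl, ← sub_eq_zero, ← map_sub, Submodule.mkQ_apply,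
      Submodule.Quotient.mk_eq_zero] at key
    have h1 := add_mem (show _ ∈ B from key) (map_mono_sorted_mem q B hB X)
    rwa [sub_add_cancel] at h1
  · intro η hη
    rw [mapHeights_id (f := id) fun _ _ => rfl, QN.mono_map]
    exact fun i hi j hj h => hη ((hT i).2 hi) ((hT j).2 hj) h
  · intro η hη i hi j hj hij hadj
    have hS' : (mapHeights η (sorted X)).Admissible := (admissible_map fun i hi j hj h =>
      hη ((hT i).2 hi) ((hT j).2 hj) h).2 hS
    have hmem : ∀ t ∈ (heights (sorted X)).toFinset, η t ∈ heights (mapHeights η (sorted X)) := by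
      intro t ht
      rw [heights_map]
      exact List.mem_map.2 ⟨t, (hT t).1 ht, rfl⟩
    have h1 := map_mono_swap_mem q hq W hS' (fun Z hZ hZl => ih _ ?_ Z hZ rfl) (hmem i hi) (hmem j hj)
      hij ?_
    · rw [mapHeights_map] at h1
      have h2 := (Submodule.Quotient.mk_eq_zero W).2 h1
      rw [← Submodule.mkQ_apply, map_sub, sub_eq_zero] at h2
      exact h2.symm
    · rwa [← hlen, ← List.length_map (as := sorted X)]
    · intro t ht
      rw [heights_map] at ht
      obtain ⟨s, hs, rfl⟩ := List.mem_map.1 ht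
      exact hadj s ((hT s).2 hs)
  · rw [hη] at hX
    have := injOn_of_nodup hX.2
    exact fun i hi j hj h => this ((hT i).1 hi) ((hT j).1 hj) h

end Spanning

end NecklaceQuantization

namespace NecklaceQuantization

open DoubleArrow PathAlgebra HMonomial

attribute [local instance] LieRing.ofAssociativeRing

/-! ### The spanning half of the Poincaré–Birkhoff–Witt theorem. -/

section Enveloping

variable {K L : Type*} [Field K] [LieRing L] [LieAlgebra K L]

open UniversalEnvelopingAlgebra

/-- The universal enveloping algebra is spanned by the products of elements of the Lie algebra. -/
theorem span_list_prod_ι : Submodule.span K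
    (Set.range fun l : List L => (l.map (ι K)).prod) = ⊤ := by
  rw [eq_top_iff]
  rintro u -
  -- By the universal property, lifting `ι` to the subalgebra it generates and including back is the
  -- identity; hence this subalgebra is everything.
  let S : Subalgebra K (UniversalEnvelopingAlgebra K L) := Algebra.adjoin K (Set.range (ι K))
  have hS : ∀ x : L, ι K x ∈ S := fun x => Algebra.subset_adjoin ⟨x, rfl⟩
  let f : L →ₗ⁅K⁆ S :=
    { toFun := fun x => ⟨ι K x, hS x⟩
      map_add' := fun x y => Subtype.ext (map_add _ _ _)
      map_smul' := fun c x => Subtype.ext (map_smul _ _ _)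
      map_lie' := fun {x y} => Subtype.ext (LieHom.map_lie (ι K) x y) }
  have h1 : S.val.comp (lift K f) = AlgHom.id K _ := by
    refine hom_ext K (LieHom.ext fun x => ?_)
    change ((lift K f (ι K x) : S) : UniversalEnvelopingAlgebra K L) = ι K x
    rw [lift_ι_apply]
    rfl
  have h2 : u ∈ S := by
    have := congrArg (fun g => g u) h1
    change ((lift K f u : S) : UniversalEnvelopingAlgebra K L) = u at this
    exact this ▸ (lift K f u).2
  have h3 : u ∈ Subalgebra.toSubmodule S := h2
  rw [Algebra.adjoin_eq_span] at h3
  refine Submodule.span_mono ?_ h3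
  intro x hx
  obtain ⟨l, hl, rfl⟩ := Submonoid.exists_list_of_mem_closure hx
  have : l ∈ Set.range (List.map (ι K : L → UniversalEnvelopingAlgebra K L)) := by
    rw [Set.range_list_map]; exact hl
  obtain ⟨l', rfl⟩ := this
  exact ⟨l', rfl⟩

/-- Exchanging neighbouring factors changes a product by one in which the two are replaced by their
bracket, hence by a shorter product. The prefix `p` makes the induction on permutations pass under
`cons`. -/
theorem prod_sub_prod_perm_mem (R : Submodule K (UniversalEnvelopingAlgebra K L)) {n : ℕ}
    (h : ∀ l : List L, l.length < n → (l.map (ι K)).prod ∈ R) {l l' : List L} (hp : l.Perm l') :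
    ∀ p : List L, p.length + l.length ≤ n →
      ((p ++ l).map (ι K)).prod - ((p ++ l').map (ι K)).prod ∈ R := by
  induction hp with
  | nil => intro p _; rw [sub_self]; exact zero_mem R
  | cons x _ ih =>
    intro p hp
    have := ih (p ++ [x]) (by simp at hp ⊢; omega)
    rwa [List.append_assoc, List.append_assoc] at this
  | swap x y l =>
    intro p hp
    have h1 := h (p ++ ⁅y, x⁆ :: l) (by simp at hp ⊢; omega)
    simp only [List.map_append, List.map_cons, List.prod_append, List.prod_cons] at h1 ⊢
    rw [LieHom.map_lie, LieRing.of_associative_ring_bracket] at h1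
    convert h1 using 1
    noncomm_ring
  | trans h1 _ ih1 ih2 =>
    intro p hp
    have h3 := add_mem (ih1 p hp) (ih2 p (by rwa [← h1.length_eq]))
    rwa [sub_add_sub_cancel] at h3

/-- The ordered monomials in a basis span the universal enveloping algebra. -/
theorem prod_mem_of_basis {I : Type*} (b : Module.Basis I K L)
    (R : Submodule K (UniversalEnvelopingAlgebra K L))
    (hR : ∀ s : Multiset I, (s.toList.map fun i => ι K (b i)).prod ∈ R) (l : List L) :
    (l.map (ι K)).prod ∈ R := by
  obtain ⟨n, hn⟩ : ∃ n, l.length = n := ⟨_, rfl⟩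
  induction n using Nat.strong_induction_on generalizing l with
  | _ n ih =>
  -- The factors are expanded in the basis one at a time: `is` indexes those already replaced, and
  -- `xs` is still arbitrary. When `xs` is empty, the product is rearranged into the order chosen by
  -- `Multiset.toList`.
  have key : ∀ (xs : List L) (is : List I), is.length + xs.length = n →
      ((is.map b ++ xs).map (ι K)).prod ∈ R := by
    intro xs
    induction xs with
    | nil =>
      intro is his
      have hp : (is.map b).Perm ((is : Multiset I).toList.map b) :=
        List.Perm.map _ (Multiset.coe_eq_coe.1 (Multiset.coe_toList _).symm)
      have h1 := prod_sub_prod_perm_mem R (n := n) (fun l hl => ih _ hl l rfl) hp []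
        (by simp at his ⊢; omega)
      simp only [List.nil_append, List.map_map, Function.comp_def] at h1
      have h2 := add_mem h1 (hR (is : Multiset I))
      rw [sub_add_cancel] at h2
      simpa only [List.append_nil, List.map_map, Function.comp_def] using h2
    | cons x xs ihx =>
      intro is his
      let f : L →ₗ[K] UniversalEnvelopingAlgebra K L :=
        (LinearMap.mulLeft K ((is.map b).map (ι K)).prod ∘ₗ
          LinearMap.mulRight K (xs.map (ι K)).prod) ∘ₗ (ι K : L →ₗ⁅K⁆ _).toLinearMap
      have hf : ∀ x, f x = ((is.map b ++ x :: xs).map (ι K)).prod := by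
        intro x
        simp only [f, LinearMap.comp_apply, LinearMap.mulLeft_apply, LinearMap.mulRight_apply,
          List.map_append, List.map_cons, List.prod_append, List.prod_cons]
        rfl
      have h1 : Submodule.span K (Set.range b) ≤ R.comap f := by
        rw [Submodule.span_le]
        rintro _ ⟨i, rfl⟩
        have h2 := ihx (is ++ [i]) (by simp at his ⊢; omega)
        change f (b i) ∈ R
        rw [hf]
        simpa only [List.map_append, List.map_cons, List.map_nil, List.append_assoc,
          List.cons_append, List.nil_append] using h2
      have h2 := h1 (b.mem_span x)
      rw [Submodule.mem_comap, hf] at h2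
      exact h2
  exact key l [] (by simpa using hn)

end Enveloping

end NecklaceQuantization

namespace NecklaceQuantization

open DoubleArrow PathAlgebra HMonomial

attribute [local instance] LieRing.ofAssociativeRing

open Polynomial

/-! ### Leading terms of symbols in a basis of the cyclic quotient. -/

section LeadingTerm

set_option linter.unusedSectionVars false

variable {V : Type*} [Quiver V] {K : Type*} [Field K] [Fintype V]

theorem toCyclic_word_append_comm {u v : V} {l m : List (DoubleArrow V)} (hl : IsPath u l v)
    (hm : IsPath v m u) :
    (toCyclic (word u (l ++ m)) : CyclicQuotient K (PathAlgebra K V)) =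
      toCyclic (word v (m ++ l)) := by
  classical
  refine (Submodule.Quotient.eq _).2 (Submodule.subset_span ⟨word u l, word v m, ?_⟩)
  rw [word_mul_word _ _ _ _ hl.1 hm.1, word_mul_word _ _ _ _ hm.1 hl.1, if_pos hl.2, if_pos hm.2]

/-- The closed paths span the cyclic quotient. -/
theorem span_toCyclic_word : ⊤ ≤ Submodule.span K {x : CyclicQuotient K (PathAlgebra K V) |
    ∃ v l, IsPath v l v ∧ x = toCyclic (word v l)} := by
  rintro x -
  obtain ⟨x, rfl⟩ := Submodule.Quotient.mk_surjective _ x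
  change toCyclic (K := K) x ∈ _
  induction x using span_induction with
  | zero => rw [map_zero]; exact zero_mem _
  | add x y hx hy => rw [map_add]; exact add_mem hx hy
  | smul c x hx => rw [map_smul]; exact Submodule.smul_mem _ _ hx
  | word v l hl =>
    by_cases h : IsPath v l v
    · exact Submodule.subset_span ⟨v, l, h, rfl⟩
    · rw [toCyclic_word_of_not h]; exact zero_mem _

variable {I : Type*} (b : Module.Basis I K (CyclicQuotient K (PathAlgebra K V)))

/-- The class of a component in the cyclic quotient, as a linear polynomial in a basis. -/
noncomputable def compPoly (c : V × List (DoubleArrow V)) : MvPolynomial I K :=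
  linPoly (b.repr (toCyclic (word c.1 c.2)))

/-- The class of a cyclic word in the cyclic quotient, as a linear polynomial in a basis. -/
noncomputable def cycPoly : HCyc V → MvPolynomial I K :=
  Quot.lift (fun c => compPoly b (c.1.1, c.1.2.map Prod.fst)) (by
    rintro ⟨c, hc⟩ ⟨d, hd⟩ ⟨v, a, l, h, h'⟩
    simp only at h h'
    subst h h'
    rw [ClosedComp, List.map_cons, isPath_cons] at hc
    simp only [compPoly]
    rw [List.map_append, ← toCyclic_word_append_comm (l := [a].map Prod.fst)
      (isPath_cons.2 ⟨rfl, isPath_nil.2 rfl⟩) (hc.1 ▸ hc.2), hc.1]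
    rfl)

theorem cycPoly_mk (c : HComp V) (hc : ClosedComp c) :
    cycPoly b (HCyc.mk c hc) = compPoly b (c.1, c.2.map Prod.fst) := rfl

theorem cycPoly_map (f : ℕ → ℕ) (x : HCyc V) : cycPoly b (HCyc.map f x) = cycPoly b x := by
  induction x using HCyc.ind with
  | h c hc =>
    rw [HCyc.map_mk, cycPoly_mk, cycPoly_mk]
    simp [mapComp, Function.comp_def]

theorem cycPoly_isHomogeneous (x : HCyc V) : (cycPoly b x).IsHomogeneous 1 := by
  induction x using HCyc.ind with
  | h c hc => exact linPoly_isHomogeneous _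

variable [CharZero K]

theorem monoPoly_isHomogeneous (X : HMonomial V) : (monoPoly K X).IsHomogeneous X.length := by
  induction X with
  | nil => exact MvPolynomial.isHomogeneous_one _ _
  | cons c X ih =>
    rw [List.length_cons, add_comm]
    exact (linPoly_isHomogeneous _).mul ih

theorem contract_pow_isHomogeneous {σ : Type*} (B : (σ →₀ K) →ₗ[K] (σ →₀ K) →ₗ[K] (σ →₀ K))
    {f : MvPolynomial σ K} {n : ℕ} (hf : f.IsHomogeneous n) (k : ℕ) :
    ((contract B ^ k) f).IsHomogeneous (n - k) := by
  induction k with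
  | zero => exact hf
  | succ k ih =>
    rw [pow_succ', Module.End.mul_apply, ← Nat.sub_sub]
    exact contract_isHomogeneous ih

theorem aeval_monoPoly {X : HMonomial V} (hX : ∀ c ∈ X, ClosedComp c) :
    MvPolynomial.aeval (cycPoly b) (monoPoly K X) =
      ((X.map fun c => (c.1, c.2.map Prod.fst)).map (compPoly b)).prod := by
  rw [monoPoly, map_list_prod, List.map_map, List.map_map, List.map_map]
  congr 1
  refine List.map_congr_left fun c hc => ?_
  simp only [Function.comp_apply]
  rw [cycClass_of (hX c hc), linPoly_single, one_smul, MvPolynomial.aeval_X, cycPoly_mk]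

/-- The leading term of the symbol is the product of the components. -/
theorem homogeneousComponent_symbol (u : ℕ → ℕ → K) {X : HMonomial V}
    (hX : ∀ c ∈ X, ClosedComp c) {d : ℕ} (hd : X.length ≤ d) :
    MvPolynomial.homogeneousComponent d (symbol (cycPoly b) u X) =
      MvPolynomial.homogeneousComponent d
        ((X.map fun c => (c.1, c.2.map Prod.fst)).map (compPoly b)).prod := by
  rw [symbol, Finset.sum_range_succ', map_add, map_sum, Finset.sum_eq_zero, zero_add]
  · rw [Nat.factorial_zero, Nat.cast_one, inv_one, one_smul, pow_zero, Module.End.one_apply,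
      aeval_monoPoly b hX]
  -- After `k + 1` contractions the degree is `X.length - (k + 1)`. Here `k < X.length ≤ d`, so this
  -- is below `d` and contributes nothing.
  · intro k hk
    have hk := Finset.mem_range.1 hk
    have h1 := (contract_pow_isHomogeneous (glueForm u) (monoPoly_isHomogeneous X) (k + 1)).aeval
      (cycPoly b) (n := 1) (cycPoly_isHomogeneous b)
    rw [map_smul, MvPolynomial.homogeneousComponent_of_mem h1, if_neg, smul_zero]
    omega

/-- Identifies a product of height-liftings with a single monomial, whose symbol is available. -/
theorem mono_sorted (w : List (V × List (DoubleArrow V))) :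
    (QN.mono (sorted (w.map fun c => (c.1, c.2.zipIdx 1))) : QN K V) =
      (w.map fun c => QN.heightLift (word c.1 c.2)).prod := by
  induction w with
  | nil => rfl
  | cons c w ih =>
    rw [List.map_cons, List.map_cons, List.prod_cons, ← ih]
    change QN.mono (above _ (sorted _)) = _
    rw [← QN.mono_mul_mono, map_fst_zipIdx]
    congr 1
    exact (map_heightLift_word (AlgHom.id K (QN K V))).symm

end LeadingTerm

/-! ### The specialization at `ħ = 0` is an enveloping algebra. -/

section Classical

set_option linter.unusedSectionVars false

variable {V : Type*} [Quiver V] {K : Type*} [Field K] [Fintype V] [Fintype (Quiver.Total V)]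
variable {A : Type*} [Ring A] [Algebra K A] (q : QN K V →ₐ[K] A)

/-- The homomorphism of Lie algebras induced by the height-lifting. -/
noncomputable def cycLieHom (hq : ∀ z, q ((X : K[X]) • z) = 0) :
    CyclicQuotient K (PathAlgebra K V) →ₗ⁅K⁆ A :=
  { cycLift q hq with
    map_lie' := fun {x y} => (cycLift_lie q hq x y).trans (LieRing.of_associative_ring_bracket _ _).symm }

/-- The homomorphism from the universal enveloping algebra induced by the height-lifting. -/
noncomputable def envelopingLift (hq : ∀ z, q ((X : K[X]) • z) = 0) :
    UniversalEnvelopingAlgebra K (CyclicQuotient K (PathAlgebra K V)) →ₐ[K] A :=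
  UniversalEnvelopingAlgebra.lift K (cycLieHom q hq)

theorem envelopingLift_ι (hq : ∀ z, q ((X : K[X]) • z) = 0) (x : PathAlgebra K V) :
    envelopingLift q hq (UniversalEnvelopingAlgebra.ι K (toCyclic x)) = q (QN.heightLift x) :=
  UniversalEnvelopingAlgebra.lift_ι_apply K _ _

theorem envelopingLift_surjective (hq : ∀ z, q ((X : K[X]) • z) = 0) (hs : Function.Surjective q) :
    Function.Surjective (envelopingLift q hq) := by
  intro a
  obtain ⟨z, rfl⟩ := hs a
  refine map_mem_of_cycWord_mem q hq (envelopingLift q hq).range (fun v l => ?_) z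
  exact ⟨UniversalEnvelopingAlgebra.ι K (toCyclic (word v l)),
    (envelopingLift_ι q hq _).trans (map_heightLift_word q)⟩

theorem prod_toList_X {I : Type*} (s : I →₀ ℕ) :
    ((Finsupp.toMultiset s).toList.map fun i => (MvPolynomial.X i : MvPolynomial I K)).prod =
      MvPolynomial.monomial s 1 := by
  rw [Multiset.prod_map_toList, Finsupp.toMultiset_map, Finsupp.prod_toMultiset,
    Finsupp.prod_mapDomain_index (fun _ => pow_zero _) (fun _ _ _ => pow_add _ _ _),
    MvPolynomial.monomial_eq, map_one, one_mul]

theorem eq_zero_of_homogeneousComponent {I : Type*} {f : MvPolynomial I K}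
    (h : MvPolynomial.homogeneousComponent f.totalDegree f = 0) : f = 0 := by
  by_contra hf
  obtain ⟨s, hs, hd⟩ := Finset.exists_mem_eq_sup _ (MvPolynomial.support_nonempty.2 hf)
    fun s : I →₀ ℕ => s.sum fun _ e => e
  have h1 := MvPolynomial.coeff_homogeneousComponent (n := f.totalDegree) (φ := f) s
  rw [h, MvPolynomial.coeff_zero, if_pos] at h1
  · exact MvPolynomial.mem_support_iff.1 hs h1.symm
  · exact hd.symm

/-- Polynomials in a basis of the cyclic quotient map onto the enveloping algebra by `σ`, and to the
quantized necklace algebra by the parallel lift `ζ`. Taking symbols after `ζ` is unitriangular with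
respect to the degree. So a polynomial whose image is divisible by `ħ`, and hence has zero symbol,
is zero. -/
theorem envelopingLift_injective [CharZero K] (hq : ∀ z, q ((X : K[X]) • z) = 0)
    (hker : ∀ z, q z = 0 → ∃ z', z = (X : K[X]) • z') :
    Function.Injective (envelopingLift q hq) := by
  classical
  -- A basis consisting of closed paths is chosen, so that its members are single height-liftings
  -- rather than combinations.
  let b := Module.Basis.ofSpan (span_toCyclic_word (K := K) (V := V))
  have hb : ∀ i, ∃ w : V × List (DoubleArrow V), IsPath w.1 w.2 w.1 ∧ b i = toCyclic (word w.1 w.2) := by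
    intro i
    obtain ⟨v, l, h⟩ := Module.Basis.ofSpan_subset (span_toCyclic_word (K := K) (V := V)) ⟨i, rfl⟩
    exact ⟨(v, l), h⟩
  choose w hw hbw using hb
  obtain ⟨Φ, hΦ, hΦX⟩ := exists_symbolQN (K := K) (cycPoly_map b)
  let ζ := (MvPolynomial.basisMonomials _ K).constr K fun s =>
    ((Finsupp.toMultiset s).toList.map fun i => (QN.heightLift (word (w i).1 (w i).2) : QN K V)).prod
  let σ := (MvPolynomial.basisMonomials _ K).constr K fun s =>
    ((Finsupp.toMultiset s).toList.map fun i => UniversalEnvelopingAlgebra.ι K (b i)).prod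
  have hζ : ∀ s, ζ (MvPolynomial.monomial s 1) = ((Finsupp.toMultiset s).toList.map fun i =>
      (QN.heightLift (word (w i).1 (w i).2) : QN K V)).prod := fun s => by
    have := Module.Basis.constr_basis (MvPolynomial.basisMonomials _ K) K (fun s =>
      ((Finsupp.toMultiset s).toList.map fun i =>
        (QN.heightLift (word (w i).1 (w i).2) : QN K V)).prod) s
    rwa [MvPolynomial.coe_basisMonomials] at this
  have hσ : ∀ s, σ (MvPolynomial.monomial s 1) = ((Finsupp.toMultiset s).toList.map fun i =>
      UniversalEnvelopingAlgebra.ι K (b i)).prod := fun s => by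
    have := Module.Basis.constr_basis (MvPolynomial.basisMonomials _ K) K (fun s =>
      ((Finsupp.toMultiset s).toList.map fun i => UniversalEnvelopingAlgebra.ι K (b i)).prod) s
    rwa [MvPolynomial.coe_basisMonomials] at this
  have hσs : ∀ u, ∃ f, σ f = u := by
    intro u
    have h1 : LinearMap.range σ = ⊤ := by
      rw [eq_top_iff, ← span_list_prod_ι, Submodule.span_le]
      rintro _ ⟨l, rfl⟩
      refine prod_mem_of_basis b _ (fun s => ?_) l
      exact ⟨MvPolynomial.monomial (Multiset.toFinsupp s) 1, by rw [hσ, Multiset.toFinsupp_toMultiset]⟩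
    exact LinearMap.range_eq_top.1 h1 u
  have hσζ : ∀ f, envelopingLift q hq (σ f) = q (ζ f) := by
    intro f
    have : (envelopingLift q hq).toLinearMap ∘ₗ σ = q.toLinearMap ∘ₗ ζ := by
      refine (MvPolynomial.basisMonomials _ K).ext fun s => ?_
      rw [MvPolynomial.coe_basisMonomials]
      simp only [LinearMap.comp_apply, AlgHom.toLinearMap_apply]
      rw [hσ, hζ, map_list_prod, map_list_prod, List.map_map, List.map_map]
      congr 1
      refine List.map_congr_left fun i _ => ?_
      simp only [Function.comp_apply]
      rw [hbw, envelopingLift_ι]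
    exact LinearMap.congr_fun this f
  let T : MvPolynomial _ K →ₗ[K] MvPolynomial _ K :=
    { toFun := fun f => Φ (ζ f)
      map_add' := fun f g => by rw [map_add, map_add]
      map_smul' := fun c f => by
        rw [map_smul, QN.smul_def, hΦ, Polynomial.coeff_C_zero]; rfl }
  -- The value of `ζ` on a monomial is a sorted monomial with `s.degree` components, whose leading
  -- symbol is the product of the corresponding variables.
  have hTs : ∀ s d, s.degree ≤ d → MvPolynomial.homogeneousComponent d
      (T (MvPolynomial.monomial s 1)) = MvPolynomial.homogeneousComponent d
        (MvPolynomial.monomial s 1) := by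
    intro s d hd
    let ws := (Finsupp.toMultiset s).toList.map w
    have hcl : ∀ c ∈ ws.map (fun c => ((c.1, c.2.zipIdx 1) : HComp V)), ClosedComp c := by
      intro c hc
      obtain ⟨c', hc', rfl⟩ := List.mem_map.1 hc
      obtain ⟨i, -, rfl⟩ := List.mem_map.1 hc'
      rw [ClosedComp, map_fst_zipIdx]
      exact hw i
    have hadm := admissible_sorted hcl
    have h1 : ζ (MvPolynomial.monomial s 1) =
        QN.mono (sorted (ws.map fun c => ((c.1, c.2.zipIdx 1) : HComp V))) := by
      rw [hζ, mono_sorted, List.map_map]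
      rfl
    have hlen : (sorted (ws.map fun c => ((c.1, c.2.zipIdx 1) : HComp V))).length = s.degree := by
      have := congrArg List.length (map_arrows_sorted (ws.map fun c => ((c.1, c.2.zipIdx 1) : HComp V)))
      simp only [List.length_map] at this
      rw [this, List.length_map, Multiset.length_toList, Finsupp.card_toMultiset]
      rfl
    have h2 : T (MvPolynomial.monomial s 1) = _ := (congrArg Φ h1).trans (hΦX _ hadm)
    rw [h2, homogeneousComponent_symbol b _ hadm.1 (hlen.le.trans hd), map_arrows_sorted,
      ← prod_toList_X, List.map_map, List.map_map, List.map_map]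
    congr 2
    refine List.map_congr_left fun i _ => ?_
    simp only [Function.comp_apply, map_fst_zipIdx]
    rw [compPoly, ← hbw, Module.Basis.repr_self, linPoly_single, one_smul]
  rw [injective_iff_map_eq_zero]
  intro u hu
  obtain ⟨f, rfl⟩ := hσs u
  rw [hσζ] at hu
  obtain ⟨z, hz⟩ := hker _ hu
  have hTf : T f = 0 := by
    change Φ (ζ f) = 0
    rw [hz, hΦ, Polynomial.coeff_X_zero, zero_smul]
  -- The operator `T` preserves the component of top degree; as `T f = 0`, this component of `f`
  -- vanishes.
  have hT : MvPolynomial.homogeneousComponent f.totalDegree (T f) =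
      MvPolynomial.homogeneousComponent f.totalDegree f := by
    conv_lhs => rw [f.as_sum]
    conv_rhs => rw [f.as_sum]
    rw [map_sum, map_sum, map_sum]
    refine Finset.sum_congr rfl fun s hs => ?_
    have hs' : MvPolynomial.monomial s (f.coeff s) = f.coeff s • MvPolynomial.monomial s (1 : K) := by
      rw [MvPolynomial.smul_monomial, smul_eq_mul, mul_one]
    rw [hs', map_smul, map_smul, map_smul, hTs s _ ?_]
    rw [← f.as_sum]
    exact MvPolynomial.le_totalDegree hs
  rw [hTf, map_zero] at hT
  rw [eq_zero_of_homogeneousComponent hT.symm, map_zero]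

end Classical

end NecklaceQuantization

namespace NecklaceQuantization

open DoubleArrow PathAlgebra HMonomial

attribute [local instance] LieRing.ofAssociativeRing

open Polynomial

/-! ### Passing to the preprojective algebra and to the reduction. -/

section Reduction

set_option linter.unusedSectionVars false

open scoped Pointwise

variable {V : Type*} [Quiver V] {K : Type*} [Field K] [Fintype V]

/-- The quotient of the quantized necklace algebra at `ħ = 0`. -/
abbrev ClassicalQN (K V : Type*) [Field K] [Quiver V] : Type _ :=
  QN K V ⧸ (TwoSidedIdeal.span {(X : K[X]) • (1 : QN K V)}).asIdeal

/-- The specialization `ħ = 0`. -/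
noncomputable def toClassical : QN K V →ₐ[K] ClassicalQN K V := Ideal.Quotient.mkₐ K _

theorem toClassical_surjective : Function.Surjective (toClassical (K := K) (V := V)) :=
  Ideal.Quotient.mk_surjective

theorem toClassical_eq_zero_iff {z : QN K V} :
    toClassical z = 0 ↔ z ∈ TwoSidedIdeal.span {(X : K[X]) • (1 : QN K V)} :=
  Ideal.Quotient.eq_zero_iff_mem.trans TwoSidedIdeal.mem_asIdeal

theorem toClassical_X_smul (z : QN K V) : toClassical ((X : K[X]) • z) = 0 := by
  rw [toClassical_eq_zero_iff, ← one_mul z, ← smul_mul_assoc]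
  exact TwoSidedIdeal.mul_mem_right _ _ _ (TwoSidedIdeal.subset_span rfl)

/-- The variable `ħ` acts centrally, so its multiples already form a two-sided ideal. -/
theorem eq_X_smul_of_toClassical {z : QN K V} (hz : toClassical z = 0) :
    ∃ z', z = (X : K[X]) • z' := by
  rw [toClassical_eq_zero_iff] at hz
  induction hz using TwoSidedIdeal.span_induction with
  | mem z hz => exact ⟨1, hz⟩
  | zero => exact ⟨0, (smul_zero _).symm⟩
  | add x y _ _ hx hy =>
    obtain ⟨x, rfl⟩ := hx
    obtain ⟨y, rfl⟩ := hy
    exact ⟨x + y, (smul_add _ _ _).symm⟩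
  | neg x _ hx =>
    obtain ⟨x, rfl⟩ := hx
    exact ⟨-x, (smul_neg _ _).symm⟩
  | left_absorb a x _ hx =>
    obtain ⟨x, rfl⟩ := hx
    exact ⟨a * x, mul_smul_comm _ _ _⟩
  | right_absorb a x _ hx =>
    obtain ⟨x, rfl⟩ := hx
    exact ⟨x * a, smul_mul_assoc _ _ _⟩

variable [Fintype (Quiver.Total V)]

/-- The projection of necklace Lie algebras `(K Q̄)_♮ → (Π Q)_♮`. -/
noncomputable def prLieHom :
    CyclicQuotient K (PathAlgebra K V) →ₗ⁅K⁆ CyclicQuotient K (Preprojective K V) :=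
  { pr with map_lie' := fun {x y} => (lie_pr x y).symm }

/-- The quantized necklace algebra maps to the universal enveloping algebra of `(Π Q)_♮`. -/
theorem exists_toEnveloping [CharZero K] :
    ∃ g : QN K V →ₐ[K] UniversalEnvelopingAlgebra K (CyclicQuotient K (Preprojective K V)),
      (∀ x, g (QN.heightLift x) = UniversalEnvelopingAlgebra.ι K (pr (toCyclic x))) ∧
        ∀ z, g ((X : K[X]) • z) = 0 := by
  -- This is the identification of the specialization at `ħ = 0` with the enveloping algebra of the
  -- necklace Lie algebra; it is inverted and followed by the map that `pr` induces.
  let θ := AlgEquiv.ofBijective (envelopingLift toClassical (toClassical_X_smul (K := K) (V := V)))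
    ⟨envelopingLift_injective _ _ fun z => eq_X_smul_of_toClassical,
      envelopingLift_surjective _ _ toClassical_surjective⟩
  let π := UniversalEnvelopingAlgebra.lift K
    ((UniversalEnvelopingAlgebra.ι K).comp (prLieHom (K := K) (V := V)))
  refine ⟨π.comp (θ.symm.toAlgHom.comp toClassical), fun x => ?_, fun z => ?_⟩
  · have h1 : θ.symm (toClassical (QN.heightLift x)) = UniversalEnvelopingAlgebra.ι K (toCyclic x) := by
      rw [AlgEquiv.symm_apply_eq]
      exact (envelopingLift_ι _ _ x).symm
    change π (θ.symm (toClassical (QN.heightLift x))) = _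
    rw [h1]
    exact UniversalEnvelopingAlgebra.lift_ι_apply K _ _
  · change π (θ.symm (toClassical _)) = 0
    rw [toClassical_X_smul, map_zero, map_zero]

theorem toCyclic_mul_comm {A : Type*} [Ring A] [Algebra K A] (x y : A) :
    (toCyclic (x * y) : CyclicQuotient K A) = toCyclic (y * x) :=
  (Submodule.Quotient.eq _).2 (Submodule.subset_span ⟨x, y, rfl⟩)

/-- The class of an element of the two-sided ideal generated by `w` is the class of some `y w`. -/
theorem exists_toCyclic_eq {z : PathAlgebra K V} (hz : z ∈ TwoSidedIdeal.span {momentMap K V}) :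
    ∃ y, (toCyclic z : CyclicQuotient K (PathAlgebra K V)) = toCyclic (y * momentMap K V) := by
  -- Quantifying over factors on both sides lets them absorb the multiplications in the induction on
  -- the ideal. For the generator, `a w b` and `b a w` have the same class.
  have key : ∀ a b : PathAlgebra K V, ∃ y,
      (toCyclic (a * z * b) : CyclicQuotient K (PathAlgebra K V)) = toCyclic (y * momentMap K V) := by
    induction hz using TwoSidedIdeal.span_induction with
    | mem z hz =>
      intro a b
      obtain rfl := Set.mem_singleton_iff.1 hz
      exact ⟨b * a, by rw [toCyclic_mul_comm, mul_assoc]⟩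
    | zero => exact fun a b => ⟨0, by simp⟩
    | add x y _ _ hx hy =>
      intro a b
      obtain ⟨x', hx⟩ := hx a b
      obtain ⟨y', hy⟩ := hy a b
      exact ⟨x' + y', by rw [mul_add, add_mul, add_mul, map_add, map_add, hx, hy]⟩
    | neg x _ hx =>
      intro a b
      obtain ⟨x', hx⟩ := hx a b
      exact ⟨-x', by rw [mul_neg, neg_mul, neg_mul, map_neg, map_neg, hx]⟩
    | left_absorb c x _ hx =>
      intro a b
      obtain ⟨x', hx⟩ := hx (a * c) b
      exact ⟨x', by rw [← mul_assoc, hx]⟩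
    | right_absorb c x _ hx =>
      intro a b
      obtain ⟨x', hx⟩ := hx a (c * b)
      exact ⟨x', by rw [← hx]; simp only [mul_assoc]⟩
  simpa using key 1 1

/-- The kernel of the projection `(K Q̄)_♮ → (Π Q)_♮` consists of the classes of the elements `y w`. -/
theorem pr_eq_zero_iff {x : CyclicQuotient K (PathAlgebra K V)} :
    pr x = 0 ↔ ∃ y : PathAlgebra K V, x = toCyclic (y * momentMap K V) := by
  constructor
  · obtain ⟨q, rfl⟩ := Submodule.Quotient.mk_surjective _ x
    intro hx
    have h1 : toPreprojective q ∈ commutatorSubmodule K (Preprojective K V) :=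
      (Submodule.Quotient.mk_eq_zero _).1 hx
    have h2 : commutatorSubmodule K (Preprojective K V) ≤
        (commutatorSubmodule K (PathAlgebra K V)).map
          (toPreprojective (K := K) (V := V)).toLinearMap := by
      rw [commutatorSubmodule, Submodule.span_le]
      rintro _ ⟨x, y, rfl⟩
      obtain ⟨x, rfl⟩ := toPreprojective_surjective x
      obtain ⟨y, rfl⟩ := toPreprojective_surjective y
      exact ⟨x * y - y * x, Submodule.subset_span ⟨x, y, rfl⟩, by simp⟩
    -- Commutators in the preprojective algebra lift to commutators in the path algebra. Subtracting
    -- such a lift `c` keeps the cyclic class and moves `q` into the ideal of `w`.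
    obtain ⟨c, hc, hcq⟩ := h2 h1
    have h3 : q - c ∈ TwoSidedIdeal.span {momentMap K V} :=
      TwoSidedIdeal.mem_asIdeal.1 ((Ideal.Quotient.eq).1 hcq.symm)
    obtain ⟨y, hy⟩ := exists_toCyclic_eq h3
    refine ⟨y, hy ▸ ?_⟩
    exact (Submodule.Quotient.eq _).2 (by simpa using hc)
  · rintro ⟨y, rfl⟩
    have h : toPreprojective (y * momentMap K V) = (0 : Preprojective K V) :=
      Ideal.Quotient.eq_zero_iff_mem.2 (TwoSidedIdeal.mem_asIdeal.2
        (TwoSidedIdeal.mul_mem_left _ _ _ (TwoSidedIdeal.subset_span rfl)))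
    change toCyclic (toPreprojective (y * momentMap K V)) = _
    rw [h, map_zero]

theorem reductionClass_eq_zero_iff {S : Set (PathAlgebra K V)} {z : QN K V} :
    reductionClass S z = 0 ↔
      ∃ z', z - (X : K[X]) • z' ∈ TwoSidedIdeal.span (QN.heightLift (K := K) '' S) := by
  have h1 : reductionClass S z = 0 ↔ Ideal.Quotient.mk
      (TwoSidedIdeal.span (QN.heightLift (K := K) '' S)).asIdeal z ∈
        (X : K[X]) • (⊤ : Submodule K[X] (QuantumReduction K V S)) :=
    Submodule.Quotient.mk_eq_zero _
  rw [h1, Submodule.mem_smul_pointwise_iff_exists]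
  constructor
  · rintro ⟨w, -, hw⟩
    obtain ⟨z', rfl⟩ := Ideal.Quotient.mk_surjective w
    exact ⟨z', TwoSidedIdeal.mem_asIdeal.1 (Ideal.Quotient.eq.1 hw.symm)⟩
  · rintro ⟨z', hz'⟩
    exact ⟨Ideal.Quotient.mk _ z', trivial,
      (Ideal.Quotient.eq.2 (TwoSidedIdeal.mem_asIdeal.2 hz')).symm⟩

/-- The class in the reduction at `ħ = 0`, as a linear map. -/
noncomputable def reductionLinear (S : Set (PathAlgebra K V)) :
    QN K V →ₗ[K] ModH K (QuantumReduction K V S) where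
  toFun := reductionClass S
  map_add' x y := by rw [reductionClass, map_add, map_add]; rfl
  map_smul' c x := (ModH.mk (K := K)).map_smul (C c) (Ideal.Quotient.mk _ x)

theorem reductionLinear_surjective (S : Set (PathAlgebra K V)) :
    Function.Surjective (reductionLinear (K := K) S) := by
  intro y
  obtain ⟨w, rfl⟩ := Submodule.Quotient.mk_surjective _ y
  obtain ⟨z, rfl⟩ := Ideal.Quotient.mk_surjective w
  exact ⟨z, rfl⟩

/-- Dividing first by `S` and then by `ħ` kills everything that dividing by both at once does; the
centrality of `ħ` lets the correction term be carried through products. -/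
theorem reductionClass_eq_zero_of_mem_span {S : Set (PathAlgebra K V)} {z : QN K V}
    (hz : z ∈ TwoSidedIdeal.span (QN.heightLift (K := K) '' S ∪ {(X : K[X]) • (1 : QN K V)})) :
    reductionClass S z = 0 := by
  rw [reductionClass_eq_zero_iff]
  induction hz using TwoSidedIdeal.span_induction with
  | mem z hz =>
    rcases hz with hz | hz
    · exact ⟨0, by rw [smul_zero, sub_zero]; exact TwoSidedIdeal.subset_span hz⟩
    · exact ⟨1, by rw [Set.mem_singleton_iff.1 hz, sub_self]; exact zero_mem _⟩
  | zero => exact ⟨0, by rw [smul_zero, sub_zero]; exact zero_mem _⟩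
  | add x y _ _ hx hy =>
    obtain ⟨x', hx⟩ := hx
    obtain ⟨y', hy⟩ := hy
    exact ⟨x' + y', by rw [smul_add, add_sub_add_comm]; exact add_mem hx hy⟩
  | neg x _ hx =>
    obtain ⟨x', hx⟩ := hx
    exact ⟨-x', by rw [smul_neg, ← neg_sub']; exact neg_mem hx⟩
  | left_absorb a x _ hx =>
    obtain ⟨x', hx⟩ := hx
    refine ⟨a * x', ?_⟩
    rw [← mul_smul_comm, ← mul_sub]
    exact TwoSidedIdeal.mul_mem_left _ _ _ hx
  | right_absorb a x _ hx =>
    obtain ⟨x', hx⟩ := hx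
    refine ⟨x' * a, ?_⟩
    rw [← smul_mul_assoc, ← sub_mul]
    exact TwoSidedIdeal.mul_mem_right _ _ _ hx

/-- Homomorphisms from the quantized necklace algebra which kill `ħ` are determined by the
height-liftings. -/
theorem algHom_ext_heightLift {A : Type*} [Ring A] [Algebra K A] {f g : QN K V →ₐ[K] A}
    (hf : ∀ z, f ((X : K[X]) • z) = 0) (hg : ∀ z, g ((X : K[X]) • z) = 0)
    (h : ∀ x, f (QN.heightLift x) = g (QN.heightLift x)) (z : QN K V) : f z = g z := by
  -- The generation statement is applied to the pair `(f, g)` with values in `A × A` and to the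
  -- subalgebra where both coordinates agree.
  refine map_mem_of_cycWord_mem (f.prod g) (fun z => Prod.ext (hf z) (hg z))
    (AlgHom.equalizer (AlgHom.fst K A A) (AlgHom.snd K A A)) (fun v l => ?_) z
  rw [← map_heightLift_word]
  exact h _

/-- Homomorphisms of Lie algebras factor through the projection `(K Q̄)_♮ → (Π Q)_♮` if they vanish
on its kernel. -/
theorem exists_envelopingLift_pr {A : Type*} [Ring A] [Algebra K A]
    (f : CyclicQuotient K (PathAlgebra K V) →ₗ⁅K⁆ A) (hf : ∀ x, pr x = 0 → f x = 0) :
    ∃ F : UniversalEnvelopingAlgebra K (CyclicQuotient K (Preprojective K V)) →ₐ[K] A,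
      ∀ x, F (UniversalEnvelopingAlgebra.ι K (pr x)) = f x := by
  let e := (pr (K := K) (V := V)).quotKerEquivOfSurjective pr_surjective
  let f₀ : CyclicQuotient K (Preprojective K V) →ₗ[K] A :=
    ((LinearMap.ker (pr (K := K) (V := V))).liftQ f.toLinearMap hf) ∘ₗ e.symm.toLinearMap
  have hf₀ : ∀ x, f₀ (pr x) = f x := by
    intro x
    have : e.symm (pr x) = Submodule.Quotient.mk x := by
      rw [LinearEquiv.symm_apply_eq]
      rfl
    change ((LinearMap.ker (pr (K := K) (V := V))).liftQ f.toLinearMap hf) (e.symm (pr x)) = f x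
    rw [this]
    rfl
  let f₁ : CyclicQuotient K (Preprojective K V) →ₗ⁅K⁆ A :=
    { f₀ with
      map_lie' := fun {x y} => by
        obtain ⟨x, rfl⟩ := pr_surjective x
        obtain ⟨y, rfl⟩ := pr_surjective y
        change f₀ ⁅pr x, pr y⁆ = ⁅f₀ (pr x), f₀ (pr y)⁆
        rw [lie_pr, hf₀, hf₀, hf₀, LieHom.map_lie] }
  exact ⟨UniversalEnvelopingAlgebra.lift K f₁, fun x =>
    (UniversalEnvelopingAlgebra.lift_ι_apply K f₁ (pr x)).trans (hf₀ x)⟩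

/-- The two descriptions of the reduction at `ħ = 0` are quotients by the same ideal. -/
theorem toEnveloping_eq_zero_iff {S : Set (PathAlgebra K V)} (hS : RepresentsMoment S)
    {g : QN K V →ₐ[K] UniversalEnvelopingAlgebra K (CyclicQuotient K (Preprojective K V))}
    (hg : ∀ x, g (QN.heightLift x) = UniversalEnvelopingAlgebra.ι K (pr (toCyclic x)))
    (hgX : ∀ z, g ((X : K[X]) • z) = 0) (z : QN K V) : g z = 0 ↔ reductionClass S z = 0 := by
  constructor
  · intro hz
    -- Imposing `ħ = 0` and `S = 0` simultaneously gives an algebra quotient `q` in which the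
    -- enveloping algebra can be mapped.
    let J := TwoSidedIdeal.span (QN.heightLift (K := K) '' S ∪ {(X : K[X]) • (1 : QN K V)})
    let q : QN K V →ₐ[K] QN K V ⧸ J.asIdeal := Ideal.Quotient.mkₐ K _
    have hq : ∀ z, q z = 0 ↔ z ∈ J := fun z =>
      Ideal.Quotient.eq_zero_iff_mem.trans TwoSidedIdeal.mem_asIdeal
    have hqX : ∀ z, q ((X : K[X]) • z) = 0 := by
      intro z
      rw [hq, ← one_mul z, ← smul_mul_assoc]
      exact TwoSidedIdeal.mul_mem_right _ _ _ (TwoSidedIdeal.subset_span (Or.inr rfl))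
    -- An element of the kernel of `pr` has the class of some `y w`, hence of some `s` in `S`. Since
    -- `q` kills `ħ`, its value on a lifting depends only on this class, and it is zero on the
    -- lifting of `s`.
    obtain ⟨F, hF⟩ := exists_envelopingLift_pr (cycLieHom q hqX) (by
      intro x hx
      obtain ⟨y, rfl⟩ := pr_eq_zero_iff.1 hx
      have h1 : (toCyclic (y * momentMap K V) : CyclicQuotient K (PathAlgebra K V)) ∈
          toCyclic (K := K) '' Set.range fun y => y * momentMap K V := ⟨_, ⟨y, rfl⟩, rfl⟩
      rw [← hS] at h1
      obtain ⟨s, hs, hsy⟩ := h1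
      rw [← hsy]
      exact (hq _).2 (TwoSidedIdeal.subset_span (Or.inl ⟨s, hs, rfl⟩)))
    -- Both `q` and `F ∘ g` kill `ħ` and agree on height-liftings, so `q` factors through `g`.
    have h2 : q z = F (g z) := algHom_ext_heightLift (f := q) (g := F.comp g) hqX
      (fun z => by rw [AlgHom.comp_apply, hgX, map_zero])
      (fun x => by rw [AlgHom.comp_apply, hg, hF]; rfl) z
    rw [hz, map_zero, hq] at h2
    exact reductionClass_eq_zero_of_mem_span h2
  · intro hz
    obtain ⟨z', hz'⟩ := reductionClass_eq_zero_iff.1 hz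
    have h1 : ∀ w ∈ TwoSidedIdeal.span (QN.heightLift (K := K) '' S), g w = 0 := by
      intro w hw
      induction hw using TwoSidedIdeal.span_induction with
      | mem w hw =>
        obtain ⟨s, hs, rfl⟩ := hw
        have h2 : (toCyclic s : CyclicQuotient K (PathAlgebra K V)) ∈ toCyclic (K := K) '' S :=
          ⟨s, hs, rfl⟩
        rw [hS] at h2
        obtain ⟨_, ⟨y, rfl⟩, hy⟩ := h2
        rw [hg, pr_eq_zero_iff.2 ⟨y, hy.symm⟩, map_zero]
      | zero => exact map_zero g
      | add x y _ _ hx hy => rw [map_add, hx, hy, add_zero]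
      | neg x _ hx => rw [map_neg, hx, neg_zero]
      | left_absorb a x _ hx => rw [map_mul, hx, mul_zero]
      | right_absorb a x _ hx => rw [map_mul, hx, zero_mul]
    have := h1 _ hz'
    rwa [map_sub, hgX, sub_zero] at this

theorem toEnveloping_prod
    {g : QN K V →ₐ[K] UniversalEnvelopingAlgebra K (CyclicQuotient K (Preprojective K V))}
    (hg : ∀ x, g (QN.heightLift x) = UniversalEnvelopingAlgebra.ι K (pr (toCyclic x)))
    (xs : List (PathAlgebra K V)) : g ((xs.map fun x => QN.heightLift x).prod) =
      (xs.map fun x => UniversalEnvelopingAlgebra.ι K (pr (toCyclic x))).prod := by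
  rw [map_list_prod, List.map_map]
  congr 1
  exact List.map_congr_left fun x _ => hg x

theorem span_prod_pr : Submodule.span K (Set.range fun xs : List (PathAlgebra K V) =>
    (xs.map fun x => UniversalEnvelopingAlgebra.ι K (pr (toCyclic x))).prod) = ⊤ := by
  rw [eq_top_iff, ← span_list_prod_ι]
  refine Submodule.span_mono ?_
  rintro _ ⟨l, rfl⟩
  have hs : Function.Surjective fun x : PathAlgebra K V => pr (K := K) (toCyclic x) :=
    pr_surjective.comp (Submodule.Quotient.mk_surjective _)
  obtain ⟨xs, rfl⟩ := List.map_surjective_iff.2 hs l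
  exact ⟨xs, by simp only [List.map_map, Function.comp_def]⟩

end Reduction

end NecklaceQuantization
-- The theorem: two surjections with the same kernel.
open NecklaceQuantization NecklaceQuantization.PathAlgebra in
theorem mainTheorem2 (K : Type*) [Field K] [IsAlgClosed K] [CharZero K]
    (V : Type*) [Quiver V] [Fintype V] [Fintype (Quiver.Total V)]
    (S : Set (PathAlgebra K V)) (hS : RepresentsMoment S) :
    ∃! v : UniversalEnvelopingAlgebra K (CyclicQuotient K (Preprojective K V)) ≃ₗ[K]
        ModH K (QuantumReduction K V S),
      ∀ xs : List (PathAlgebra K V),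
        v ((xs.map fun x => UniversalEnvelopingAlgebra.ι K (pr (toCyclic x))).prod) =
          reductionClass S ((xs.map fun x => QN.heightLift x).prod) := by
  obtain ⟨g, hg, hgX⟩ := exists_toEnveloping (K := K) (V := V)
  have hsurj : Function.Surjective g.toLinearMap := by
    rw [← LinearMap.range_eq_top, eq_top_iff, ← span_prod_pr, Submodule.span_le]
    rintro _ ⟨xs, rfl⟩
    exact ⟨_, toEnveloping_prod hg xs⟩
  have hker : LinearMap.ker g.toLinearMap = LinearMap.ker (reductionLinear S) :=
    Submodule.ext fun z => toEnveloping_eq_zero_iff hS hg hgX z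
  -- Both targets are identified with the quotient of the quantized necklace algebra by the common
  -- kernel of `g` and `reductionLinear S`.
  let v := (g.toLinearMap.quotKerEquivOfSurjective hsurj).symm ≪≫ₗ Submodule.quotEquivOfEq _ _ hker ≪≫ₗ
    (reductionLinear S).quotKerEquivOfSurjective (reductionLinear_surjective S)
  have hv : ∀ z, v (g z) = reductionClass S z := by
    intro z
    have h1 : (g.toLinearMap.quotKerEquivOfSurjective hsurj).symm (g z) = Submodule.Quotient.mk z := by
      rw [LinearEquiv.symm_apply_eq]
      rfl
    simp only [v, LinearEquiv.trans_apply]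
    rw [h1]
    rfl
  refine ⟨v, fun xs => ?_, fun v' hv' => ?_⟩
  · rw [← toEnveloping_prod hg, hv]
  -- The prescribed formula fixes a linear map on the products, and these span the enveloping
  -- algebra.
  · refine LinearEquiv.toLinearMap_injective (LinearMap.ext_on_range span_prod_pr fun xs => ?_)
    change v' _ = v _
    rw [hv', ← toEnveloping_prod hg, hv]
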